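/- **Setting.** Let $n\ge 2$ and let $\Phi=\{\pm(e_i\pm e_j): 1\le i<j\le n\}$ be the root system of type $D_n$ with simple roots $\alpha_0=e_1+e_2$ and $\alpha_i=e_{i+1}-e_i$ for $1\le i\le n-1$. Its Weyl group is the group $\mathcal D_n$ of all bijections $\sigma$ of $\{\pm1,\dots,\pm n\}$ such that $\sigma(-i)=-\sigma(i)$ for all $i$ and such that the number of negative entries among $\sigma(1),\dots,\sigma(n)$ is even. It acts linearly by $\sigma(e_i)=e_{\sigma(i)}$, where $e_{-i}:=-e_i$. Its Coxeter generators are $s_0=(1,-2)(2,-1)$ and $s_i=(i,i+1)(-i,-(i+1))$ for $1\le i\le n-1$. The length $\ell(\sigma)$ is the number of positive roots that $\sigma$ sends to negative roots. The odd length $L(\sigma)$ is the number of positive roots of odd height (sum of the coefficients with respect to the simple roots) that $\sigma$ sends to negative roots. For $I\subseteq[0,n-1]=\{0,1,\dots,n-1\}$ put $$\mathcal D_n^I=\{\sigma\in\mathcal D_n:\ \ell(\sigma s_i)>\ell(\sigma)\text{ for all } i\in I\},\qquad \mathcal D_n^I(x)=\sum_{\sigma\in\mathcal D_n^I}(-1)^{\ell(\sigma)}x^{L(\sigma)}\in\mathbb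 Z[x].$$ The connected components of $I$ are its maximal nonempty intervals of consecutive integers. Let $I_0$ be the component containing $0$ (with $I_0=\emptyset$ if $0\notin I$), and let $I_1,\dots,I_s$ be the other components. Put $[k]_q=\frac{1-q^k}{1-q}$, $[k]_q!=\prod_{i=1}^k[i]_q$ (so $[0]_q!=1$), and $$m_I=\sum_{k=0}^{s}\Big\lfloor\frac{|I_k|+1}{2}\Big\rfloor,\qquad C_I=\frac{[m_I]_{x^2}!}{\prod_{k=0}^s\big[\lfloor\frac{|I_k|+1}{2}\rfloor\big]_{x^2}!}.$$ Call a polynomial in $\mathbb Z[x]$ a *product of cyclotomic polynomials* if, up to a sign $\pm1$, it is a (possibly empty) product of cyclotomic polynomials. **Theorem.** Let $n\geq2$ and let $I$ be a proper subset of $[0,n-1]$. Then $\mathcal D_n^I(x)$ is not a product of cyclotomic polynomials if and only if $n$ is even and $\{0\}\cup\{i\in[1,n-1]: i \text{ odd}\}\subseteq I$. In this case $$\mathcal D_n^I(x)=C_I\;\frac{1+x^{|I_0|}+2x^{n/2}}{1+x^{n/2}}\;\prod_{i=|I_0|+2}^{n}\left(1+(-1)^{i-1}x^{\lfloor i/2\rfloor}\right),$$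 where the product is $1$ if it is empty. Moreover, exactly one of the factors in this formula is not a product of cyclotomic polynomials. Namely, $C_I$, $1+x^{n/2}$ and each $1+(-1)^{i-1}x^{\lfloor i/2\rfloor}$ with $|I_0|+2\le i\le n$ are products of cyclotomic polynomials, whereas $x^{a}+2x^{b}+1$ with $a=|I_0|>0$ and $b=n/2>0$ is not. -/

import Mathlib

open Polynomial

namespace TypeD

/-! ### The root system of type `D_n`

The ambient lattice is `ℤⁿ = (Fin n → ℤ)`; the `j`-th coordinate (`j : Fin n`) belongs to
the standard basis vector `e_{j+1}`. -/

/-- The vector `e_a` for an integer `a`, with the convention `e_{-a} = -e_a`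
(it is the zero vector if `a = 0` or `|a| > n`). -/
def e (n : ℕ) (a : ℤ) : Fin n → ℤ :=
  fun j => if a = (j : ℤ) + 1 then 1 else if a = -((j : ℤ) + 1) then -1 else 0

/-- The root system `Φ = {±(e_i ± e_j) | 1 ≤ i < j ≤ n}` of type `D_n`. -/
def roots (n : ℕ) : Set (Fin n → ℤ) :=
  {v | ∃ i j : ℤ, 1 ≤ i ∧ i < j ∧ j ≤ n ∧
    (v = e n i + e n j ∨ v = -(e n i + e n j) ∨ v = e n i - e n j ∨ v = -(e n i - e n j))}

/-- The simple roots `α_0 = e_1 + e_2` and `α_i = e_{i+1} - e_i` for `1 ≤ i ≤ n - 1`. -/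
def simpleRoot (n i : ℕ) : Fin n → ℤ :=
  if i = 0 then e n 1 + e n 2 else e n ((i : ℤ) + 1) - e n i

/-- The positive roots: the roots that are nonnegative combinations of simple roots. -/
def posRoots (n : ℕ) : Set (Fin n → ℤ) :=
  {v | v ∈ roots n ∧ ∃ c : ℕ → ℕ, v = ∑ k ∈ Finset.range n, (c k : ℤ) • simpleRoot n k}

/-- The negative roots `Φ⁻ = -Φ⁺`. -/
def negRoots (n : ℕ) : Set (Fin n → ℤ) := {v | -v ∈ posRoots n}

/-- `HasHeight n v h`: the vector `v` is an integral combination of simple roots whose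
coefficients sum to `h`, i.e. `ht(v) = h`. (For `n ≥ 2` the simple roots are linearly
independent, so such an `h` is unique.) -/
def HasHeight (n : ℕ) (v : Fin n → ℤ) (h : ℤ) : Prop :=
  ∃ c : ℕ → ℤ, v = ∑ k ∈ Finset.range n, c k • simpleRoot n k ∧
    ∑ k ∈ Finset.range n, c k = h

/-! ### The even hyperoctahedral group `𝒟_n` -/

/-- The set `[n]_± = {-n, …, -1, 1, …, n}`. -/
abbrev SignedIdx (n : ℕ) : Type :=
  {a : ℤ // a ∈ (Finset.Icc (-(n : ℤ)) (n : ℤ)).erase 0}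

/-- The element `j + 1` of `[n]_±`, for `j : Fin n`. -/
def posIdx {n : ℕ} (j : Fin n) : SignedIdx n :=
  ⟨(j : ℤ) + 1, by
    have := j.isLt
    simp only [Finset.mem_erase, Finset.mem_Icc]
    omega⟩

/-- A bijection `σ` of `[n]_±` is a signed permutation if `σ(-a) = -σ(a)` for all `a`. -/
def IsSigned {n : ℕ} (σ : Equiv.Perm (SignedIdx n)) : Prop :=
  ∀ a b : SignedIdx n, (b : ℤ) = -(a : ℤ) → (σ b : ℤ) = -(σ a : ℤ)

/-- The number of negative entries in the one-line notation `σ(1) σ(2) ⋯ σ(n)`. -/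
def negCount {n : ℕ} (σ : Equiv.Perm (SignedIdx n)) : ℕ :=
  (Finset.univ.filter (fun j : Fin n => (σ (posIdx j) : ℤ) < 0)).card

/-- The elements of the even hyperoctahedral group `𝒟_n`: the signed permutations with an
even number of negative entries. -/
def IsEvenSigned {n : ℕ} (σ : Equiv.Perm (SignedIdx n)) : Prop :=
  IsSigned σ ∧ Even (negCount σ)

/-- The transposition `(a, b)` of `[n]_±` (the identity if `a` or `b` is not in `[n]_±`). -/
noncomputable def transp (n : ℕ) (a b : ℤ) : Equiv.Perm (SignedIdx n) :=
  if h : a ∈ (Finset.Icc (-(n : ℤ)) (n : ℤ)).erase 0 ∧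
      b ∈ (Finset.Icc (-(n : ℤ)) (n : ℤ)).erase 0 then
    Equiv.swap ⟨a, h.1⟩ ⟨b, h.2⟩
  else 1

/-- The Coxeter generators `s_0 = (1, -2)(2, -1)` and `s_i = (i, i+1)(-i, -(i+1))` for
`1 ≤ i ≤ n - 1`. -/
noncomputable def gen (n i : ℕ) : Equiv.Perm (SignedIdx n) :=
  if i = 0 then transp n 1 (-2) * transp n 2 (-1)
  else transp n i ((i : ℤ) + 1) * transp n (-(i : ℤ)) (-((i : ℤ) + 1))

/-- The linear action of a signed permutation on `ℤⁿ`, determined by `σ(e_i) = e_{σ(i)}`. -/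
def act {n : ℕ} (σ : Equiv.Perm (SignedIdx n)) (v : Fin n → ℤ) : Fin n → ℤ :=
  ∑ j : Fin n, v j • e n (σ (posIdx j))

/-- The Coxeter length `ℓ(σ)`: the number of positive roots sent to negative roots. -/
noncomputable def len {n : ℕ} (σ : Equiv.Perm (SignedIdx n)) : ℕ :=
  Set.ncard {v | v ∈ posRoots n ∧ act σ v ∈ negRoots n}

/-- The odd length `L(σ)`: the number of positive roots of odd height sent to negative
roots. -/
noncomputable def oddLen {n : ℕ} (σ : Equiv.Perm (SignedIdx n)) : ℕ :=
  Set.ncard {v | v ∈ posRoots n ∧ (∃ h : ℤ, HasHeight n v h ∧ Odd h) ∧ act σ v ∈ negRoots n}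

/-- Membership in the parabolic quotient
`𝒟_n^I = {σ ∈ 𝒟_n | ℓ(σ s_i) > ℓ(σ) for all i ∈ I}`. -/
def InQuotient {n : ℕ} (I : Finset ℕ) (σ : Equiv.Perm (SignedIdx n)) : Prop :=
  IsEvenSigned σ ∧ ∀ i ∈ I, len σ < len (σ * gen n i)

open scoped Classical in
/-- The sign-twisted generating function
`𝒟_n^I(x) = ∑_{σ ∈ 𝒟_n^I} (-1)^{ℓ(σ)} x^{L(σ)}`. -/
noncomputable def genFun (n : ℕ) (I : Finset ℕ) : ℤ[X] :=
  ∑ σ ∈ Finset.univ.filter (fun σ : Equiv.Perm (SignedIdx n) => InQuotient I σ),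
    (-1) ^ len σ * X ^ oddLen σ

/-! ### Connected components and `C_I` -/

/-- The connected component of `i` in `I`: the `j ∈ I` such that the whole interval between
`i` and `j` lies in `I`; it is empty if `i ∉ I`. In particular `comp I 0` is `I_0`. -/
def comp (I : Finset ℕ) (i : ℕ) : Finset ℕ := I.filter (fun j => Finset.uIcc i j ⊆ I)

/-- The set of the nonempty connected components of `I`. -/
def components (I : Finset ℕ) : Finset (Finset ℕ) := I.image (comp I)

/-- `[k]_q = (1 - q^k) / (1 - q)`. -/
noncomputable def qNum (q : RatFunc ℤ) (k : ℕ) : RatFunc ℤ := (1 - q ^ k) / (1 - q)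

/-- `[k]_q! = [1]_q [2]_q ⋯ [k]_q`. -/
noncomputable def qFactorial (q : RatFunc ℤ) (k : ℕ) : RatFunc ℤ :=
  ∏ i ∈ Finset.Icc 1 k, qNum q i

/-- `m_I = ∑_k ⌊(|I_k| + 1) / 2⌋`, over the connected components of `I` (an empty `I_0`
contributes `0`). -/
def m (I : Finset ℕ) : ℕ := ∑ J ∈ components I, (J.card + 1) / 2

/-- The `q`-multinomial coefficient `C_I`, with `q = x^2`, of `m_I` over the numbers
`⌊(|I_k| + 1) / 2⌋` (an empty `I_0` contributes the factor `[0]_q! = 1`). -/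
noncomputable def C (I : Finset ℕ) : RatFunc ℤ :=
  qFactorial (RatFunc.X ^ 2) (m I) /
    ∏ J ∈ components I, qFactorial (RatFunc.X ^ 2) ((J.card + 1) / 2)

/-! ### Products of cyclotomic polynomials -/

/-- `p` is, up to sign, a (possibly empty) product of cyclotomic polynomials. -/
def IsCyclotomicProduct (p : ℤ[X]) : Prop :=
  ∃ s : Multiset ℕ, (∀ d ∈ s, 0 < d) ∧
    (p = (s.map (fun d => cyclotomic d ℤ)).prod ∨
      p = -(s.map (fun d => cyclotomic d ℤ)).prod)

end TypeD

/-!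
A signed permutation is written as a word `σ(1) ⋯ σ(n)`. Two positions `i < j` of the word carry
the two positive roots `e_j ± e_i`, and the height of both has the parity of `i + j`. So
`(-1)^ℓ x^L` is a product over pairs of positions (`neg_one_pow_len_mul`), in which an inverted
root contributes `-1` if the positions have the same parity and `-x` otherwise. This product does
not change when the values `1` and `-1` are exchanged, nor when the first entry changes its sign.
The first symmetry extends the sum from `𝒟_n` to all signed permutations (`two_mul_genFun`); the
second one exchanges the ascent conditions for `0` and `1`, and it makes the first entry positive
if both of them are imposed.

As a result, up to a factor `2`, the generating function is a sum `flagSum` over all words that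
consist of an increasing block of `c` positive letters, followed by increasing blocks of signed
letters. Here `c = |I_0|` if `0, 1 ∈ I`, and `c = 0` otherwise; the sizes `d` of the other blocks
exceed those of the remaining components by one, and blocks of size `1` belong to no component
(`exists_blocks`). In the remaining case, `0 ∈ I` and `1 ∉ I`, the second symmetry replaces `0` by
`1`.

The sum is evaluated by merging blocks. Put `y = x^2`. A signed block of even size can be merged
into the block before it at the cost of a `y`-binomial coefficient (`mergeSum_aux`, by removing
the smallest letter), and an even block followed by a single letter is equivalent to one odd block
(`sumWords_even_one`). In this way all blocks collect in one block of even size and one single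
letter for each odd block (`flagSum_collect`), and these single letters move freely across blocks
of even size. A signed block is then merged with the positive block by removing the letter with
the largest absolute value (`blockSum_aux`). If `c` is odd, or if some other block has odd size,
the result is a product of factors `1 ± x^k` (`flagSum_odd`, `flagSum_even_of_odd`), and hence of
cyclotomic polynomials. If `c` and all other block sizes are even, the factor
`1 + x^c + 2 x^(n/2)` appears (`flagSum_even_of_even`); for `c = 0` it is `2 (1 + x^(n/2))`, in
which the `2` cancels. The blocks are even in this sense, with `c > 0`, if and only if `n` is even
and `I` contains `0` and all odd numbers below `n` (`isCyclotomicProduct_or_exists`).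

For `0 < a < 2 b` the polynomial `x^a + 2 x^b + 1` is not a product of cyclotomic polynomials
(`not_isCyclotomicProduct_trinomial`): a root `z` with `|z| = 1` satisfies `z^a + 1 = -2 z^b`, so
the triangle inequality forces `z^a = 1` and `z^b = -1`. All roots are simple since `a ≠ 2 b`, and
there are too few such `z`. Since `ℤ[x]` is a domain in which cyclotomic polynomials are prime, a
polynomial that becomes a product of cyclotomic polynomials when it is multiplied by such a
product is one itself (`IsCyclotomicProduct.of_mul`). This transfers the conclusion from the
evaluated sums, which are multiplied by the `y`-factorials of the blocks, to the generating
functions.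
-/

namespace TypeD

/-! ### Weights of words -/

/-- The number of roots among `e_j - e_i`, `e_i + e_j` (with `i < j`) that a signed permutation
with entries `a` in position `i` and `b` in position `j` sends to a negative root. -/
def pairInv (a b : ℤ) : ℕ := (if b < a then 1 else 0) + (if a + b < 0 then 1 else 0)

/-- The weight of one inverted root: it changes the sign, and it contributes to the odd length
if the two positions have different parities. -/
noncomputable def invWt (p q : Bool) : ℤ[X] := if p = q then -1 else -X

/-- The product of `(-1)^ℓ x^L` over all pairs of a word. The letters carry the parity of their
position explicitly, so that letters may be removed without disturbing the weights of the
others. -/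
noncomputable def wt : List (Bool × ℤ) → ℤ[X]
  | [] => 1
  | x :: l => (l.map fun y => invWt x.1 y.1 ^ pairInv x.2 y.2).prod * wt l

/-- Place the entries of a list at consecutive positions, the first one of parity `p`. -/
def place : Bool → List ℤ → List (Bool × ℤ)
  | _, [] => []
  | p, v :: l => (p, v) :: place (!p) l

/-- The parity of the position that is `d` steps after a position of parity `p`. -/
def par (p : Bool) (d : ℕ) : Bool := xor p d.bodd

@[simp] lemma par_zero (p : Bool) : par p 0 = p := by simp [par]
@[simp] lemma par_two_mul (p : Bool) (a : ℕ) : par p (2 * a) = p := by simp [par]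
@[simp] lemma par_one (p : Bool) : par p 1 = !p := by simp [par]
lemma par_succ (p : Bool) (d : ℕ) : par p (d + 1) = par (!p) d := by
  cases p <;> cases h : d.bodd <;> simp [par, h]
lemma par_succ' (p : Bool) (d : ℕ) : par p (d + 1) = !par p d := by
  cases p <;> cases h : d.bodd <;> simp [par, h]
@[simp] lemma par_two_mul_add_one (p : Bool) (a : ℕ) : par p (2 * a + 1) = !p := by
  simp [par_succ']
lemma par_add (p : Bool) (a b : ℕ) : par p (a + b) = par (par p a) b := by
  simp [par, Nat.bodd_add]

lemma place_append (p : Bool) (s w : List ℤ) :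
    place p (s ++ w) = place p s ++ place (par p s.length) w := by
  induction s generalizing p with
  | nil => simp [place]
  | cons v s ih => simp [place, ih, par_succ]

lemma mem_place {p : Bool} {s : List ℤ} {z : Bool × ℤ} (h : z ∈ place p s) : z.2 ∈ s := by
  induction s generalizing p with
  | nil => simp [place] at h
  | cons v s ih =>
    simp only [place, List.mem_cons] at h ⊢
    rcases h with rfl | h
    · simp
    · exact Or.inr (ih h)

lemma invWt_comm (p q : Bool) : invWt p q = invWt q p := by
  simp [invWt, eq_comm]

@[simp] lemma invWt_self (p : Bool) : invWt p p = -1 := by simp [invWt]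
@[simp] lemma invWt_not_left (p : Bool) : invWt (!p) p = -X := by cases p <;> simp [invWt]
@[simp] lemma invWt_not_right (p : Bool) : invWt p (!p) = -X := by cases p <;> simp [invWt]

/-- Changing the sign of the earlier entry exchanges the two roots of a pair. -/
lemma pairInv_neg_left (a b : ℤ) : pairInv (-a) b = pairInv a b := by
  simp only [pairInv]; split_ifs <;> omega

lemma pairInv_of_lt {a b : ℤ} (h : b < a) : pairInv a b = 1 + pairInv b a := by
  simp only [pairInv]; split_ifs <;> omega

lemma wt_swap (l₁ l₂ : List (Bool × ℤ)) (x y : Bool × ℤ) (h : y.2 < x.2) :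
    wt (l₁ ++ x :: y :: l₂) = invWt x.1 y.1 * wt (l₁ ++ y :: x :: l₂) := by
  induction l₁ with
  | nil =>
    simp only [List.nil_append, wt, List.map_cons, List.prod_cons, pairInv_of_lt h, pow_add,
      pow_one, invWt_comm y.1 x.1]
    ring
  | cons z l₁ ih =>
    have hp : ((l₁ ++ x :: y :: l₂).map fun u => invWt z.1 u.1 ^ pairInv z.2 u.2).prod =
        ((l₁ ++ y :: x :: l₂).map fun u => invWt z.1 u.1 ^ pairInv z.2 u.2).prod :=
      (((List.Perm.swap y x l₂).append_left l₁).map _).prod_eq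
    simp only [List.cons_append, wt, ih, hp]
    ring

/-- A letter that is smaller than all letters of `S` may be moved to the front of `S`. -/
lemma wt_move_left (l₁ S l₂ : List (Bool × ℤ)) (y : Bool × ℤ) (h : ∀ s ∈ S, y.2 < s.2) :
    wt (l₁ ++ S ++ y :: l₂) =
      (S.map fun s => invWt s.1 y.1).prod * wt (l₁ ++ y :: S ++ l₂) := by
  induction S generalizing l₁ with
  | nil => simp
  | cons s S ih =>
    have h1 := ih (l₁ ++ [s]) fun s hs => h s (List.mem_cons_of_mem _ hs)
    have h2 := wt_swap l₁ (S ++ l₂) s y (h s List.mem_cons_self)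
    simp only [List.append_assoc, List.cons_append, List.nil_append] at h1 h2 ⊢
    rw [h1, h2, List.map_cons, List.prod_cons]
    ring

/-- A letter that is larger than all letters of `S` may be moved to the end of `S`. -/
lemma wt_move_right (l₁ S l₂ : List (Bool × ℤ)) (x : Bool × ℤ) (h : ∀ s ∈ S, s.2 < x.2) :
    wt (l₁ ++ x :: (S ++ l₂)) =
      (S.map fun s => invWt s.1 x.1).prod * wt (l₁ ++ S ++ x :: l₂) := by
  induction S generalizing l₁ with
  | nil => simp
  | cons s S ih =>
    have h1 := ih (l₁ ++ [s]) fun s hs => h s (List.mem_cons_of_mem _ hs)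
    have h2 := wt_swap l₁ (S ++ l₂) x s (h s List.mem_cons_self)
    simp only [List.append_assoc, List.cons_append, List.nil_append] at h1 h2 ⊢
    rw [h2, h1, List.map_cons, List.prod_cons, invWt_comm s.1 x.1]
    ring

/-- Changing the sign of a letter does not affect the pairs that it forms with later letters. -/
lemma wt_neg (l₁ l₂ : List (Bool × ℤ)) (q : Bool) (m : ℤ) (h : ∀ x ∈ l₁, |x.2| < m) :
    wt (l₁ ++ (q, -m) :: l₂) =
      (l₁.map fun x => invWt x.1 q).prod ^ 2 * wt (l₁ ++ (q, m) :: l₂) := by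
  induction l₁ with
  | nil => simp [wt, pairInv_neg_left]
  | cons z l₁ ih =>
    have hz := abs_lt.1 (h z List.mem_cons_self)
    have h1 : pairInv z.2 (-m) = 2 := by simp only [pairInv]; split_ifs <;> omega
    have h2 : pairInv z.2 m = 0 := by simp only [pairInv]; split_ifs <;> omega
    simp only [List.cons_append, wt, ih fun x hx => h x (List.mem_cons_of_mem _ hx),
      List.map_append, List.prod_append, List.map_cons, List.prod_cons, h1, h2]
    ring

/-- The cost of moving a letter of parity `q` across `n` letters in consecutive positions, the
first one of parity `p`. -/
noncomputable def moveWt (p q : Bool) (n : ℕ) : ℤ[X] :=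
  X ^ (n / 2) * if n.bodd then invWt p q else 1

lemma prod_invWt_place (p q : Bool) (s : List ℤ) :
    ((place p s).map fun z => invWt z.1 q).prod = moveWt p q s.length := by
  induction s generalizing p with
  | nil => simp [place, moveWt]
  | cons v s ih =>
    simp only [place, List.map_cons, List.prod_cons, ih, List.length_cons, moveWt, Nat.bodd_succ]
    rcases Nat.even_or_odd' s.length with ⟨k, hk | hk⟩
    · rw [hk, show (2 * k + 1) / 2 = k by omega, show 2 * k / 2 = k by omega]
      simp
      ring
    · rw [hk, show (2 * k + 1) / 2 = k by omega, show (2 * k + 1 + 1) / 2 = k + 1 by omega]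
      have : invWt p q * invWt (!p) q = X := by
        cases p <;> cases q <;> simp [invWt]
      simp
      linear_combination X ^ k * this

@[simp] lemma moveWt_two_mul (p q : Bool) (a : ℕ) : moveWt p q (2 * a) = X ^ a := by
  simp [moveWt]

@[simp] lemma moveWt_two_mul_add_one (p q : Bool) (a : ℕ) :
    moveWt p q (2 * a + 1) = X ^ a * invWt p q := by
  simp [moveWt, show (2 * a + 1) / 2 = a by omega]

/-- An increasing word of positive entries has no inversions. -/
lemma wt_place_of_pos (p : Bool) (s : List ℤ) (hs : s.Pairwise (· < ·)) (h0 : ∀ x ∈ s, 0 < x) :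
    wt (place p s) = 1 := by
  induction s generalizing p with
  | nil => simp [place, wt]
  | cons v s ih =>
    rw [List.pairwise_cons] at hs
    simp only [place, wt, ih (!p) hs.2 fun x hx => h0 x (List.mem_cons_of_mem _ hx), mul_one]
    apply List.prod_eq_one
    intro a ha
    obtain ⟨y, hy, rfl⟩ := List.mem_map.1 ha
    have h1 := hs.1 _ (mem_place hy)
    have h2 := h0 v List.mem_cons_self
    have : pairInv v y.2 = 0 := by simp only [pairInv]; split_ifs <;> omega
    simp [this]

/-! ### Splitting lists and enumerating signed words -/

section Splits
variable {α : Type*} {M : Type*}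

/-- All ways to split a list into a sublist of length `k` and the complementary sublist. -/
def splits : List α → ℕ → List (List α × List α)
  | l, 0 => [([], l)]
  | [], _ + 1 => []
  | x :: l, k + 1 => (splits l k).map (fun p => (x :: p.1, p.2)) ++
      (splits l (k + 1)).map (fun p => (p.1, x :: p.2))

/-- The sum of `f S C` over all splittings `(S, C)` of a list with `S` of length `k`. -/
def sumSplits [AddMonoid M] (l : List α) (k : ℕ) (f : List α → List α → M) : M :=
  ((splits l k).map fun p => f p.1 p.2).sum

section Monoid
variable [AddMonoid M]

@[simp] lemma sumSplits_zero (l : List α) (f : List α → List α → M) :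
    sumSplits l 0 f = f [] l := by
  cases l <;> simp [sumSplits, splits]

@[simp] lemma sumSplits_nil_succ (k : ℕ) (f : List α → List α → M) :
    sumSplits [] (k + 1) f = 0 := by
  simp [sumSplits, splits]

lemma sumSplits_cons (x : α) (l : List α) (k : ℕ) (f : List α → List α → M) :
    sumSplits (x :: l) (k + 1) f =
      sumSplits l k (fun S C => f (x :: S) C) + sumSplits l (k + 1) (fun S C => f S (x :: C)) := by
  simp [sumSplits, splits, Function.comp_def]

end Monoid

lemma splits_spec {l : List α} {k : ℕ} {p : List α × List α} (h : p ∈ splits l k) :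
    p.1.length = k ∧ p.1.Sublist l ∧ p.2.Sublist l ∧ (p.1 ++ p.2).Perm l := by
  induction l generalizing k p with
  | nil =>
    cases k with
    | zero => simp [splits] at h; simp [h]
    | succ k => simp [splits] at h
  | cons x l ih =>
    cases k with
    | zero => simp [splits] at h; simp [h]
    | succ k =>
      simp only [splits, List.mem_append, List.mem_map] at h
      rcases h with ⟨q, hq, rfl⟩ | ⟨q, hq, rfl⟩
      · obtain ⟨h1, h2, h3, h4⟩ := ih hq
        exact ⟨by simp [h1], h2.cons_cons x, h3.cons x, h4.cons x⟩
      · obtain ⟨h1, h2, h3, h4⟩ := ih hq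
        exact ⟨h1, h2.cons x, h3.cons_cons x, List.perm_middle.trans (h4.cons x)⟩

lemma sumSplits_congr [AddMonoid M] {l : List α} {k : ℕ} {f g : List α → List α → M}
    (h : ∀ S C, S.length = k → S.Sublist l → C.Sublist l → (S ++ C).Perm l → f S C = g S C) :
    sumSplits l k f = sumSplits l k g := by
  unfold sumSplits
  congr 1
  refine List.map_congr_left fun p hp => ?_
  obtain ⟨h1, h2, h3, h4⟩ := splits_spec hp
  exact h _ _ h1 h2 h3 h4

lemma sumSplits_eq_zero [AddMonoid M] (l : List α) (k : ℕ) (f : List α → List α → M)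
    (h : l.length < k) : sumSplits l k f = 0 := by
  have : splits l k = [] := by
    apply List.eq_nil_iff_forall_not_mem.2
    intro p hp
    obtain ⟨h1, h2, -, -⟩ := splits_spec hp
    have := h2.length_le
    omega
  simp [sumSplits, this]

lemma sumSplits_add [AddCommMonoid M] (l : List α) (k : ℕ) (f g : List α → List α → M) :
    sumSplits l k (fun S C => f S C + g S C) = sumSplits l k f + sumSplits l k g := by
  simp [sumSplits, List.sum_map_add]

lemma sumSplits_mul_left {R : Type*} [NonUnitalNonAssocSemiring R] (l : List α) (k : ℕ) (r : R)
    (f : List α → List α → R) :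
    sumSplits l k (fun S C => r * f S C) = r * sumSplits l k f := by
  simp [sumSplits, List.sum_map_mul_left]

lemma sumSplits_length [AddCommMonoid M] (l : List α) (f : List α → List α → M) :
    sumSplits l l.length f = f l [] := by
  induction l generalizing f with
  | nil => simp
  | cons x l ih =>
    rw [List.length_cons, sumSplits_cons, ih, sumSplits_eq_zero _ _ _ (Nat.lt_succ_self _),
      add_zero]

lemma sumSplits_append_singleton [AddCommMonoid M] (l : List α) (x : α) (k : ℕ)
    (f : List α → List α → M) :
    sumSplits (l ++ [x]) (k + 1) f = sumSplits l k (fun S C => f (S ++ [x]) C) +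
      sumSplits l (k + 1) (fun S C => f S (C ++ [x])) := by
  induction l generalizing k f with
  | nil =>
    cases k <;> simp [sumSplits_cons]
  | cons y l ih =>
    cases k with
    | zero =>
      simp only [List.cons_append, sumSplits_cons, sumSplits_zero, ih, List.nil_append]
      rw [add_left_comm]
    | succ k =>
      simp only [List.cons_append, sumSplits_cons, ih]
      exact add_add_add_comm _ _ _ _

/-- Splitting off `a` entries and then `b` entries amounts to splitting off `a + b` entries, which
are then split into `a` and `b` entries. -/
lemma sumSplits_assoc [AddCommMonoid M] (l : List α) (a b : ℕ)
    (f : List α → List α → List α → M) :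
    sumSplits l a (fun S C => sumSplits C b fun T E => f S T E) =
      sumSplits l (a + b) (fun U E => sumSplits U a fun S T => f S T E) := by
  induction l generalizing a b f with
  | nil =>
    cases a with
    | zero => simp
    | succ a => simp [show a + 1 + b = (a + b) + 1 by omega]
  | cons x l ih =>
    cases a with
    | zero => simp
    | succ a =>
      cases b with
      | zero =>
        simp only [sumSplits_zero, Nat.add_zero]
        refine sumSplits_congr fun S C hS _ _ _ => ?_
        have := sumSplits_length S (fun S T => f S T C)
        rw [hS] at this
        exact this.symm
      | succ b =>
        rw [show a + 1 + (b + 1) = (a + 1 + b) + 1 by omega]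
        simp only [sumSplits_cons, sumSplits_add]
        rw [ih a (b + 1), ih (a + 1) b, ih (a + 1) (b + 1), ← add_assoc,
          show a + (b + 1) = a + 1 + b by omega]
        rfl

/-- The increasing words whose absolute values are the entries of a decreasing list. -/
def signings : List ℤ → List (List ℤ)
  | [] => [[]]
  | m :: U => (signings U).map (fun s => s ++ [m]) ++ (signings U).map (fun s => -m :: s)

/-- The sum of `f` over all signings of a decreasing list. -/
def sumSignings [AddMonoid M] (U : List ℤ) (f : List ℤ → M) : M := ((signings U).map f).sum

@[simp] lemma sumSignings_nil [AddMonoid M] (f : List ℤ → M) : sumSignings [] f = f [] := by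
  simp [sumSignings, signings]

lemma sumSignings_cons [AddMonoid M] (m : ℤ) (U : List ℤ) (f : List ℤ → M) :
    sumSignings (m :: U) f =
      sumSignings U (fun s => f (s ++ [m])) + sumSignings U (fun s => f (-m :: s)) := by
  simp [sumSignings, signings, Function.comp_def]

lemma sumSignings_add [AddCommMonoid M] (U : List ℤ) (f g : List ℤ → M) :
    sumSignings U (fun s => f s + g s) = sumSignings U f + sumSignings U g := by
  simp [sumSignings, List.sum_map_add]

lemma sumSignings_mul_left {R : Type*} [NonUnitalNonAssocSemiring R] (U : List ℤ) (r : R)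
    (f : List ℤ → R) : sumSignings U (fun s => r * f s) = r * sumSignings U f := by
  simp [sumSignings, List.sum_map_mul_left]

/-- Strictly decreasing lists of positive integers. -/
def IsAbsList (U : List ℤ) : Prop := U.Pairwise (· > ·) ∧ ∀ x ∈ U, 0 < x

lemma IsAbsList.sublist {U V : List ℤ} (h : IsAbsList V) (hU : U.Sublist V) : IsAbsList U :=
  ⟨h.1.sublist hU, fun x hx => h.2 x (hU.subset hx)⟩

lemma IsAbsList.of_cons {m : ℤ} {U : List ℤ} (h : IsAbsList (m :: U)) : IsAbsList U :=
  h.sublist (List.sublist_cons_self m U)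

lemma signings_spec {U s : List ℤ} (hU : IsAbsList U) (hs : s ∈ signings U) :
    s.Pairwise (· < ·) ∧ (s.map fun v => |v|).Perm U := by
  induction U generalizing s with
  | nil => simp [signings] at hs; simp [hs]
  | cons m U ih =>
    have hm : ∀ x ∈ U, x < m := (List.pairwise_cons.1 hU.1).1
    have hm0 : 0 < m := hU.2 m List.mem_cons_self
    have key : ∀ s ∈ signings U, ∀ v ∈ s, -m < v ∧ v < m := by
      intro s hs v hv
      have := (ih hU.of_cons hs).2.subset (List.mem_map_of_mem hv)
      exact abs_lt.1 (hm _ this)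
    simp only [signings, List.mem_append, List.mem_map] at hs
    rcases hs with ⟨s, hs, rfl⟩ | ⟨s, hs, rfl⟩
    · obtain ⟨h1, h2⟩ := ih hU.of_cons hs
      refine ⟨List.pairwise_append.2 ⟨h1, List.pairwise_singleton _ _, fun a ha b hb => ?_⟩, ?_⟩
      · rw [List.mem_singleton.1 hb]; exact (key s hs a ha).2
      · rw [List.map_append, List.map_singleton, abs_of_pos hm0]
        exact List.perm_append_singleton _ _ |>.trans (h2.cons m)
    · obtain ⟨h1, h2⟩ := ih hU.of_cons hs
      refine ⟨List.pairwise_cons.2 ⟨fun a ha => (key s hs a ha).1, h1⟩, ?_⟩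
      rw [List.map_cons, abs_neg, abs_of_pos hm0]
      exact h2.cons m

lemma sumSignings_congr [AddMonoid M] {U : List ℤ} (hU : IsAbsList U) {f g : List ℤ → M}
    (h : ∀ s, s.Pairwise (· < ·) → (s.map fun v => |v|).Perm U → f s = g s) :
    sumSignings U f = sumSignings U g := by
  unfold sumSignings
  congr 1
  refine List.map_congr_left fun s hs => ?_
  obtain ⟨h1, h2⟩ := signings_spec hU hs
  exact h s h1 h2

/-- Splitting an absolute value list and then choosing signs amounts to choosing signs and then
splitting the resulting increasing word. -/
lemma sumSplits_sumSignings [AddCommMonoid M] (U : List ℤ) (k : ℕ) (f : List ℤ → List ℤ → M) :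
    sumSplits U k (fun S T => sumSignings S fun s => sumSignings T fun t => f s t) =
      sumSignings U fun u => sumSplits u k f := by
  induction U generalizing k f with
  | nil => cases k <;> simp
  | cons m U ih =>
    cases k with
    | zero => simp
    | succ k =>
      simp only [sumSplits_cons, sumSignings_cons, sumSplits_append_singleton, sumSignings_add,
        sumSplits_add, ih]
      exact add_add_add_comm _ _ _ _

lemma list_sum_comm {β : Type*} [AddCommMonoid M] (l₁ : List α) (l₂ : List β) (f : α → β → M) :
    (l₁.map fun a => (l₂.map fun b => f a b).sum).sum =
      (l₂.map fun b => (l₁.map fun a => f a b).sum).sum := by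
  induction l₁ with
  | nil => simp
  | cons x l ih => simp [ih, List.sum_map_add]

/-- The words that consist of increasing blocks of the given sizes, and whose absolute values are
the entries of `V`. -/
def words : List ℤ → List ℕ → List (List ℤ)
  | [], [] => [[]]
  | _ :: _, [] => []
  | V, d :: ds => (splits V d).flatMap fun p => (signings p.1).flatMap fun s =>
      (words p.2 ds).map fun w => s ++ w

/-- The sum of `f` over all words with the given absolute values and block sizes. -/
def sumWords [AddMonoid M] (V : List ℤ) (ds : List ℕ) (f : List ℤ → M) : M :=
  ((words V ds).map f).sum

lemma sum_map_flatMap {β : Type*} [AddMonoid M] (l : List α) (g : α → List β) (f : β → M) :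
    ((l.flatMap g).map f).sum = (l.map fun x => ((g x).map f).sum).sum := by
  induction l with
  | nil => simp
  | cons x l ih => simp [List.flatMap_cons, ih]

lemma sumWords_cons [AddMonoid M] (V : List ℤ) (d : ℕ) (ds : List ℕ) (f : List ℤ → M) :
    sumWords V (d :: ds) f =
      sumSplits V d fun S C => sumSignings S fun s => sumWords C ds fun w => f (s ++ w) := by
  have : words V (d :: ds) = (splits V d).flatMap fun p => (signings p.1).flatMap fun s =>
      (words p.2 ds).map fun w => s ++ w := by cases V <;> rfl
  simp only [sumWords, sumSplits, sumSignings, this, sum_map_flatMap, List.map_map,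
    Function.comp_def]

@[simp] lemma sumWords_nil_nil [AddMonoid M] (f : List ℤ → M) : sumWords [] [] f = f [] := by
  simp [sumWords, words]

lemma sumWords_zero_cons [AddMonoid M] (V : List ℤ) (ds : List ℕ) (f : List ℤ → M) :
    sumWords V (0 :: ds) f = sumWords V ds f := by
  simp [sumWords_cons]

lemma sumWords_mul_left {R : Type*} [NonUnitalNonAssocSemiring R] (V : List ℤ) (ds : List ℕ)
    (r : R) (f : List ℤ → R) : sumWords V ds (fun w => r * f w) = r * sumWords V ds f := by
  simp [sumWords, List.sum_map_mul_left]

lemma sumWords_add [AddCommMonoid M] (V : List ℤ) (ds : List ℕ) (f g : List ℤ → M) :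
    sumWords V ds (fun w => f w + g w) = sumWords V ds f + sumWords V ds g := by
  simp [sumWords, List.sum_map_add]

end Splits

/-! ### Merging two adjacent increasing blocks -/

/-- The polynomial `(1 - x^2)(1 - x^4) ⋯ (1 - x^{2m})`, which is `(1 - x^2)^m [m]_{x^2}!`. -/
noncomputable def qProd (m : ℕ) : ℤ[X] := ∏ j ∈ Finset.range m, (1 - X ^ (2 * (j + 1)))

@[simp] lemma qProd_zero : qProd 0 = 1 := by simp [qProd]
lemma qProd_succ (m : ℕ) : qProd (m + 1) = qProd m * (1 - X ^ (2 * (m + 1))) := by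
  simp [qProd, Finset.prod_range_succ]

/-- The sum over all ways to distribute the letters of the increasing word `u` to two increasing
blocks, the first one having `k` letters, with first positions of parities `p` and `q`. -/
noncomputable def mergeSum (l₁ : List (Bool × ℤ)) (p q : Bool) (k : ℕ) (u : List ℤ)
    (l₂ : List (Bool × ℤ)) : ℤ[X] :=
  sumSplits u k fun s t => wt (l₁ ++ place p s ++ place q t ++ l₂)

lemma mergeSum_zero (l₁ : List (Bool × ℤ)) (p q : Bool) (u : List ℤ) (l₂ : List (Bool × ℤ)) :
    mergeSum l₁ p q 0 u l₂ = wt (l₁ ++ place q u ++ l₂) := by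
  simp [mergeSum, place]

lemma mergeSum_length (l₁ : List (Bool × ℤ)) (p q : Bool) (k : ℕ) (u : List ℤ)
    (l₂ : List (Bool × ℤ)) (hk : u.length = k) :
    mergeSum l₁ p q k u l₂ = wt (l₁ ++ place p u ++ l₂) := by
  subst hk
  simp [mergeSum, place, sumSplits_length]

/-- The recursion obtained by removing the smallest letter. -/
lemma mergeSum_cons (l₁ : List (Bool × ℤ)) (p q : Bool) (k : ℕ) (m : ℤ) (u : List ℤ)
    (l₂ : List (Bool × ℤ)) (hm : ∀ x ∈ u, m < x) :
    mergeSum l₁ p q (k + 1) (m :: u) l₂ =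
      mergeSum (l₁ ++ [(p, m)]) (!p) q k u l₂ +
        moveWt p q (k + 1) * mergeSum (l₁ ++ [(q, m)]) p (!q) (k + 1) u l₂ := by
  simp only [mergeSum, sumSplits_cons, ← sumSplits_mul_left]
  congr 1
  · simp [place]
  · refine sumSplits_congr fun s t hs hsu _ _ => ?_
    have := wt_move_left l₁ (place p s) (place (!q) t ++ l₂) (q, m)
      fun z hz => hm _ (hsu.subset (mem_place hz))
    simp only [place, List.append_assoc, List.cons_append, List.nil_append] at this ⊢
    rw [this, prod_invWt_place, hs]

lemma place_cons_wt (l₁ : List (Bool × ℤ)) (p : Bool) (m : ℤ) (u : List ℤ)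
    (l₂ : List (Bool × ℤ)) :
    wt (l₁ ++ place p (m :: u) ++ l₂) = wt (l₁ ++ [(p, m)] ++ place (!p) u ++ l₂) := by
  simp [place]

/-- The merging rules for two blocks that end in positions of the same parity. The four cases
are proved together, since removing a letter leads from each of them to two others. -/
lemma mergeSum_aux (u : List ℤ) (hu : u.Pairwise (· < ·)) (l₁ l₂ : List (Bool × ℤ)) (p : Bool)
    (a b : ℕ) :
    (u.length = 2 * a + 2 * b → qProd a * qProd b * mergeSum l₁ p p (2 * a) u l₂ =
      qProd (a + b) * wt (l₁ ++ place p u ++ l₂)) ∧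
    (u.length = 2 * a + 1 + 2 * b → qProd a * qProd b * mergeSum l₁ p (!p) (2 * a + 1) u l₂ =
      qProd (a + b) * wt (l₁ ++ place p u ++ l₂)) ∧
    (u.length = 2 * a + (2 * b + 1) → qProd a * qProd b * mergeSum l₁ (!p) p (2 * a) u l₂ =
      X ^ a * qProd (a + b) * wt (l₁ ++ place p u ++ l₂)) ∧
    (u.length = 2 * a + 1 + (2 * b + 1) →
      qProd a * qProd b * mergeSum l₁ p p (2 * a + 1) u l₂ = 0) := by
  induction u generalizing l₁ p a b with
  | nil =>
    refine ⟨fun h => ?_, fun h => ?_, fun h => ?_, fun h => ?_⟩ <;> rw [List.length_nil] at h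
    · obtain ⟨rfl, rfl⟩ : a = 0 ∧ b = 0 := by omega
      simp [mergeSum_zero, place]
    all_goals omega
  | cons m u ih =>
    rw [List.pairwise_cons] at hu
    obtain ⟨hm, hu⟩ := hu
    replace ih := ih hu
    refine ⟨fun h => ?_, fun h => ?_, fun h => ?_, fun h => ?_⟩ <;>
      rw [List.length_cons] at h
    · rcases a with _ | a
      · simp [mergeSum_zero]
      rcases b with _ | b
      · rw [mergeSum_length _ _ _ _ _ _ (by simp; omega)]; simp
      have h1 := (ih (l₁ ++ [(p, m)]) (!p) a (b + 1)).2.1 (by omega)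
      have h2 := (ih (l₁ ++ [(p, m)]) (!p) (a + 1) b).2.2.1 (by omega)
      simp only [Bool.not_not] at h1 h2
      rw [show 2 * (a + 1) = 2 * a + 1 + 1 by ring] at h2 ⊢
      rw [mergeSum_cons _ _ _ _ _ _ _ hm, show 2 * a + 1 + 1 = 2 * (a + 1) by ring,
        moveWt_two_mul, place_cons_wt]
      rw [show 2 * a + 1 + 1 = 2 * (a + 1) by ring] at h2
      rw [show a + (b + 1) = a + b + 1 by ring, qProd_succ] at h1
      rw [show a + 1 + b = a + b + 1 by ring, qProd_succ] at h2
      rw [show a + 1 + (b + 1) = (a + b + 1) + 1 by ring, qProd_succ (a + b + 1),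
        qProd_succ (a + b), qProd_succ a, qProd_succ b]
      rw [qProd_succ] at h1 h2
      linear_combination (1 - X ^ (2 * (a + 1))) * h1 +
        X ^ (a + 1) * (1 - X ^ (2 * (b + 1))) * h2
    · have h1 := (ih (l₁ ++ [(p, m)]) (!p) a b).1 (by omega)
      rw [mergeSum_cons _ _ _ _ _ _ _ hm, place_cons_wt]
      rcases b with _ | b
      · rw [show mergeSum (l₁ ++ [(!p, m)]) p (!!p) (2 * a + 1) u l₂ = 0 from
          sumSplits_eq_zero _ _ _ (by omega)]
        linear_combination h1
      · have h2 := (ih (l₁ ++ [(!p, m)]) p a b).2.2.2 (by omega)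
        simp only [Bool.not_not]
        rw [qProd_succ b] at h1 ⊢
        linear_combination h1 + moveWt p (!p) (2 * a + 1) * (1 - X ^ (2 * (b + 1))) * h2
    · have h2 := (ih (l₁ ++ [(p, m)]) (!p) a b).1 (by omega)
      rcases a with _ | a
      · simp [mergeSum_zero]
      rw [show 2 * (a + 1) = 2 * a + 1 + 1 by ring] at h2 ⊢
      rw [mergeSum_cons _ _ _ _ _ _ _ hm, show 2 * a + 1 + 1 = 2 * (a + 1) by ring,
        moveWt_two_mul, place_cons_wt]
      have h1 := (ih (l₁ ++ [(!p, m)]) p a b).2.2.2 (by omega)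
      simp only [Bool.not_not]
      rw [qProd_succ a] at h2 ⊢
      linear_combination (1 - X ^ (2 * (a + 1))) * h1 + X ^ (a + 1) * h2
    · have h1 := (ih (l₁ ++ [(p, m)]) p a b).2.2.1 (by omega)
      have h2 := (ih (l₁ ++ [(p, m)]) p a b).2.1 (by omega)
      rw [mergeSum_cons _ _ _ _ _ _ _ hm, moveWt_two_mul_add_one, invWt_self]
      linear_combination h1 - X ^ a * h2

/-- The merging rules for a block that is followed by a single letter. -/
lemma mergeSum_singleton_aux (u : List ℤ) (hu : u.Pairwise (· < ·)) (l₁ l₂ : List (Bool × ℤ))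
    (p : Bool) (a : ℕ) :
    (u.length = 2 * a + 1 → mergeSum l₁ p p (2 * a) u l₂ = wt (l₁ ++ place p u ++ l₂)) ∧
    (u.length = 2 * a + 2 → mergeSum l₁ p (!p) (2 * a + 1) u l₂ =
      wt (l₁ ++ place p u ++ l₂) - X ^ (a + 1) * wt (l₁ ++ place (!p) u ++ l₂)) := by
  induction u generalizing l₁ p a with
  | nil => exact ⟨fun h => by simp at h, fun h => by simp at h⟩
  | cons m u ih =>
    rw [List.pairwise_cons] at hu
    obtain ⟨hm, hu⟩ := hu
    replace ih := ih hu
    refine ⟨fun h => ?_, fun h => ?_⟩ <;> rw [List.length_cons] at h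
    · rcases a with _ | a
      · simp [mergeSum_zero]
      have h1 := (ih (l₁ ++ [(p, m)]) (!p) a).2 (by omega)
      rw [Bool.not_not] at h1
      rw [show 2 * (a + 1) = 2 * a + 1 + 1 by ring, mergeSum_cons _ _ _ _ _ _ _ hm, h1,
        show 2 * a + 1 + 1 = 2 * (a + 1) by ring, moveWt_two_mul,
        mergeSum_length _ _ _ _ _ _ (by omega), place_cons_wt]
      ring
    · have h1 := (ih (l₁ ++ [(p, m)]) (!p) a).1 (by omega)
      rw [mergeSum_cons _ _ _ _ _ _ _ hm, h1, moveWt_two_mul_add_one, invWt_not_right,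
        mergeSum_length _ _ _ _ _ _ (by omega), place_cons_wt, place_cons_wt, Bool.not_not]
      ring

/-- A merging rule for increasing words lifts to words with prescribed blocks. -/
lemma sumWords_merge (V : List ℤ) (hV : IsAbsList V) (l : List (Bool × ℤ)) (p : Bool) (a b : ℕ)
    (ds : List ℕ) (k k' : ℤ[X])
    (h : ∀ u : List ℤ, u.Pairwise (· < ·) → u.length = a + b → ∀ l₂,
      k * mergeSum l p (par p a) a u l₂ = k' * wt (l ++ place p u ++ l₂)) :
    k * sumWords V (a :: b :: ds) (fun w => wt (l ++ place p w)) =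
      k' * sumWords V ((a + b) :: ds) (fun w => wt (l ++ place p w)) := by
  simp only [sumWords_cons]
  have e : ∀ (S : List ℤ) (g : List ℤ → List ℤ → List ℤ → ℤ[X]) (C : List ℤ),
      sumSignings S (fun s => sumSplits C b fun T E => sumSignings T fun t => g s t E) =
      sumSplits C b fun T E => sumSignings S fun s => sumSignings T fun t => g s t E := by
    intro S g C
    simp only [sumSignings, sumSplits]
    exact list_sum_comm _ _ _
  simp only [e, sumSplits_assoc V a b]
  rw [← sumSplits_mul_left, ← sumSplits_mul_left]
  refine sumSplits_congr fun U E hU hUV _ _ => ?_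
  have hUa := hV.sublist hUV
  rw [sumSplits_sumSignings U a fun s t => sumWords E ds fun w => wt (l ++ place p (s ++ (t ++ w))),
    ← sumSignings_mul_left, ← sumSignings_mul_left]
  refine sumSignings_congr hUa fun u hu hp => ?_
  have hlen : u.length = a + b := by rw [← hU, ← hp.length_eq]; simp
  have e2 : sumSplits u a (fun s t => sumWords E ds fun w => wt (l ++ place p (s ++ (t ++ w)))) =
      sumWords E ds fun w => mergeSum l p (par p a) a u (place (par p (a + b)) w) := by
    simp only [mergeSum, sumWords, sumSplits]
    rw [list_sum_comm]
    congr 1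
    refine List.map_congr_left fun w _ => ?_
    congr 1
    refine List.map_congr_left fun q hq => ?_
    obtain ⟨h1, -, -, h4⟩ := splits_spec hq
    have h5 : q.2.length = b := by
      have := h4.length_eq
      rw [List.length_append] at this
      omega
    simp only [place_append, h1, h5, par_add, List.append_assoc]
  rw [e2, ← sumWords_mul_left, ← sumWords_mul_left]
  unfold sumWords
  congr 1
  refine List.map_congr_left fun w _ => ?_
  rw [h u hu hlen, place_append, hlen, List.append_assoc]

/-! ### Merging the block of the special component with a signed block -/

/-- The weight of the letters of the decreasing list `U`, in increasing order and starting at a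
position of parity `p`, followed by `l`. -/
noncomputable def sortedWt (p : Bool) (U : List ℤ) (l : List (Bool × ℤ)) : ℤ[X] :=
  wt (place p U.reverse ++ l)

lemma sortedWt_cons (p : Bool) (m : ℤ) (U : List ℤ) (l : List (Bool × ℤ)) :
    sortedWt p (m :: U) l = sortedWt p U ((par p U.length, m) :: l) := by
  simp [sortedWt, place_append, place]

/-- The sum over all ways to distribute the absolute values in `U` to an increasing block of `c`
positive letters and an increasing block of signed letters, with first positions of parities
`p` and `q`. -/
noncomputable def blockSum (p q : Bool) (c : ℕ) (U : List ℤ) (l : List (Bool × ℤ)) : ℤ[X] :=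
  sumSplits U c fun A T => sumSignings T fun t => wt (place p A.reverse ++ place q t ++ l)

lemma blockSum_length (p q : Bool) (c : ℕ) (U : List ℤ) (l : List (Bool × ℤ))
    (h : U.length = c) : blockSum p q c U l = sortedWt p U l := by
  subst h
  simp [blockSum, sortedWt, sumSplits_length, place]

/-- The largest letter of a signed block is either its last letter or, if it is negative, its
first letter. -/
lemma sumSignings_cons_wt (p q : Bool) (A : List ℤ) (m : ℤ) (T : List ℤ) (l : List (Bool × ℤ))
    (hT : IsAbsList (m :: T)) (hA : ∀ x ∈ A, |x| < m) :
    sumSignings (m :: T) (fun t => wt (place p A ++ place q t ++ l)) =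
      sumSignings T (fun t => wt (place p A ++ place q t ++ (par q T.length, m) :: l)) +
        moveWt p q A.length ^ 2 * moveWt (!q) q T.length *
          sumSignings T (fun t => wt (place p A ++ place (!q) t ++ (q, m) :: l)) := by
  rw [sumSignings_cons, ← sumSignings_mul_left]
  have hm : ∀ x ∈ T, x < m := (List.pairwise_cons.1 hT.1).1
  congr 1
  · refine sumSignings_congr hT.of_cons fun s _ hs => ?_
    have : s.length = T.length := by rw [← hs.length_eq]; simp
    simp [place_append, place, this]
  · refine sumSignings_congr hT.of_cons fun s _ hs => ?_
    have hl : s.length = T.length := by rw [← hs.length_eq]; simp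
    have hs' : ∀ z ∈ place (!q) s, z.2 < m := fun z hz =>
      (abs_lt.1 (hm _ (hs.subset (List.mem_map_of_mem (mem_place hz))))).2
    have h1 := wt_neg (place p A) (place (!q) s ++ l) q m fun x hx => hA _ (mem_place hx)
    have h2 := wt_move_right (place p A) (place (!q) s) l (q, m) hs'
    simp only [place, List.append_assoc, List.cons_append] at h1 h2 ⊢
    rw [h1, h2, prod_invWt_place, prod_invWt_place, hl]
    ring

lemma blockSum_zero_cons (p q : Bool) (m : ℤ) (U : List ℤ) (l : List (Bool × ℤ))
    (hU : IsAbsList (m :: U)) :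
    blockSum p q 0 (m :: U) l = blockSum p q 0 U ((par q U.length, m) :: l) +
      moveWt (!q) q U.length * blockSum p (!q) 0 U ((q, m) :: l) := by
  have := sumSignings_cons_wt p q [] m U l hU (by simp)
  simpa [blockSum, moveWt] using this

/-- The recursion obtained by removing the letter with the largest absolute value. -/
lemma blockSum_succ_cons (p q : Bool) (c d : ℕ) (m : ℤ) (U : List ℤ) (l : List (Bool × ℤ))
    (hU : IsAbsList (m :: U)) (hd : U.length = c + (d + 1)) :
    blockSum p q (c + 1) (m :: U) l =
      moveWt q (par p c) (d + 1) * blockSum p q c U ((par p c, m) :: l) +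
        blockSum p q (c + 1) U ((par q d, m) :: l) +
        moveWt p q (c + 1) ^ 2 * moveWt (!q) q d *
          blockSum p (!q) (c + 1) U ((q, m) :: l) := by
  have hm : ∀ x ∈ U, x < m := (List.pairwise_cons.1 hU.1).1
  simp only [blockSum]
  rw [sumSplits_cons, add_assoc]
  congr 1
  · rw [← sumSplits_mul_left]
    refine sumSplits_congr fun S C hS _ hC hp => ?_
    rw [← sumSignings_mul_left]
    refine sumSignings_congr (hU.of_cons.sublist hC) fun s _ hs => ?_
    have hl : s.length = d + 1 := by
      have h1 := hs.length_eq
      have h2 := hp.length_eq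
      rw [List.length_map] at h1
      rw [List.length_append] at h2
      omega
    have hs' : ∀ z ∈ place q s, z.2 < m := fun z hz =>
      (abs_lt.1 (hm _ (hC.subset (hs.subset (List.mem_map_of_mem (mem_place hz)))))).2
    have h2 := wt_move_right (place p S.reverse) (place q s) l (par p c, m) hs'
    rw [prod_invWt_place, hl] at h2
    rw [← h2]
    simp [place_append, place, hS]
  · rw [← sumSplits_mul_left, ← sumSplits_add]
    refine sumSplits_congr fun S C hS hSU hC hp => ?_
    have hl : C.length = d := by
      have h2 := hp.length_eq
      rw [List.length_append] at h2
      omega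
    rw [sumSignings_cons_wt p q S.reverse m C l (hU.sublist (hC.cons_cons m)), hl,
      List.length_reverse, hS]
    intro x hx
    have hx := hSU.subset (List.mem_reverse.1 hx)
    rw [abs_of_pos (hU.of_cons.2 x hx)]
    exact hm x hx

/-- The product of the squares of the factors `1 - x^{2j}` for `g < j ≤ g + m`. -/
noncomputable def sqProd (g m : ℕ) : ℤ[X] :=
  ∏ j ∈ Finset.range m, (1 - X ^ (2 * (g + j + 1))) ^ 2

@[simp] lemma sqProd_zero (g : ℕ) : sqProd g 0 = 1 := by simp [sqProd]
lemma sqProd_succ (g m : ℕ) :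
    sqProd g (m + 1) = sqProd g m * (1 - X ^ (2 * (g + m + 1))) ^ 2 := by
  simp [sqProd, Finset.prod_range_succ]
lemma sqProd_succ' (g m : ℕ) :
    sqProd g (m + 1) = sqProd (g + 1) m * (1 - X ^ (2 * (g + 1))) ^ 2 := by
  rw [sqProd, Finset.prod_range_succ', sqProd, add_zero]
  exact congrArg₂ _ (Finset.prod_congr rfl fun j _ => by
    rw [show g + (j + 1) = g + 1 + j by omega]) rfl

set_option linter.unusedSimpArgs false in
/-- The sums `blockSum`, for all parities of the two block sizes and of the offset of the second
block. In each case the sum is a combination of the two ways to merge the two blocks into one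
block that has no inversions, which starts at a position of either parity. The eight cases are
proved together, since the recursion leads from each of them to three others. -/
lemma blockSum_aux (U : List ℤ) (hU : IsAbsList U) (l : List (Bool × ℤ)) (p : Bool) (g m : ℕ) :
    (U.length = 2 * g + 1 + 2 * m → qProd m * blockSum p (!p) (2 * g + 1) U l =
      sqProd g m * sortedWt p U l) ∧
    (U.length = 2 * g + (2 * m + 1) → qProd m * blockSum p (!p) (2 * g) U l =
      2 * X ^ g * sqProd g m * sortedWt (!p) U l) ∧
    (U.length = 2 * g + 1 + (2 * m + 1) → qProd m * blockSum p (!p) (2 * g + 1) U l =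
      sqProd g m * ((1 + X ^ (2 * (g + 1 + m))) * sortedWt p U l -
        2 * X ^ (g + 1 + m) * sortedWt (!p) U l)) ∧
    (U.length = 2 * g + 2 * (m + 1) → qProd (m + 1) * blockSum p (!p) (2 * g) U l =
      sqProd g m * (X ^ (m + 1) * (1 - 3 * X ^ (2 * g) + X ^ (2 * (g + m + 1)) +
        X ^ (2 * g) * X ^ (2 * (g + m + 1))) * sortedWt p U l +
        2 * X ^ g * (1 - X ^ (2 * (m + 1))) * sortedWt (!p) U l)) ∧
    (U.length = 2 * g + (2 * m + 1) → qProd m * blockSum p p (2 * g) U l =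
      (1 + X ^ (2 * g)) * sqProd g m * sortedWt p U l) ∧
    (U.length = 2 * g + 1 + (2 * m + 1) → qProd m * blockSum p p (2 * g + 1) U l = 0) ∧
    (U.length = 2 * g + 1 + 2 * m → qProd m * blockSum p p (2 * g + 1) U l =
      X ^ m * sqProd g m * sortedWt p U l) ∧
    (U.length = 2 * g + 2 * (m + 1) → qProd (m + 1) * blockSum p p (2 * g) U l =
      sqProd g m * ((1 + X ^ (2 * g) - 3 * X ^ (2 * (g + m + 1)) +
        X ^ (2 * g) * X ^ (2 * (g + m + 1))) * sortedWt p U l -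
        2 * X ^ (3 * g + m + 1) * (1 - X ^ (2 * (m + 1))) * sortedWt (!p) U l)) := by
  induction U generalizing l p g m with
  | nil =>
    refine ⟨?_, ?_, ?_, ?_, ?_, ?_, ?_, ?_⟩ <;> intro h <;> rw [List.length_nil] at h <;> omega
  | cons v U ih =>
    replace ih := ih hU.of_cons
    refine ⟨?_, ?_, ?_, ?_, ?_, ?_, ?_, ?_⟩ <;> intro h <;> rw [List.length_cons] at h
    · rcases m with _ | m
      · rw [blockSum_length _ _ _ _ _ (by simp; omega)]; simp
      rw [blockSum_succ_cons p (!p) (2 * g) (2 * m + 1) v U l hU (by omega)]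
      have hA := (ih ((p, v) :: l) p g m).2.2.2.1 (by omega)
      have hB := (ih ((p, v) :: l) p g m).2.2.1 (by omega)
      have hC := (ih ((!p, v) :: l) p g m).2.2.2.2.2.1 (by omega)
      simp only [sortedWt_cons, show U.length = 2 * (g + m + 1) by omega,
        show 2 * m + 1 + 1 = 2 * (m + 1) by ring, par_two_mul, par_two_mul_add_one, Bool.not_not,
        moveWt_two_mul, moveWt_two_mul_add_one, invWt_not_left, invWt_not_right, invWt_self,
        sqProd_succ, qProd_succ] at hA hB hC ⊢
      linear_combination X ^ (m + 1) * hA + (1 - X ^ (2 * (m + 1))) * hB +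
        (X ^ g * -X) ^ 2 * (X ^ m * -X) * (1 - X ^ (2 * (m + 1))) * hC
    · rcases g with _ | g
      · rw [Nat.mul_zero, blockSum_zero_cons p (!p) v U l hU]
        rcases m with _ | m
        · rw [Nat.mul_zero, Nat.zero_add] at h
          have hB := blockSum_length p (!p) 0 U ((!p, v) :: l) (by omega)
          have hC := blockSum_length p p 0 U ((!p, v) :: l) (by omega)
          simp only [sortedWt_cons, show U.length = 2 * 0 by omega, sqProd_zero, qProd_zero,
            par_two_mul, par_two_mul_add_one, Bool.not_not, moveWt_two_mul, moveWt_two_mul_add_one,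
            invWt_not_left, invWt_not_right, invWt_self, sqProd_succ, qProd_succ] at hB hC ⊢
          have e : sortedWt p U ((!p, v) :: l) = sortedWt (!p) U ((!p, v) :: l) := by
            rw [List.length_eq_zero_iff.1 (show U.length = 0 by omega)]; rfl
          linear_combination hB + hC + 2 * e
        · rw [Nat.mul_zero, Nat.zero_add] at h
          have hB := (ih ((!p, v) :: l) p 0 m).2.2.2.1 (by omega)
          have hC := (ih ((!p, v) :: l) p 0 m).2.2.2.2.2.2.2 (by omega)
          simp only [sortedWt_cons, show U.length = 2 * (m + 1) by omega, par_two_mul,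
            par_two_mul_add_one, Bool.not_not, moveWt_two_mul, moveWt_two_mul_add_one,
            invWt_not_left, invWt_not_right, invWt_self, sqProd_succ, qProd_succ] at hB hC ⊢
          linear_combination hB + X ^ (m + 1) * hC
      · rw [show 2 * (g + 1) = 2 * g + 1 + 1 by ring,
          blockSum_succ_cons p (!p) (2 * g + 1) (2 * m) v U l hU (by omega)]
        rcases m with _ | m
        · rw [show 2 * g + 1 + 1 = 2 * (g + 1) by ring]
          have hA := (ih ((!p, v) :: l) p g 0).2.2.1 (by omega)
          have hB := blockSum_length p (!p) (2 * (g + 1)) U ((!p, v) :: l) (by omega)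
          have hC := blockSum_length p p (2 * (g + 1)) U ((!p, v) :: l) (by omega)
          simp only [sortedWt_cons, show U.length = 2 * (g + 1) by omega, sqProd_zero, qProd_zero,
            par_two_mul, par_two_mul_add_one, Bool.not_not, moveWt_two_mul, moveWt_two_mul_add_one,
            invWt_not_left, invWt_not_right, invWt_self, sqProd_succ, qProd_succ] at hA hB hC ⊢
          linear_combination X ^ 0 * -1 * hA + hB + (X ^ (g + 1)) ^ 2 * hC
        · rw [show 2 * g + 1 + 1 = 2 * (g + 1) by ring]
          have hA := (ih ((!p, v) :: l) p g (m + 1)).2.2.1 (by omega)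
          have hB := (ih ((!p, v) :: l) p (g + 1) m).2.2.2.1 (by omega)
          have hC := (ih ((!p, v) :: l) p (g + 1) m).2.2.2.2.2.2.2 (by omega)
          rw [sqProd_succ' g m] at hA
          simp only [sortedWt_cons, show U.length = 2 * (g + 1 + m + 1) by omega, par_two_mul,
            par_two_mul_add_one, Bool.not_not, moveWt_two_mul, moveWt_two_mul_add_one,
            invWt_not_left, invWt_not_right, invWt_self, sqProd_succ, qProd_succ] at hA hB hC ⊢
          linear_combination X ^ (m + 1) * -1 * hA + hB + (X ^ (g + 1)) ^ 2 * X ^ (m + 1) * hC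
    · rw [blockSum_succ_cons p (!p) (2 * g) (2 * m) v U l hU (by omega)]
      have hA := (ih ((p, v) :: l) p g m).2.1 (by omega)
      have hB := (ih ((!p, v) :: l) p g m).1 (by omega)
      have hC := (ih ((!p, v) :: l) p g m).2.2.2.2.2.2.1 (by omega)
      simp only [sortedWt_cons, show U.length = 2 * (g + m) + 1 by omega, par_two_mul,
        par_two_mul_add_one, Bool.not_not, moveWt_two_mul, moveWt_two_mul_add_one, invWt_not_left,
        invWt_not_right, invWt_self, sqProd_succ, qProd_succ] at hA hB hC ⊢
      linear_combination X ^ m * -X * hA + hB + (X ^ g * -X) ^ 2 * X ^ m * hC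
    · rcases g with _ | g
      · rw [Nat.mul_zero, blockSum_zero_cons p (!p) v U l hU]
        rw [Nat.mul_zero, Nat.zero_add] at h
        have hB := (ih ((p, v) :: l) p 0 m).2.1 (by omega)
        have hC := (ih ((!p, v) :: l) p 0 m).2.2.2.2.1 (by omega)
        simp only [sortedWt_cons, show U.length = 2 * m + 1 by omega, par_two_mul,
          par_two_mul_add_one, Bool.not_not, moveWt_two_mul, moveWt_two_mul_add_one, invWt_not_left,
          invWt_not_right, invWt_self, sqProd_succ, qProd_succ] at hB hC ⊢
        linear_combination (1 - X ^ (2 * (m + 1))) * hB + X ^ m * -X * (1 - X ^ (2 * (m + 1))) * hC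
      · rw [show 2 * (g + 1) = 2 * g + 1 + 1 by ring,
          blockSum_succ_cons p (!p) (2 * g + 1) (2 * m + 1) v U l hU (by omega)]
        rw [show 2 * g + 1 + 1 = 2 * (g + 1) by ring]
        have hA := (ih ((!p, v) :: l) p g (m + 1)).1 (by omega)
        have hB := (ih ((p, v) :: l) p (g + 1) m).2.1 (by omega)
        have hC := (ih ((!p, v) :: l) p (g + 1) m).2.2.2.2.1 (by omega)
        rw [sqProd_succ' g m] at hA
        simp only [sortedWt_cons, show U.length = 2 * (g + 1 + m) + 1 by omega,
          show 2 * m + 1 + 1 = 2 * (m + 1) by ring, par_two_mul, par_two_mul_add_one, Bool.not_not,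
          moveWt_two_mul, moveWt_two_mul_add_one, invWt_not_left, invWt_not_right, invWt_self,
          sqProd_succ, qProd_succ] at hA hB hC ⊢
        linear_combination X ^ (m + 1) * hA + (1 - X ^ (2 * (m + 1))) * hB + (X ^ (g +
          1)) ^ 2 * (X ^ m * -X) * (1 - X ^ (2 * (m + 1))) * hC
    · rcases g with _ | g
      · rw [Nat.mul_zero, blockSum_zero_cons p p v U l hU]
        rcases m with _ | m
        · rw [Nat.mul_zero, Nat.zero_add] at h
          have hB := blockSum_length p p 0 U ((p, v) :: l) (by omega)
          have hC := blockSum_length p (!p) 0 U ((p, v) :: l) (by omega)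
          simp only [sortedWt_cons, show U.length = 2 * 0 by omega, sqProd_zero, qProd_zero,
            par_two_mul, par_two_mul_add_one, Bool.not_not, moveWt_two_mul, moveWt_two_mul_add_one,
            invWt_not_left, invWt_not_right, invWt_self, sqProd_succ, qProd_succ] at hB hC ⊢
          linear_combination hB + hC
        · rw [Nat.mul_zero, Nat.zero_add] at h
          have hB := (ih ((p, v) :: l) p 0 m).2.2.2.2.2.2.2 (by omega)
          have hC := (ih ((p, v) :: l) p 0 m).2.2.2.1 (by omega)
          simp only [sortedWt_cons, show U.length = 2 * (m + 1) by omega, par_two_mul,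
            par_two_mul_add_one, Bool.not_not, moveWt_two_mul, moveWt_two_mul_add_one,
            invWt_not_left, invWt_not_right, invWt_self, sqProd_succ, qProd_succ] at hB hC ⊢
          linear_combination hB + X ^ (m + 1) * hC
      · rw [show 2 * (g + 1) = 2 * g + 1 + 1 by ring,
          blockSum_succ_cons p p (2 * g + 1) (2 * m) v U l hU (by omega)]
        rcases m with _ | m
        · rw [show 2 * g + 1 + 1 = 2 * (g + 1) by ring]
          have hA := (ih ((!p, v) :: l) p g 0).2.2.2.2.2.1 (by omega)
          have hB := blockSum_length p p (2 * (g + 1)) U ((p, v) :: l) (by omega)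
          have hC := blockSum_length p (!p) (2 * (g + 1)) U ((p, v) :: l) (by omega)
          simp only [sortedWt_cons, show U.length = 2 * (g + 1) by omega, sqProd_zero, qProd_zero,
            par_two_mul, par_two_mul_add_one, Bool.not_not, moveWt_two_mul, moveWt_two_mul_add_one,
            invWt_not_left, invWt_not_right, invWt_self, sqProd_succ, qProd_succ] at hA hB hC ⊢
          linear_combination X ^ 0 * -X * hA + hB + (X ^ (g + 1)) ^ 2 * hC
        · rw [show 2 * g + 1 + 1 = 2 * (g + 1) by ring]
          have hA := (ih ((!p, v) :: l) p g (m + 1)).2.2.2.2.2.1 (by omega)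
          have hB := (ih ((p, v) :: l) p (g + 1) m).2.2.2.2.2.2.2 (by omega)
          have hC := (ih ((p, v) :: l) p (g + 1) m).2.2.2.1 (by omega)
          simp only [sortedWt_cons, show U.length = 2 * (g + 1 + m + 1) by omega, par_two_mul,
            par_two_mul_add_one, Bool.not_not, moveWt_two_mul, moveWt_two_mul_add_one,
            invWt_not_left, invWt_not_right, invWt_self, sqProd_succ, qProd_succ] at hA hB hC ⊢
          linear_combination X ^ (m + 1) * -X * hA + hB + (X ^ (g + 1)) ^ 2 * X ^ (m + 1) * hC
    · rw [blockSum_succ_cons p p (2 * g) (2 * m) v U l hU (by omega)]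
      have hA := (ih ((p, v) :: l) p g m).2.2.2.2.1 (by omega)
      have hB := (ih ((p, v) :: l) p g m).2.2.2.2.2.2.1 (by omega)
      have hC := (ih ((p, v) :: l) p g m).1 (by omega)
      simp only [sortedWt_cons, show U.length = 2 * (g + m) + 1 by omega, par_two_mul,
        par_two_mul_add_one, Bool.not_not, moveWt_two_mul, moveWt_two_mul_add_one, invWt_not_left,
        invWt_not_right, invWt_self, sqProd_succ, qProd_succ] at hA hB hC ⊢
      linear_combination X ^ m * -1 * hA + hB + (X ^ g * -1) ^ 2 * X ^ m * hC
    · rcases m with _ | m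
      · rw [blockSum_length _ _ _ _ _ (by simp; omega)]; simp
      rw [blockSum_succ_cons p p (2 * g) (2 * m + 1) v U l hU (by omega)]
      have hA := (ih ((p, v) :: l) p g m).2.2.2.2.2.2.2 (by omega)
      have hB := (ih ((!p, v) :: l) p g m).2.2.2.2.2.1 (by omega)
      have hC := (ih ((p, v) :: l) p g m).2.2.1 (by omega)
      simp only [sortedWt_cons, show U.length = 2 * (g + m + 1) by omega,
        show 2 * m + 1 + 1 = 2 * (m + 1) by ring, par_two_mul, par_two_mul_add_one, Bool.not_not,
        moveWt_two_mul, moveWt_two_mul_add_one, invWt_not_left, invWt_not_right, invWt_self,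
        sqProd_succ, qProd_succ] at hA hB hC ⊢
      linear_combination X ^ (m + 1) * hA + (1 - X ^ (2 * (m + 1))) * hB +
        (X ^ g * -1) ^ 2 * (X ^ m * -X) * (1 - X ^ (2 * (m + 1))) * hC
    · rcases g with _ | g
      · rw [Nat.mul_zero, blockSum_zero_cons p p v U l hU]
        rw [Nat.mul_zero, Nat.zero_add] at h
        have hB := (ih ((!p, v) :: l) p 0 m).2.2.2.2.1 (by omega)
        have hC := (ih ((p, v) :: l) p 0 m).2.1 (by omega)
        simp only [sortedWt_cons, show U.length = 2 * m + 1 by omega, par_two_mul,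
          par_two_mul_add_one, Bool.not_not, moveWt_two_mul, moveWt_two_mul_add_one, invWt_not_left,
          invWt_not_right, invWt_self, sqProd_succ, qProd_succ] at hB hC ⊢
        linear_combination (1 - X ^ (2 * (m + 1))) * hB + X ^ m * -X * (1 - X ^ (2 * (m + 1))) * hC
      · rw [show 2 * (g + 1) = 2 * g + 1 + 1 by ring,
          blockSum_succ_cons p p (2 * g + 1) (2 * m + 1) v U l hU (by omega)]
        rw [show 2 * g + 1 + 1 = 2 * (g + 1) by ring]
        have hA := (ih ((!p, v) :: l) p g (m + 1)).2.2.2.2.2.2.1 (by omega)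
        have hB := (ih ((!p, v) :: l) p (g + 1) m).2.2.2.2.1 (by omega)
        have hC := (ih ((p, v) :: l) p (g + 1) m).2.1 (by omega)
        rw [sqProd_succ' g m] at hA
        simp only [sortedWt_cons, show U.length = 2 * (g + 1 + m) + 1 by omega,
          show 2 * m + 1 + 1 = 2 * (m + 1) by ring, par_two_mul, par_two_mul_add_one, Bool.not_not,
          moveWt_two_mul, moveWt_two_mul_add_one, invWt_not_left, invWt_not_right, invWt_self,
          sqProd_succ, qProd_succ] at hA hB hC ⊢
        linear_combination X ^ (m + 1) * hA + (1 - X ^ (2 * (m + 1))) * hB + (X ^ (g +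
          1)) ^ 2 * (X ^ m * -X) * (1 - X ^ (2 * (m + 1))) * hC

/-! ### Words with arbitrary blocks -/

lemma qProd_ne_zero (m : ℕ) : qProd m ≠ 0 := by
  refine Finset.prod_ne_zero_iff.2 fun j _ h => ?_
  have := congrArg (eval 2) h
  simp only [eval_sub, eval_one, eval_pow, eval_X, eval_zero] at this
  have h2 : (1 : ℤ) < 2 ^ (2 * (j + 1)) := one_lt_pow₀ (by norm_num) (by omega)
  omega

lemma sumWords_cons_congr (ds ds' : List ℕ) (k k' : ℤ[X])
    (h : ∀ (C : List ℤ), IsAbsList C → ∀ (l : List (Bool × ℤ)) (p : Bool),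
      k * sumWords C ds (fun w => wt (l ++ place p w)) =
        k' * sumWords C ds' (fun w => wt (l ++ place p w)))
    (V : List ℤ) (hV : IsAbsList V) (d : ℕ) (l : List (Bool × ℤ)) (p : Bool) :
    k * sumWords V (d :: ds) (fun w => wt (l ++ place p w)) =
      k' * sumWords V (d :: ds') (fun w => wt (l ++ place p w)) := by
  simp only [sumWords_cons]
  rw [← sumSplits_mul_left, ← sumSplits_mul_left]
  refine sumSplits_congr fun S C _ hS hC _ => ?_
  rw [← sumSignings_mul_left, ← sumSignings_mul_left]
  refine sumSignings_congr (hV.sublist hS) fun s _ _ => ?_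
  have := h C (hV.sublist hC) (l ++ place p s) (par p s.length)
  simpa only [place_append, List.append_assoc] using this

lemma sumWords_even_even (V : List ℤ) (hV : IsAbsList V) (a b : ℕ) (ds : List ℕ)
    (l : List (Bool × ℤ)) (p : Bool) :
    qProd a * qProd b * sumWords V (2 * a :: 2 * b :: ds) (fun w => wt (l ++ place p w)) =
      qProd (a + b) * sumWords V (2 * (a + b) :: ds) (fun w => wt (l ++ place p w)) := by
  rw [mul_add]
  refine sumWords_merge V hV l p _ _ ds _ _ fun u hu hl l₂ => ?_
  rw [par_two_mul]
  exact (mergeSum_aux u hu l l₂ p a b).1 hl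

lemma sumWords_odd_even (V : List ℤ) (hV : IsAbsList V) (a b : ℕ) (ds : List ℕ)
    (l : List (Bool × ℤ)) (p : Bool) :
    qProd a * qProd b * sumWords V ((2 * a + 1) :: 2 * b :: ds) (fun w => wt (l ++ place p w)) =
      qProd (a + b) * sumWords V ((2 * (a + b) + 1) :: ds) (fun w => wt (l ++ place p w)) := by
  rw [show 2 * (a + b) + 1 = 2 * a + 1 + 2 * b by ring]
  refine sumWords_merge V hV l p _ _ ds _ _ fun u hu hl l₂ => ?_
  rw [par_two_mul_add_one]
  exact (mergeSum_aux u hu l l₂ p a b).2.1 hl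

lemma sumWords_even_one (V : List ℤ) (hV : IsAbsList V) (a : ℕ) (ds : List ℕ)
    (l : List (Bool × ℤ)) (p : Bool) :
    sumWords V (2 * a :: 1 :: ds) (fun w => wt (l ++ place p w)) =
      sumWords V ((2 * a + 1) :: ds) (fun w => wt (l ++ place p w)) := by
  have := sumWords_merge V hV l p (2 * a) 1 ds 1 1 fun u hu hl l₂ => by
    rw [par_two_mul, one_mul, one_mul]
    exact (mergeSum_singleton_aux u hu l l₂ p a).1 hl
  simpa using this

/-- A single letter may be moved across a block of even size. -/
lemma sumWords_even_one_comm (V : List ℤ) (hV : IsAbsList V) (a : ℕ) (ds : List ℕ)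
    (l : List (Bool × ℤ)) (p : Bool) :
    sumWords V (2 * a :: 1 :: ds) (fun w => wt (l ++ place p w)) =
      sumWords V (1 :: 2 * a :: ds) (fun w => wt (l ++ place p w)) := by
  have : qProd a * sumWords V (1 :: 2 * a :: ds) (fun w => wt (l ++ place p w)) =
      qProd a * sumWords V ((2 * a + 1) :: ds) (fun w => wt (l ++ place p w)) := by
    simpa only [qProd_zero, one_mul, zero_add, mul_zero] using sumWords_odd_even V hV 0 a ds l p
  rw [sumWords_even_one V hV]
  exact (mul_left_cancel₀ (qProd_ne_zero a) this).symm

/-- The sum of the numbers `⌊d / 2⌋` over the block sizes `d`. -/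
def halfSum (ds : List ℕ) : ℕ := (ds.map (· / 2)).sum

/-- The number of odd block sizes. -/
def oddCount (ds : List ℕ) : ℕ := (ds.map (· % 2)).sum

/-- The product of the `qProd ⌊d / 2⌋` over the block sizes `d`. -/
noncomputable def blockProd (ds : List ℕ) : ℤ[X] := (ds.map fun d => qProd (d / 2)).prod

lemma sum_eq_halfSum_oddCount (ds : List ℕ) : ds.sum = 2 * halfSum ds + oddCount ds := by
  induction ds with
  | nil => simp [halfSum, oddCount]
  | cons d ds ih =>
    simp only [halfSum, oddCount, List.map_cons, List.sum_cons] at ih ⊢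
    omega

/-- All blocks may be collected in one block of even size, which is followed by one single letter
for each block of odd size. -/
lemma sumWords_collect (ds : List ℕ) (V : List ℤ) (hV : IsAbsList V) (l : List (Bool × ℤ))
    (p : Bool) :
    blockProd ds * sumWords V ds (fun w => wt (l ++ place p w)) =
      qProd (halfSum ds) * sumWords V (2 * halfSum ds :: List.replicate (oddCount ds) 1)
        (fun w => wt (l ++ place p w)) := by
  induction ds generalizing V l p with
  | nil => simp [blockProd, halfSum, oddCount, sumWords_zero_cons]
  | cons d ds ih =>
    have h1 := sumWords_cons_congr ds _ _ _ (fun C hC l p => ih C hC l p) V hV d l p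
    have hb : blockProd (d :: ds) = qProd (d / 2) * blockProd ds := by simp [blockProd]
    have hh : halfSum (d :: ds) = d / 2 + halfSum ds := by simp [halfSum]
    have ho : oddCount (d :: ds) = d % 2 + oddCount ds := by simp [oddCount]
    rw [hb, hh, ho, mul_assoc, h1]
    rcases Nat.even_or_odd' d with ⟨a, rfl | rfl⟩
    · have h2 := sumWords_even_even V hV a (halfSum ds) (List.replicate (oddCount ds) 1) l p
      rw [show 2 * a / 2 = a by omega, show 2 * a % 2 = 0 by omega, zero_add, ← h2, mul_assoc]
    · have h2 := sumWords_odd_even V hV a (halfSum ds) (List.replicate (oddCount ds) 1) l p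
      rw [show (2 * a + 1) / 2 = a by omega, show (2 * a + 1) % 2 = 1 by omega,
        Nat.add_comm 1, List.replicate_succ, sumWords_even_one V hV, ← h2, mul_assoc]

/-- The sum of the weights of all words that consist of an increasing block of `c` positive
letters and of increasing blocks of signed letters, whose sizes are the entries of `ds`. The
positive block and the remaining word start at positions of parities `p` and `q`. -/
noncomputable def flagSum (p q : Bool) (c : ℕ) (V : List ℤ) (ds : List ℕ) : ℤ[X] :=
  sumSplits V c fun A C => sumWords C ds fun w => wt (place p A.reverse ++ place q w)

/-- A merging rule for `blockSum` lifts to words with further blocks. -/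
lemma flagSum_merge (p q : Bool) (c d : ℕ) (V : List ℤ) (hV : IsAbsList V) (ds : List ℕ)
    (k k₁ k₂ : ℤ[X])
    (h : ∀ U : List ℤ, IsAbsList U → U.length = c + d → ∀ l,
      k * blockSum p q c U l = k₁ * sortedWt p U l + k₂ * sortedWt (!p) U l) :
    k * flagSum p q c V (d :: ds) =
      k₁ * flagSum p (par q d) (c + d) V ds + k₂ * flagSum (!p) (par q d) (c + d) V ds := by
  simp only [flagSum, sumWords_cons, sumSplits_assoc V c d]
  rw [← sumSplits_mul_left, ← sumSplits_mul_left, ← sumSplits_mul_left, ← sumSplits_add]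
  refine sumSplits_congr fun U E hU hUV _ _ => ?_
  have hUa := hV.sublist hUV
  have e2 : (sumSplits U c fun A T => sumSignings T fun t => sumWords E ds fun w =>
      wt (place p A.reverse ++ place q (t ++ w))) =
      sumWords E ds fun w => blockSum p q c U (place (par q d) w) := by
    simp only [blockSum, sumWords, sumSplits, sumSignings]
    rw [list_sum_comm]
    congr 1
    refine List.map_congr_left fun r hr => ?_
    rw [list_sum_comm]
    congr 1
    refine List.map_congr_left fun w _ => ?_
    congr 1
    obtain ⟨h1, -, h3, h4⟩ := splits_spec hr
    refine List.map_congr_left fun t ht => ?_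
    have h5 := (signings_spec (hUa.sublist h3) ht).2.length_eq
    have h6 : t.length = d := by
      have := h4.length_eq
      rw [List.length_append] at this
      rw [List.length_map] at h5
      omega
    rw [place_append, h6, List.append_assoc]
  rw [e2, ← sumWords_mul_left, ← sumWords_mul_left, ← sumWords_mul_left, ← sumWords_add]
  unfold sumWords
  congr 1
  exact List.map_congr_left fun w _ => h U hUa hU _

lemma flagSum_nil (p q : Bool) (c : ℕ) (V : List ℤ) (hV : IsAbsList V) (hc : V.length = c) :
    flagSum p q c V [] = 1 := by
  subst hc
  rw [flagSum, sumSplits_length, sumWords_nil_nil, place, List.append_nil]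
  exact wt_place_of_pos p _ (List.pairwise_reverse.2 hV.1)
    fun x hx => hV.2 x (List.mem_reverse.1 hx)

lemma flagSum_collect (p q : Bool) (c : ℕ) (V : List ℤ) (hV : IsAbsList V) (ds : List ℕ) :
    blockProd ds * flagSum p q c V ds = qProd (halfSum ds) *
      flagSum p q c V (2 * halfSum ds :: List.replicate (oddCount ds) 1) := by
  simp only [flagSum]
  rw [← sumSplits_mul_left, ← sumSplits_mul_left]
  exact sumSplits_congr fun S C _ _ hC _ => sumWords_collect ds C (hV.sublist hC) _ q

/-- The sum over all words that consist of a positive block of size `2 * g + 1` and `k` single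
letters. -/
noncomputable def singlesProd : ℕ → ℕ → ℤ[X]
  | _, 0 => 1
  | g, 1 => (1 - X ^ (g + 1)) ^ 2
  | g, k + 2 => (1 - X ^ (2 * (g + 1))) ^ 2 * singlesProd (g + 1) k

lemma flagSum_odd_one (p : Bool) (g : ℕ) (V : List ℤ) (hV : IsAbsList V) (ds : List ℕ) :
    flagSum p (!p) (2 * g + 1) V (1 :: ds) =
      (1 + X ^ (2 * (g + 1))) * flagSum p p (2 * (g + 1)) V ds -
        2 * X ^ (g + 1) * flagSum (!p) p (2 * (g + 1)) V ds := by
  have := flagSum_merge p (!p) (2 * g + 1) 1 V hV ds 1 (1 + X ^ (2 * (g + 1)))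
    (-(2 * X ^ (g + 1))) fun U hU hl l => by
      have := (blockSum_aux U hU l p g 0).2.2.1 (by omega)
      simp only [qProd_zero, sqProd_zero, add_zero] at this
      linear_combination this
  rw [par_one, Bool.not_not, show 2 * g + 1 + 1 = 2 * (g + 1) by ring] at this
  linear_combination this

lemma flagSum_even_one (p : Bool) (g : ℕ) (V : List ℤ) (hV : IsAbsList V) (ds : List ℕ) :
    flagSum p p (2 * g) V (1 :: ds) =
      (1 + X ^ (2 * g)) * flagSum p (!p) (2 * g + 1) V ds := by
  have := flagSum_merge p p (2 * g) 1 V hV ds 1 (1 + X ^ (2 * g)) 0 fun U hU hl l => by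
      have := (blockSum_aux U hU l p g 0).2.2.2.2.1 (by omega)
      simp only [qProd_zero, sqProd_zero] at this
      linear_combination this
  rw [par_one] at this
  linear_combination this

lemma flagSum_even_one_of_ne (p : Bool) (g : ℕ) (V : List ℤ) (hV : IsAbsList V) (ds : List ℕ) :
    flagSum (!p) p (2 * g) V (1 :: ds) = 2 * X ^ g * flagSum p (!p) (2 * g + 1) V ds := by
  have := flagSum_merge (!p) p (2 * g) 1 V hV ds 1 0 (2 * X ^ g) fun U hU hl l => by
      have := (blockSum_aux U hU l (!p) g 0).2.1 (by omega)
      simp only [qProd_zero, sqProd_zero, Bool.not_not] at this ⊢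
      linear_combination this
  rw [par_one, Bool.not_not] at this
  linear_combination this

lemma flagSum_odd_replicate (p : Bool) (V : List ℤ) (hV : IsAbsList V) (k g : ℕ)
    (hl : V.length = 2 * g + 1 + k) :
    flagSum p (!p) (2 * g + 1) V (List.replicate k 1) = singlesProd g k := by
  induction k using Nat.twoStepInduction generalizing g with
  | zero => rw [List.replicate_zero, flagSum_nil _ _ _ V hV hl, singlesProd]
  | one =>
    rw [List.replicate_one, flagSum_odd_one p g V hV, flagSum_nil _ _ _ V hV (by omega),
      flagSum_nil _ _ _ V hV (by omega), singlesProd]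
    ring
  | more k ih _ =>
    have := ih (g + 1) (by omega)
    rw [List.replicate_succ, List.replicate_succ, flagSum_odd_one p g V hV,
      flagSum_even_one p _ V hV, flagSum_even_one_of_ne p _ V hV, this, singlesProd]
    ring

lemma flagSum_odd_even (p : Bool) (g m : ℕ) (V : List ℤ) (hV : IsAbsList V) (ds : List ℕ) :
    qProd m * flagSum p (!p) (2 * g + 1) V (2 * m :: ds) =
      sqProd g m * flagSum p (!p) (2 * (g + m) + 1) V ds := by
  have := flagSum_merge p (!p) (2 * g + 1) (2 * m) V hV ds (qProd m) (sqProd g m) 0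
    fun U hU hl l => by
      have := (blockSum_aux U hU l p g m).1 (by omega)
      linear_combination this
  rw [par_two_mul, show 2 * g + 1 + 2 * m = 2 * (g + m) + 1 by ring] at this
  linear_combination this

lemma flagSum_odd (g : ℕ) (V : List ℤ) (hV : IsAbsList V) (ds : List ℕ)
    (hl : V.length = 2 * g + 1 + ds.sum) :
    blockProd ds * flagSum false true (2 * g + 1) V ds =
      sqProd g (halfSum ds) * singlesProd (g + halfSum ds) (oddCount ds) := by
  have hs := sum_eq_halfSum_oddCount ds
  rw [flagSum_collect _ _ _ V hV]
  have := flagSum_odd_even false g (halfSum ds) V hV (List.replicate (oddCount ds) 1)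
  rw [flagSum_odd_replicate false V hV _ _ (by omega)] at this
  exact this

/-- If the positive block has even size and there is a block of odd size, then the positive block
absorbs a single letter. -/
lemma flagSum_even_of_odd (g k : ℕ) (V : List ℤ) (hV : IsAbsList V) (ds : List ℕ)
    (hl : V.length = 2 * g + ds.sum) (hk : oddCount ds = k + 1) :
    blockProd ds * flagSum false false (2 * g) V ds =
      (1 + X ^ (2 * g)) * sqProd g (halfSum ds) * singlesProd (g + halfSum ds) k := by
  have hs := sum_eq_halfSum_oddCount ds
  have e : flagSum false false (2 * g) V (2 * halfSum ds :: List.replicate (k + 1) 1) =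
      flagSum false false (2 * g) V (1 :: 2 * halfSum ds :: List.replicate k 1) := by
    rw [List.replicate_succ]
    exact sumSplits_congr fun S C _ _ hC _ => sumWords_even_one_comm C (hV.sublist hC) _ _ _ _
  rw [flagSum_collect _ _ _ V hV, hk, e, flagSum_even_one _ _ V hV]
  have := flagSum_odd_even false g (halfSum ds) V hV (List.replicate k 1)
  rw [flagSum_odd_replicate false V hV _ _ (by omega)] at this
  linear_combination (1 + X ^ (2 * g)) * this

/-- If all block sizes are even, then a trinomial appears. -/
lemma flagSum_even_of_even (g m : ℕ) (V : List ℤ) (hV : IsAbsList V) (ds : List ℕ)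
    (hl : V.length = 2 * g + ds.sum) (hk : oddCount ds = 0) (hm : halfSum ds = m + 1) :
    blockProd ds * flagSum false false (2 * g) V ds =
      sqProd g m * (1 - X ^ (g + m + 1)) ^ 2 * (1 + X ^ (2 * g) + 2 * X ^ (g + m + 1)) := by
  have hs := sum_eq_halfSum_oddCount ds
  rw [flagSum_collect _ _ _ V hV, hk, hm, List.replicate_zero]
  have := flagSum_merge false false (2 * g) (2 * (m + 1)) V hV [] (qProd (m + 1))
    (sqProd g m * (1 + X ^ (2 * g) - 3 * X ^ (2 * (g + m + 1)) +
        X ^ (2 * g) * X ^ (2 * (g + m + 1))))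
    (-(sqProd g m * (2 * X ^ (3 * g + m + 1) * (1 - X ^ (2 * (m + 1))))))
    fun U hU hl l => by
      have := (blockSum_aux U hU l false g m).2.2.2.2.2.2.2 (by omega)
      linear_combination this
  rw [flagSum_nil _ _ _ V hV (by omega), flagSum_nil _ _ _ V hV (by omega)] at this
  linear_combination this

/-! ### Products of cyclotomic polynomials -/

namespace IsCyclotomicProduct

lemma one : IsCyclotomicProduct 1 := ⟨0, by simp, Or.inl (by simp)⟩

lemma neg {p : ℤ[X]} (hp : IsCyclotomicProduct p) : IsCyclotomicProduct (-p) := by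
  obtain ⟨s, hs, h | h⟩ := hp
  · exact ⟨s, hs, Or.inr (by rw [h])⟩
  · exact ⟨s, hs, Or.inl (by rw [h, neg_neg])⟩

lemma mul {p q : ℤ[X]} (hp : IsCyclotomicProduct p) (hq : IsCyclotomicProduct q) :
    IsCyclotomicProduct (p * q) := by
  obtain ⟨s, hs, h⟩ := hp
  obtain ⟨t, ht, h'⟩ := hq
  refine ⟨s + t, fun d hd => (Multiset.mem_add.1 hd).elim (hs d) (ht d), ?_⟩
  rw [Multiset.map_add, Multiset.prod_add]
  rcases h with rfl | rfl <;> rcases h' with rfl | rfl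
  · exact Or.inl rfl
  · exact Or.inr (by ring)
  · exact Or.inr (by ring)
  · exact Or.inl (by ring)

lemma pow {p : ℤ[X]} (hp : IsCyclotomicProduct p) (k : ℕ) : IsCyclotomicProduct (p ^ k) := by
  induction k with
  | zero => simpa using one
  | succ k ih => rw [pow_succ]; exact ih.mul hp

lemma prod {ι : Type*} (s : Finset ι) (f : ι → ℤ[X]) (h : ∀ i ∈ s, IsCyclotomicProduct (f i)) :
    IsCyclotomicProduct (∏ i ∈ s, f i) :=
  Finset.prod_induction f IsCyclotomicProduct (fun _ _ => mul) one h

lemma mem_of_dvd {s : Multiset ℕ} (hs : ∀ d ∈ s, 0 < d) {d : ℕ} (hd : 0 < d)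
    (h : cyclotomic d ℤ ∣ (s.map fun d => cyclotomic d ℤ).prod) : d ∈ s := by
  obtain ⟨e, he, hde⟩ := (cyclotomic.irreducible hd).prime.exists_mem_multiset_map_dvd h
  have := (cyclotomic.irreducible hd).associated_of_dvd (cyclotomic.irreducible (hs e he)) hde
  have := eq_of_monic_of_associated (cyclotomic.monic d ℤ) (cyclotomic.monic e ℤ) this
  rwa [cyclotomic_injective this]

/-- A polynomial that becomes a product of cyclotomic polynomials when it is multiplied by such
a product is itself a product of cyclotomic polynomials, since these are prime in `ℤ[X]`. -/
lemma of_mul {p q : ℤ[X]} (hq : IsCyclotomicProduct q) (h : IsCyclotomicProduct (q * p)) :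
    IsCyclotomicProduct p := by
  obtain ⟨s, hs, hqs⟩ := hq
  have h1 : IsCyclotomicProduct ((s.map fun d => cyclotomic d ℤ).prod * p) := by
    rcases hqs with rfl | rfl
    · exact h
    · simpa using h.neg
  clear h hqs
  induction s using Multiset.induction generalizing p with
  | empty => simpa using h1
  | cons d s ih =>
    refine ih (fun e he => hs e (Multiset.mem_cons_of_mem he)) ?_
    rw [Multiset.map_cons, Multiset.prod_cons, mul_assoc] at h1
    obtain ⟨t, ht, hpt⟩ := h1
    have hd : 0 < d := hs d (Multiset.mem_cons_self d s)
    have hdt : d ∈ t := by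
      refine mem_of_dvd ht hd ?_
      rcases hpt with h | h
      · exact ⟨_, h.symm⟩
      · exact (dvd_neg (a := cyclotomic d ℤ)).1 ⟨_, h.symm⟩
    obtain ⟨t, rfl⟩ := Multiset.exists_cons_of_mem hdt
    refine ⟨t, fun e he => ht e (Multiset.mem_cons_of_mem he), ?_⟩
    rw [Multiset.map_cons, Multiset.prod_cons, ← mul_neg] at hpt
    exact hpt.imp (mul_left_cancel₀ (cyclotomic_ne_zero d ℤ))
      (mul_left_cancel₀ (cyclotomic_ne_zero d ℤ))

lemma one_sub_X_pow {k : ℕ} (hk : 0 < k) : IsCyclotomicProduct (1 - X ^ k) := by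
  refine ⟨k.divisors.val, fun d hd => Nat.pos_of_mem_divisors hd, Or.inr ?_⟩
  have := prod_cyclotomic_eq_X_pow_sub_one hk ℤ
  rw [Finset.prod] at this
  rw [this]
  ring

lemma one_add_X_pow {k : ℕ} (hk : 0 < k) : IsCyclotomicProduct (1 + X ^ k) := by
  refine (one_sub_X_pow hk).of_mul ?_
  have := one_sub_X_pow (show 0 < 2 * k by omega)
  rwa [show (1 - X ^ k) * (1 + X ^ k) = (1 - X ^ (2 * k) : ℤ[X]) by ring]

lemma leadingCoeff {p : ℤ[X]} (hp : IsCyclotomicProduct p) :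
    p.leadingCoeff = 1 ∨ p.leadingCoeff = -1 := by
  obtain ⟨s, hs, h⟩ := hp
  have hm : ((s.map fun d => cyclotomic d ℤ).prod).Monic :=
    monic_multiset_prod_of_monic s _ fun d _ => cyclotomic.monic d ℤ
  rcases h with rfl | rfl
  · exact Or.inl hm
  · right; rw [leadingCoeff_neg, hm]

lemma norm_root {p : ℤ[X]} (hp : IsCyclotomicProduct p) {z : ℂ} (hz : aeval z p = 0) :
    ‖z‖ = 1 := by
  obtain ⟨s, hs, h⟩ := hp
  have h0 : aeval z (s.map fun d => cyclotomic d ℤ).prod = 0 := by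
    rcases h with rfl | rfl
    · exact hz
    · simpa using hz
  rw [map_multiset_prod, Multiset.prod_eq_zero_iff, Multiset.map_map] at h0
  obtain ⟨d, hd, h1⟩ := Multiset.mem_map.1 h0
  obtain ⟨r, hr⟩ := cyclotomic.dvd_X_pow_sub_one d ℤ
  have h2 : z ^ d = 1 := by
    have := congrArg (aeval z) hr
    rw [map_mul, show aeval z (cyclotomic d ℤ) = 0 from h1, zero_mul] at this
    simpa [sub_eq_zero] using this
  exact Complex.norm_eq_one_of_pow_eq_one h2 (hs d hd).ne'

end IsCyclotomicProduct

lemma isCyclotomicProduct_qProd (m : ℕ) : IsCyclotomicProduct (qProd m) :=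
  .prod _ _ fun j _ => .one_sub_X_pow (by omega)

lemma isCyclotomicProduct_sqProd (g m : ℕ) : IsCyclotomicProduct (sqProd g m) :=
  .prod _ _ fun j _ => (IsCyclotomicProduct.one_sub_X_pow (by omega)).pow 2

lemma isCyclotomicProduct_singlesProd (k g : ℕ) : IsCyclotomicProduct (singlesProd g k) := by
  induction k using Nat.twoStepInduction generalizing g with
  | zero => exact .one
  | one => exact (IsCyclotomicProduct.one_sub_X_pow (by omega)).pow 2
  | more k ih _ =>
    exact ((IsCyclotomicProduct.one_sub_X_pow (by omega)).pow 2).mul (ih (g + 1))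

lemma isCyclotomicProduct_blockProd (ds : List ℕ) : IsCyclotomicProduct (blockProd ds) := by
  induction ds with
  | nil => exact .one
  | cons d ds ih =>
    rw [show blockProd (d :: ds) = qProd (d / 2) * blockProd ds by simp [blockProd]]
    exact (isCyclotomicProduct_qProd _).mul ih

/-- The trinomial `x^a + 2 x^b + 1` with `0 < a < 2b` is not a product of cyclotomic polynomials:
a root `z` of absolute value `1` satisfies `|1 + z^a| = 2`, so `z^a = 1` and `z^b = -1`. Hence all
roots are simple, and their number is at most `min a b`. -/
lemma not_isCyclotomicProduct_trinomial {a b : ℕ} (ha : 0 < a) (hb : 0 < b) (hab : a < 2 * b) :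
    ¬ IsCyclotomicProduct (X ^ a + 2 * X ^ b + 1) := by
  intro h
  set p : ℤ[X] := X ^ a + 2 * X ^ b + 1 with hp
  have hroot : ∀ z : ℂ, aeval z p = 0 → z ^ a = 1 ∧ z ^ b = -1 := by
    intro z hz
    have hn := h.norm_root hz
    have hz' : z ^ a + 2 * z ^ b + 1 = 0 := by simpa [hp, map_ofNat] using hz
    have h1 : ‖z ^ a‖ = 1 := by rw [norm_pow, hn, one_pow]
    have h2 : ‖z ^ b‖ = 1 := by rw [norm_pow, hn, one_pow]
    have h3 : z ^ a + 1 = -2 * z ^ b := by linear_combination hz'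
    have h4 : ‖z ^ a + 1‖ = 2 := by rw [h3, norm_mul, h2]; simp
    have h5 : z ^ a = 1 := by
      have e1 : (z ^ a).re ^ 2 + (z ^ a).im ^ 2 = 1 := by
        have := Complex.sq_norm (z ^ a)
        rw [h1, Complex.normSq_apply] at this
        linarith
      have e2 : ((z ^ a).re + 1) ^ 2 + (z ^ a).im ^ 2 = 4 := by
        have := Complex.sq_norm (z ^ a + 1)
        rw [h4, Complex.normSq_apply] at this
        simp only [Complex.add_re, Complex.add_im, Complex.one_re, Complex.one_im] at this
        linarith
      have e3 : (z ^ a).re = 1 := by linarith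
      have e4 : (z ^ a).im = 0 := by
        rw [e3] at e1
        exact pow_eq_zero_iff (two_ne_zero) |>.1 (by linarith)
      exact Complex.ext e3 e4
    refine ⟨h5, ?_⟩
    rw [h5] at hz'
    linear_combination hz' / 2
  set P : ℂ[X] := p.map (Int.castRingHom ℂ) with hP
  have hPe : P = X ^ a + 2 * X ^ b + 1 := by simp [hP, hp]
  have hP0 : P ≠ 0 := by
    intro h0
    have : aeval (1 : ℂ) p = 0 := by
      have := congrArg (eval 1) h0
      simpa [hPe, hp, map_ofNat] using this
    have := (hroot 1 this).2
    norm_num at this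
  have hrootP : ∀ z ∈ P.roots, z ^ a = 1 ∧ z ^ b = -1 := by
    intro z hz
    refine hroot z ?_
    have := (mem_roots hP0).1 hz
    rw [IsRoot.def, hPe] at this
    simpa [hp, map_ofNat] using this
  have hnodup : P.roots.Nodup := by
    rw [Multiset.nodup_iff_count_le_one]
    intro z
    by_contra hc
    rw [count_roots, not_le] at hc
    have hz : z ∈ P.roots := by
      rw [← Multiset.count_pos, count_roots]; omega
    have hd := (one_lt_rootMultiplicity_iff_isRoot hP0).1 hc
    obtain ⟨h1, h2⟩ := hrootP z hz
    have hd1 := hd.2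
    rw [IsRoot.def, hPe] at hd1
    have e : (a : ℂ) * z ^ (a - 1) + 2 * (b * z ^ (b - 1)) = 0 := by
      simpa [derivative_X_pow] using hd1
    obtain ⟨a, rfl⟩ := Nat.exists_eq_add_of_lt ha
    obtain ⟨b, rfl⟩ := Nat.exists_eq_add_of_lt hb
    have e2 : ((0 + a + 1 : ℕ) : ℂ) = 2 * ((0 + b + 1 : ℕ) : ℂ) := by
      have := congrArg (· * z) e
      simp only [Nat.add_sub_cancel, zero_mul, add_mul, mul_assoc, ← pow_succ, h1, h2] at this
      linear_combination this
    have : 0 + a + 1 = 2 * (0 + b + 1) := by exact_mod_cast e2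
    omega
  have hcard : P.natDegree = P.roots.toFinset.card := by
    rw [Multiset.toFinset_card_of_nodup hnodup]
    exact (splits_iff_card_roots.1 (IsAlgClosed.splits P)).symm
  have hle : ∀ (k : ℕ) (c : ℂ), 0 < k → (∀ z ∈ P.roots, z ^ k = c) → P.natDegree ≤ k := by
    intro k c hk hz
    rw [hcard]
    calc P.roots.toFinset.card ≤ (nthRoots k c).toFinset.card :=
          Finset.card_le_card fun z hzP => Multiset.mem_toFinset.2
            ((mem_nthRoots hk).2 (hz z (Multiset.mem_toFinset.1 hzP)))
      _ ≤ (nthRoots k c).card := Multiset.toFinset_card_le _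
      _ ≤ k := card_nthRoots k c
  have hdeg_a := hle a 1 ha fun z hz => (hrootP z hz).1
  have hdeg_b := hle b (-1) hb fun z hz => (hrootP z hz).2
  have hcoeff : ∀ k, P.coeff k = (if k = a then 1 else 0) + 2 * (if k = b then 1 else 0) +
      (if k = 0 then 1 else 0) := by
    intro k
    rw [hPe, show (2 : ℂ[X]) = Polynomial.C 2 from rfl]
    simp [coeff_X_pow, coeff_one]
  rcases lt_trichotomy a b with hlt | rfl | hlt
  · have := le_natDegree_of_ne_zero (p := P) (n := b) (by rw [hcoeff]; simp [hlt.ne', hb.ne'])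
    omega
  · have hp3 : p = Polynomial.C 3 * X ^ a + Polynomial.C 1 := by
      rw [hp, show (Polynomial.C 3 : ℤ[X]) = 3 from rfl, C_1]; ring
    have h3 : p.leadingCoeff = 3 := by
      rw [hp3, leadingCoeff_add_of_degree_lt']
      · exact leadingCoeff_C_mul_X_pow 3 a
      · rw [degree_C_mul_X_pow a (by norm_num : (3 : ℤ) ≠ 0)]
        exact lt_of_le_of_lt degree_C_le (by exact_mod_cast ha)
    rcases h.leadingCoeff with h | h <;> rw [h3] at h <;> norm_num at h
  · have := le_natDegree_of_ne_zero (p := P) (n := a) (by rw [hcoeff]; simp [hlt.ne', ha.ne'])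
    omega

/-! ### Positive roots and the length functions -/

section Roots
variable {n : ℕ}

/-- The linear functional with values `0, 1, …, n - 1` on the standard basis. It has the value `1`
on all simple roots, so it computes heights. -/
def height (v : Fin n → ℤ) : ℤ := ∑ j : Fin n, v j * (j : ℤ)

lemma height_add (u v : Fin n → ℤ) : height (u + v) = height u + height v := by
  simp [height, add_mul, Finset.sum_add_distrib]

lemma height_neg (v : Fin n → ℤ) : height (-v) = -height v := by
  simp [height]

lemma height_sub (u v : Fin n → ℤ) : height (u - v) = height u - height v := by
  rw [sub_eq_add_neg, height_add, height_neg, sub_eq_add_neg]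

lemma height_zsmul (c : ℤ) (v : Fin n → ℤ) : height (c • v) = c * height v := by
  simp [height, Finset.mul_sum, mul_assoc]

lemma height_sum {ι : Type*} (s : Finset ι) (f : ι → Fin n → ℤ) :
    height (∑ k ∈ s, f k) = ∑ k ∈ s, height (f k) := by
  classical
  induction s using Finset.induction_on with
  | empty => simp [height]
  | insert a s ha ih => rw [Finset.sum_insert ha, Finset.sum_insert ha, height_add, ih]

lemma e_neg (a : ℤ) : e n (-a) = -e n a := by
  funext j
  simp only [e, Pi.neg_apply]
  split_ifs <;> omega

lemma e_succ (i : Fin n) : e n ((i : ℤ) + 1) = Pi.single i 1 := by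
  funext j
  simp only [e, Pi.single_apply, Fin.ext_iff]
  split_ifs <;> omega

lemma height_e {a : ℤ} (h1 : 1 ≤ a) (h2 : a ≤ n) : height (e n a) = a - 1 := by
  have : a = (((⟨(a - 1).toNat, by omega⟩ : Fin n) : ℕ) : ℤ) + 1 := by simp; omega
  rw [this, e_succ]
  simp [height, Pi.single_apply]

lemma height_simpleRoot {k : ℕ} (hn : 2 ≤ n) (hk : k < n) : height (simpleRoot n k) = 1 := by
  unfold simpleRoot
  split_ifs with h
  · rw [height_add, height_e (by omega) (by omega), height_e (by omega) (by omega)]; norm_num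
  · rw [height_sub, height_e (by omega) (by omega), height_e (by omega) (by omega)]; ring

lemma HasHeight.eq {v : Fin n → ℤ} {h : ℤ} (hn : 2 ≤ n) (hv : HasHeight n v h) :
    h = height v := by
  obtain ⟨c, rfl, rfl⟩ := hv
  rw [height_sum]
  refine Finset.sum_congr rfl fun k hk => ?_
  rw [height_zsmul, height_simpleRoot hn (Finset.mem_range.1 hk), mul_one]

/-- Nonnegative integral combinations of simple roots. -/
def IsPosComb (n : ℕ) (v : Fin n → ℤ) : Prop :=
  ∃ c : ℕ → ℕ, v = ∑ k ∈ Finset.range n, (c k : ℤ) • simpleRoot n k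

lemma IsPosComb.add {u v : Fin n → ℤ} (hu : IsPosComb n u) (hv : IsPosComb n v) :
    IsPosComb n (u + v) := by
  obtain ⟨c, rfl⟩ := hu
  obtain ⟨d, rfl⟩ := hv
  exact ⟨fun k => c k + d k, by simp [add_smul, Finset.sum_add_distrib]⟩

lemma isPosComb_zero : IsPosComb n 0 := ⟨fun _ => 0, by simp⟩

lemma isPosComb_simpleRoot {k : ℕ} (hk : k < n) : IsPosComb n (simpleRoot n k) :=
  ⟨fun i => if i = k then 1 else 0, by simp [hk]⟩

lemma IsPosComb.height_nonneg {v : Fin n → ℤ} (hn : 2 ≤ n) (hv : IsPosComb n v) :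
    0 ≤ height v := by
  obtain ⟨c, rfl⟩ := hv
  rw [height_sum]
  refine Finset.sum_nonneg fun k hk => ?_
  rw [height_zsmul, height_simpleRoot hn (Finset.mem_range.1 hk), mul_one]
  positivity

lemma IsPosComb.hasHeight {v : Fin n → ℤ} (hn : 2 ≤ n) (hv : IsPosComb n v) :
    HasHeight n v (height v) := by
  obtain ⟨c, hc⟩ := hv
  have h : HasHeight n v (∑ k ∈ Finset.range n, (c k : ℤ)) := ⟨fun k => c k, hc, rfl⟩
  rwa [← h.eq hn]

lemma isPosComb_sub {i j : ℕ} (hi : 1 ≤ i) (hij : i ≤ j) (hj : j ≤ n) :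
    IsPosComb n (e n j - e n i) := by
  induction j, hij using Nat.le_induction with
  | base => rw [sub_self]; exact isPosComb_zero
  | succ j hij ih =>
    have h1 : simpleRoot n j = e n ((j + 1 : ℕ) : ℤ) - e n j := by
      rw [simpleRoot, if_neg (by omega)]; push_cast; rfl
    have h2 : e n ((j + 1 : ℕ) : ℤ) - e n i = (e n j - e n i) + simpleRoot n j := by
      rw [h1]; abel
    rw [h2]
    exact (ih (by omega)).add (isPosComb_simpleRoot (by omega))

lemma isPosComb_add {i j : ℕ} (hi : 1 ≤ i) (hij : i < j) (hj : j ≤ n) :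
    IsPosComb n (e n i + e n j) := by
  have h1 : e n i + e n j = simpleRoot n 0 + (e n i - e n (1 : ℕ)) + (e n j - e n (2 : ℕ)) := by
    rw [simpleRoot, if_pos rfl]; push_cast; abel
  rw [h1]
  exact ((isPosComb_simpleRoot (by omega)).add (isPosComb_sub le_rfl hi (by omega))).add
    (isPosComb_sub (by omega) (by omega) hj)

/-- A root is positive if and only if its height is positive. -/
lemma mem_posRoots_iff (hn : 2 ≤ n) {v : Fin n → ℤ} :
    v ∈ posRoots n ↔ v ∈ roots n ∧ 0 < height v := by
  refine and_congr_right fun hv => ?_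
  change IsPosComb n v ↔ _
  obtain ⟨i, j, hi, hij, hj, h⟩ := hv
  lift i to ℕ using by omega
  lift j to ℕ using by omega
  have hi' := height_e (n := n) (a := i) hi (by omega)
  have hj' := height_e (n := n) (a := j) (by omega) hj
  have h1 := isPosComb_add (n := n) (i := i) (j := j) (by omega) (by omega) (by omega)
  have h2 := isPosComb_sub (n := n) (i := i) (j := j) (by omega) (by omega) (by omega)
  rcases h with rfl | rfl | rfl | rfl
  · refine iff_of_true h1 ?_
    rw [height_add]; omega
  · refine iff_of_false (fun h => ?_) ?_
    · have := h.height_nonneg hn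
      rw [height_neg, height_add] at this; omega
    · rw [height_neg, height_add]; omega
  · refine iff_of_false (fun h => ?_) ?_
    · have := h.height_nonneg hn
      rw [height_sub] at this; omega
    · rw [height_sub]; omega
  · refine iff_of_true (by rwa [neg_sub]) ?_
    rw [height_neg, height_sub]; omega

lemma neg_mem_roots {v : Fin n → ℤ} (hv : v ∈ roots n) : -v ∈ roots n := by
  obtain ⟨i, j, hi, hij, hj, h⟩ := hv
  refine ⟨i, j, hi, hij, hj, ?_⟩
  rcases h with rfl | rfl | rfl | rfl <;> simp

lemma mem_negRoots_iff (hn : 2 ≤ n) {v : Fin n → ℤ} (hv : v ∈ roots n) :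
    v ∈ negRoots n ↔ height v < 0 := by
  rw [negRoots, Set.mem_ofPred_eq, mem_posRoots_iff hn, height_neg]
  exact ⟨fun h => by have := h.2; omega, fun h => ⟨neg_mem_roots hv, by omega⟩⟩

lemma add_mem_roots {a b : ℤ} (ha : a ≠ 0) (hb : b ≠ 0) (hab : |a| ≠ |b|) (ha' : |a| ≤ n)
    (hb' : |b| ≤ n) : e n a + e n b ∈ roots n := by
  wlog h : |a| < |b| generalizing a b
  · rw [add_comm]
    exact this hb ha hab.symm hb' ha' (lt_of_le_of_ne (not_lt.1 h) hab.symm)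
  have ha0 := abs_pos.2 ha
  refine ⟨|a|, |b|, by omega, h, hb', ?_⟩
  rcases abs_choice a with h1 | h1 <;> rcases abs_choice b with h2 | h2 <;> rw [h1, h2]
  · exact Or.inl rfl
  · right; right; left
    rw [e_neg b]; abel
  · right; right; right
    rw [e_neg a]; abel
  · right; left
    rw [e_neg a, e_neg b]; abel

lemma height_e_signed {a : ℤ} (ha : a ≠ 0) (ha' : |a| ≤ n) :
    height (e n a) = if 0 < a then a - 1 else a + 1 := by
  have h0 := abs_le.1 ha'
  split_ifs with h
  · exact height_e (by omega) (by omega)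
  · have : e n a = -e n (-a) := by rw [e_neg a, neg_neg]
    rw [this, height_neg, height_e (by omega) (by omega)]; ring

lemma add_mem_negRoots_iff (hn : 2 ≤ n) {a b : ℤ} (ha : a ≠ 0) (hb : b ≠ 0) (hab : |a| ≠ |b|)
    (ha' : |a| ≤ n) (hb' : |b| ≤ n) : e n a + e n b ∈ negRoots n ↔ a + b < 0 := by
  rw [mem_negRoots_iff hn (add_mem_roots ha hb hab ha' hb'), height_add, height_e_signed ha ha',
    height_e_signed hb hb']
  have : a ≠ b ∧ a ≠ -b := ⟨fun h => hab (by rw [h]), fun h => hab (by rw [h, abs_neg])⟩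
  split_ifs <;> omega

lemma sub_mem_negRoots_iff (hn : 2 ≤ n) {a b : ℤ} (ha : a ≠ 0) (hb : b ≠ 0) (hab : |a| ≠ |b|)
    (ha' : |a| ≤ n) (hb' : |b| ≤ n) : e n b - e n a ∈ negRoots n ↔ b < a := by
  have := add_mem_negRoots_iff hn hb (neg_ne_zero.2 ha) (by rw [abs_neg]; exact hab.symm) hb'
    (by rwa [abs_neg])
  rw [e_neg a, ← sub_eq_add_neg] at this
  rw [this]
  omega

/-- The positive root `e_j + e_i` or `e_j - e_i` (for `i < j`). -/
def posRoot (x : (Fin n × Fin n) × Bool) : Fin n → ℤ :=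
  if x.2 then e n ((x.1.2 : ℤ) + 1) + e n ((x.1.1 : ℤ) + 1)
  else e n ((x.1.2 : ℤ) + 1) - e n ((x.1.1 : ℤ) + 1)

lemma mem_posRoots_iff_exists (hn : 2 ≤ n) {v : Fin n → ℤ} :
    v ∈ posRoots n ↔ ∃ x : (Fin n × Fin n) × Bool, x.1.1 < x.1.2 ∧ posRoot x = v := by
  rw [mem_posRoots_iff hn]
  constructor
  · rintro ⟨⟨i, j, hi, hij, hj, h⟩, hpos⟩
    have hi' := height_e (n := n) (a := i) hi (by omega)
    have hj' := height_e (n := n) (a := j) (by omega) hj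
    have ei : (((⟨(i - 1).toNat, by omega⟩ : Fin n) : ℕ) : ℤ) + 1 = i := by simp; omega
    have ej : (((⟨(j - 1).toNat, by omega⟩ : Fin n) : ℕ) : ℤ) + 1 = j := by simp; omega
    have hlt : (⟨(i - 1).toNat, by omega⟩ : Fin n) < ⟨(j - 1).toNat, by omega⟩ := by
      rw [Fin.mk_lt_mk]; omega
    rcases h with rfl | rfl | rfl | rfl
    · refine ⟨((⟨(i - 1).toNat, by omega⟩, ⟨(j - 1).toNat, by omega⟩), true), hlt, ?_⟩
      rw [posRoot, if_pos rfl]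
      simp only [ei, ej, add_comm]
    · rw [height_neg, height_add] at hpos; omega
    · rw [height_sub] at hpos; omega
    · refine ⟨((⟨(i - 1).toNat, by omega⟩, ⟨(j - 1).toNat, by omega⟩), false), hlt, ?_⟩
      rw [posRoot, if_neg (by simp)]
      simp only [ei, ej, neg_sub]
  · rintro ⟨⟨⟨i, j⟩, b⟩, hij, rfl⟩
    have hij : (i : ℕ) < j := hij
    have hi' := height_e (n := n) (a := (i : ℤ) + 1) (by omega) (by omega)
    have hj' := height_e (n := n) (a := (j : ℤ) + 1) (by omega) (by omega)
    cases b
    · rw [posRoot, if_neg (by simp)]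
      refine ⟨⟨(i : ℤ) + 1, (j : ℤ) + 1, by omega, by omega, by omega, ?_⟩, ?_⟩
      · simp
      · rw [height_sub, hi', hj']; omega
    · rw [posRoot, if_pos rfl]
      refine ⟨⟨(i : ℤ) + 1, (j : ℤ) + 1, by omega, by omega, by omega, ?_⟩, ?_⟩
      · left; exact add_comm _ _
      · rw [height_add, hi', hj']; omega

lemma posRoot_injOn :
    Set.InjOn (posRoot (n := n)) {x | x.1.1 < x.1.2} := by
  rintro ⟨⟨i, j⟩, b⟩ hx ⟨⟨i', j'⟩, b'⟩ hx' h
  have hx : i < j := hx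
  have hx' : i' < j' := hx'
  have hval : ∀ (i j : Fin n) (b : Bool), i < j → posRoot ((i, j), b) j = 1 ∧
      (posRoot ((i, j), b) i = if b then 1 else -1) ∧
      ∀ k, k ≠ i → k ≠ j → posRoot ((i, j), b) k = 0 := by
    intro i j b hij
    cases b <;> simp [posRoot, e_succ, Pi.single_apply, hij.ne, hij.ne', sub_eq_add_neg] <;>
      intro k h1 h2 <;> simp [h1, h2]
  obtain ⟨h1, h2, h3⟩ := hval i j b hx
  obtain ⟨h1', h2', h3'⟩ := hval i' j' b' hx'
  rw [h] at h1 h2 h3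
  have hj : j = i' ∨ j = j' := by
    by_contra hc
    push Not at hc
    rw [h3' j hc.1 hc.2] at h1
    exact zero_ne_one h1
  have hi : i = i' ∨ i = j' := by
    by_contra hc
    push Not at hc
    rw [h3' i hc.1 hc.2] at h2
    cases b <;> simp at h2
  have hii : i = i' ∧ j = j' := by
    rcases hi with rfl | rfl <;> rcases hj with rfl | rfl
    · exact absurd hx (lt_irrefl _)
    · exact ⟨rfl, rfl⟩
    · exact absurd (hx.trans hx') (lt_irrefl _)
    · exact absurd hx (lt_irrefl _)
  obtain ⟨rfl, rfl⟩ := hii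
  rw [h2'] at h2
  cases b <;> cases b' <;> simp_all

lemma act_add (σ : Equiv.Perm (SignedIdx n)) (u v : Fin n → ℤ) :
    act σ (u + v) = act σ u + act σ v := by
  simp [act, add_smul, Finset.sum_add_distrib]

lemma act_sub (σ : Equiv.Perm (SignedIdx n)) (u v : Fin n → ℤ) :
    act σ (u - v) = act σ u - act σ v := by
  simp [act, sub_smul, Finset.sum_sub_distrib]

lemma act_e (σ : Equiv.Perm (SignedIdx n)) (i : Fin n) :
    act σ (e n ((i : ℤ) + 1)) = e n (σ (posIdx i)) := by
  rw [e_succ, act, Finset.sum_eq_single i]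
  · simp
  · intro j _ hj; simp [hj]
  · simp

lemma SignedIdx.ne_zero (a : SignedIdx n) : (a : ℤ) ≠ 0 := (Finset.mem_erase.1 a.2).1

lemma SignedIdx.abs_le (a : SignedIdx n) : |(a : ℤ)| ≤ n :=
  _root_.abs_le.2 (Finset.mem_Icc.1 (Finset.mem_erase.1 a.2).2)

/-- The element `-a` of `[n]_±`. -/
def negIdx (a : SignedIdx n) : SignedIdx n :=
  ⟨-(a : ℤ), by
    have h := a.2
    simp only [Finset.mem_erase, Finset.mem_Icc] at h ⊢
    omega⟩

lemma IsSigned.map_negIdx {σ : Equiv.Perm (SignedIdx n)} (hσ : IsSigned σ) (a : SignedIdx n) :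
    (σ (negIdx a) : ℤ) = -(σ a : ℤ) := hσ a (negIdx a) rfl

lemma IsSigned.abs_ne {σ : Equiv.Perm (SignedIdx n)} (hσ : IsSigned σ) {i j : Fin n}
    (hij : i ≠ j) : |(σ (posIdx i) : ℤ)| ≠ |(σ (posIdx j) : ℤ)| := by
  intro h
  have hij' : (i : ℕ) ≠ j := fun h => hij (Fin.ext h)
  rcases abs_eq_abs.1 h with h | h
  · have := congrArg Subtype.val (σ.injective (Subtype.ext h))
    simp only [posIdx] at this
    omega
  · rw [← hσ.map_negIdx] at h
    have := congrArg Subtype.val (σ.injective (Subtype.ext h))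
    simp only [posIdx, negIdx] at this
    omega

lemma act_posRoot_mem_negRoots (hn : 2 ≤ n) {σ : Equiv.Perm (SignedIdx n)} (hσ : IsSigned σ)
    (x : (Fin n × Fin n) × Bool) (hx : x.1.1 < x.1.2) :
    act σ (posRoot x) ∈ negRoots n ↔
      if x.2 then (σ (posIdx x.1.1) : ℤ) + σ (posIdx x.1.2) < 0
      else (σ (posIdx x.1.2) : ℤ) < σ (posIdx x.1.1) := by
  have h := hσ.abs_ne hx.ne
  unfold posRoot
  split_ifs
  · rw [act_add, act_e, act_e, add_comm]
    exact add_mem_negRoots_iff hn (SignedIdx.ne_zero _) (SignedIdx.ne_zero _) h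
      (SignedIdx.abs_le _) (SignedIdx.abs_le _)
  · rw [act_sub, act_e, act_e]
    exact sub_mem_negRoots_iff hn (SignedIdx.ne_zero _) (SignedIdx.ne_zero _) h
      (SignedIdx.abs_le _) (SignedIdx.abs_le _)

lemma hasHeight_posRoot_odd_iff (hn : 2 ≤ n) (x : (Fin n × Fin n) × Bool) (hx : x.1.1 < x.1.2) :
    (∃ h : ℤ, HasHeight n (posRoot x) h ∧ Odd h) ↔ Odd ((x.1.1 : ℕ) + x.1.2) := by
  have hpos : posRoot x ∈ posRoots n := (mem_posRoots_iff_exists hn).2 ⟨x, hx, rfl⟩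
  have hh : HasHeight n (posRoot x) (height (posRoot x)) := IsPosComb.hasHeight hn hpos.2
  have hx' : (x.1.1 : ℕ) < x.1.2 := hx
  have e1 := height_e (n := n) (a := (x.1.1 : ℤ) + 1) (by omega) (by omega)
  have e2 := height_e (n := n) (a := (x.1.2 : ℤ) + 1) (by omega) (by omega)
  have key : Odd (height (posRoot x)) ↔ Odd ((x.1.1 : ℕ) + x.1.2) := by
    have : Odd ((x.1.1 : ℕ) + x.1.2) ↔ Odd (((x.1.1 : ℕ) : ℤ) + x.1.2) := by
      exact_mod_cast Iff.rfl
    rw [this]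
    unfold posRoot
    split_ifs
    · rw [height_add, e1, e2, Int.odd_iff, Int.odd_iff]; omega
    · rw [height_sub, e1, e2, Int.odd_iff, Int.odd_iff]; omega
  rw [← key]
  exact ⟨fun ⟨h, h1, h2⟩ => by rwa [← h1.eq hn], fun h => ⟨_, hh, h⟩⟩

lemma ncard_posRoots (hn : 2 ≤ n) {σ : Equiv.Perm (SignedIdx n)} (hσ : IsSigned σ)
    (P : (Fin n → ℤ) → Prop) (Q : Fin n → Fin n → Prop) [DecidableRel Q]
    (hPQ : ∀ x : (Fin n × Fin n) × Bool, x.1.1 < x.1.2 → (P (posRoot x) ↔ Q x.1.1 x.1.2)) :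
    Set.ncard {v | v ∈ posRoots n ∧ P v ∧ act σ v ∈ negRoots n} =
      ∑ i : Fin n, ∑ j : Fin n, if i < j ∧ Q i j then
        pairInv (σ (posIdx i)) (σ (posIdx j)) else 0 := by
  classical
  have hset : {v | v ∈ posRoots n ∧ P v ∧ act σ v ∈ negRoots n} = posRoot ''
      ((Finset.univ.filter fun x : (Fin n × Fin n) × Bool => (x.1.1 < x.1.2 ∧ Q x.1.1 x.1.2) ∧
        if x.2 then (σ (posIdx x.1.1) : ℤ) + σ (posIdx x.1.2) < 0
        else (σ (posIdx x.1.2) : ℤ) < σ (posIdx x.1.1) : Finset _) : Set _) := by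
    ext v
    simp only [Set.mem_ofPred_eq, Set.mem_image, Finset.coe_filter, Finset.mem_univ, true_and]
    constructor
    · rintro ⟨h1, h2, h3⟩
      obtain ⟨x, hx, rfl⟩ := (mem_posRoots_iff_exists hn).1 h1
      exact ⟨x, ⟨⟨hx, (hPQ x hx).1 h2⟩, (act_posRoot_mem_negRoots hn hσ x hx).1 h3⟩, rfl⟩
    · rintro ⟨x, ⟨⟨hx, h2⟩, h3⟩, rfl⟩
      exact ⟨(mem_posRoots_iff_exists hn).2 ⟨x, hx, rfl⟩, (hPQ x hx).2 h2,
        (act_posRoot_mem_negRoots hn hσ x hx).2 h3⟩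
  rw [hset, Set.InjOn.ncard_image, Set.ncard_coe_finset, Finset.card_filter,
    ← Finset.univ_product_univ, Finset.sum_product, ← Finset.univ_product_univ,
    Finset.sum_product]
  · refine Finset.sum_congr rfl fun i _ => Finset.sum_congr rfl fun j _ => ?_
    rw [Fintype.sum_bool]
    by_cases h : i < j ∧ Q i j
    · simp [h, pairInv, add_comm]
    · simp [h]
  · refine posRoot_injOn.mono fun x hx => ?_
    simp only [Finset.coe_filter, Finset.mem_univ, true_and, Set.mem_ofPred_eq] at hx
    exact hx.1.1

lemma len_eq_sum (hn : 2 ≤ n) {σ : Equiv.Perm (SignedIdx n)} (hσ : IsSigned σ) :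
    len σ = ∑ i : Fin n, ∑ j : Fin n, if i < j then
      pairInv (σ (posIdx i)) (σ (posIdx j)) else 0 := by
  simpa [len] using ncard_posRoots hn hσ (fun _ => True) (fun _ _ => True) (by simp)

lemma oddLen_eq_sum (hn : 2 ≤ n) {σ : Equiv.Perm (SignedIdx n)} (hσ : IsSigned σ) :
    oddLen σ = ∑ i : Fin n, ∑ j : Fin n, if i < j ∧ Odd ((i : ℕ) + j) then
      pairInv (σ (posIdx i)) (σ (posIdx j)) else 0 :=
  ncard_posRoots hn hσ _ (fun i j => Odd ((i : ℕ) + j)) (hasHeight_posRoot_odd_iff hn)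

/-- The one-line notation of a signed permutation. -/
def oneLine (σ : Equiv.Perm (SignedIdx n)) : List ℤ := List.ofFn fun j => (σ (posIdx j) : ℤ)

end Roots

/-- A product over all pairs of positions of a list. -/
def pairProd {α M : Type*} [CommMonoid M] (g : α → α → M) : List α → M
  | [] => 1
  | x :: l => (l.map (g x)).prod * pairProd g l

lemma pairProd_ofFn {α M : Type*} [CommMonoid M] (g : α → α → M) {n : ℕ} (z : Fin n → α) :
    pairProd g (List.ofFn z) = ∏ i, ∏ j, if i < j then g (z i) (z j) else 1 := by
  induction n with
  | zero => simp [pairProd]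
  | succ n ih =>
    rw [List.ofFn_succ, pairProd, ih, Fin.prod_univ_succ]
    simp only [Fin.prod_univ_succ, Fin.succ_lt_succ_iff, Fin.succ_pos, if_true, lt_irrefl,
      if_false, one_mul, Fin.not_lt_zero, List.map_ofFn, List.prod_ofFn, Function.comp_apply]

lemma wt_eq_pairProd (l : List (Bool × ℤ)) :
    wt l = pairProd (fun x y => invWt x.1 y.1 ^ pairInv x.2 y.2) l := by
  induction l with
  | nil => rfl
  | cons x l ih => rw [wt, pairProd, ih]

lemma place_ofFn (p : Bool) {n : ℕ} (a : Fin n → ℤ) :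
    place p (List.ofFn a) = List.ofFn fun i => (par p i, a i) := by
  induction n generalizing p with
  | zero => simp [place]
  | succ n ih => simp [List.ofFn_succ, place, ih, par_succ]

/-- The sign and the odd length of a signed permutation are recorded by the weight of its
one-line notation. -/
lemma neg_one_pow_len_mul {n : ℕ} (hn : 2 ≤ n) {σ : Equiv.Perm (SignedIdx n)}
    (hσ : IsSigned σ) : (-1) ^ len σ * X ^ oddLen σ = wt (place false (oneLine σ)) := by
  rw [len_eq_sum hn hσ, oddLen_eq_sum hn hσ, oneLine, place_ofFn, wt_eq_pairProd, pairProd_ofFn]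
  simp only [← Finset.prod_pow_eq_pow_sum, ← Finset.prod_mul_distrib]
  refine Finset.prod_congr rfl fun i _ => Finset.prod_congr rfl fun j _ => ?_
  by_cases h : i < j
  · have hodd : par false i = par false j ↔ ¬ Odd ((i : ℕ) + j) := by
      rw [Nat.odd_iff, Nat.mod_two_of_bodd, Nat.bodd_add, par, par]
      cases (i : ℕ).bodd <;> cases (j : ℕ).bodd <;> simp
    by_cases h2 : Odd ((i : ℕ) + j)
    · have h3 : ¬ par false i = par false j := fun h4 => hodd.1 h4 h2
      simp only [h, h2, invWt, h3, if_true, if_false, and_self]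
      rw [← mul_pow, neg_one_mul]
    · simp only [h, h2, invWt, hodd.2 h2, if_true, if_false, and_false, pow_zero, mul_one]
  · simp [h]

/-! ### Descents in one-line notation -/

lemma pairProd_swap {α M : Type*} [CommMonoid M] (g : α → α → M) (l₁ l₂ : List α) (x y : α) :
    pairProd g (l₁ ++ x :: y :: l₂) * g y x = pairProd g (l₁ ++ y :: x :: l₂) * g x y := by
  induction l₁ with
  | nil =>
    simp only [List.nil_append, pairProd, List.map_cons, List.prod_cons]
    ac_rfl
  | cons z l₁ ih =>
    have hp : ((l₁ ++ x :: y :: l₂).map (g z)).prod = ((l₁ ++ y :: x :: l₂).map (g z)).prod :=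
      (((List.Perm.swap y x l₂).append_left l₁).map _).prod_eq
    simp only [List.cons_append, pairProd, hp, mul_assoc, ih]

lemma list_eq_take_cons_cons_drop {α : Type*} (l : List α) (k : ℕ) (h : k + 1 < l.length) :
    l = l.take k ++ l[k] :: l[k + 1] :: l.drop (k + 2) := by
  conv_lhs => rw [← List.take_append_drop k l, List.drop_eq_getElem_cons (by omega),
    List.drop_eq_getElem_cons h]

lemma ofFn_eq_append {α : Type*} {n : ℕ} (a b : Fin n → α) (k : ℕ) (hk : k + 1 < n)
    (h : ∀ j : Fin n, (j : ℕ) ≠ k → (j : ℕ) ≠ k + 1 → b j = a j) :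
    ∃ l₁ l₂, l₁.length = k ∧
      List.ofFn a = l₁ ++ a ⟨k, by omega⟩ :: a ⟨k + 1, hk⟩ :: l₂ ∧
      List.ofFn b = l₁ ++ b ⟨k, by omega⟩ :: b ⟨k + 1, hk⟩ :: l₂ := by
  refine ⟨(List.ofFn a).take k, (List.ofFn a).drop (k + 2), by simp; omega, ?_, ?_⟩
  · have h1 := list_eq_take_cons_cons_drop (List.ofFn a) k (by simpa using hk)
    rwa [List.getElem_ofFn, List.getElem_ofFn] at h1
  · have h1 := list_eq_take_cons_cons_drop (List.ofFn b) k (by simpa using hk)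
    have h2 : (List.ofFn b).take k = (List.ofFn a).take k := by
      refine List.ext_getElem (by simp) fun i hi _ => ?_
      simp only [List.length_take, List.length_ofFn] at hi
      simp only [List.getElem_take, List.getElem_ofFn]
      exact h _ (by simp; omega) (by simp; omega)
    have h3 : (List.ofFn b).drop (k + 2) = (List.ofFn a).drop (k + 2) := by
      refine List.ext_getElem (by simp) fun i hi _ => ?_
      simp only [List.getElem_drop, List.getElem_ofFn]
      exact h _ (by simp; omega) (by simp; omega)
    rwa [h2, h3, List.getElem_ofFn, List.getElem_ofFn] at h1

section
variable {n : ℕ}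

lemma two_pow_len (hn : 2 ≤ n) {σ : Equiv.Perm (SignedIdx n)} (hσ : IsSigned σ) :
    2 ^ len σ = pairProd (fun a b : ℤ => 2 ^ pairInv a b) (oneLine σ) := by
  rw [len_eq_sum hn hσ, oneLine, pairProd_ofFn]
  simp only [← Finset.prod_pow_eq_pow_sum]
  refine Finset.prod_congr rfl fun i _ => Finset.prod_congr rfl fun j _ => ?_
  split_ifs <;> simp

lemma coe_transp (a b : ℤ) (ha : a ≠ 0) (ha' : |a| ≤ n) (hb : b ≠ 0) (hb' : |b| ≤ n)
    (p : SignedIdx n) :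
    (transp n a b p : ℤ) = if (p : ℤ) = a then b else if (p : ℤ) = b then a else (p : ℤ) := by
  have h : a ∈ (Finset.Icc (-(n : ℤ)) (n : ℤ)).erase 0 ∧
      b ∈ (Finset.Icc (-(n : ℤ)) (n : ℤ)).erase 0 := by
    simp only [Finset.mem_erase, Finset.mem_Icc]
    exact ⟨⟨ha, abs_le.1 ha'⟩, hb, abs_le.1 hb'⟩
  rw [transp, dif_pos h, Equiv.swap_apply_def]
  simp only [Subtype.ext_iff]
  split_ifs <;> rfl

lemma coe_gen_zero (hn : 2 ≤ n) (p : SignedIdx n) :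
    (gen n 0 p : ℤ) = if (p : ℤ) = 1 then (-2 : ℤ) else if (p : ℤ) = -2 then (1 : ℤ) else
      if (p : ℤ) = 2 then (-1 : ℤ) else if (p : ℤ) = -1 then (2 : ℤ) else (p : ℤ) := by
  have h1 : |(1 : ℤ)| ≤ n := by simp; omega
  have h2 : |(2 : ℤ)| ≤ n := by simp; omega
  rw [gen, if_pos rfl, Equiv.Perm.mul_apply, coe_transp _ _ (by norm_num) h1 (by norm_num)
    (by rwa [abs_neg]), coe_transp _ _ (by norm_num) h2 (by norm_num) (by rwa [abs_neg])]
  split_ifs <;> first | omega | contradiction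

lemma coe_gen_of_pos {i : ℕ} (hi : i ≠ 0) (hin : i < n) (p : SignedIdx n) :
    (gen n i p : ℤ) = if (p : ℤ) = i then (i : ℤ) + 1 else if (p : ℤ) = i + 1 then (i : ℤ) else
      if (p : ℤ) = -i then -((i : ℤ) + 1) else if (p : ℤ) = -((i : ℤ) + 1) then -(i : ℤ)
      else (p : ℤ) := by
  have h1 : |(i : ℤ)| ≤ n := by simp; omega
  have h2 : |(i : ℤ) + 1| ≤ n := by rw [abs_of_nonneg (by omega)]; omega
  rw [gen, if_neg hi, Equiv.Perm.mul_apply, coe_transp _ _ (by omega) h1 (by omega) h2,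
    coe_transp _ _ (by omega) (by rwa [abs_neg]) (by omega) (by rwa [abs_neg])]
  split_ifs <;> omega

lemma isSigned_gen (hn : 2 ≤ n) {i : ℕ} (hin : i < n) : IsSigned (gen n i) := by
  intro a b hab
  have ha := a.ne_zero
  rcases Nat.eq_zero_or_pos i with rfl | hi
  · rw [coe_gen_zero hn, coe_gen_zero hn, hab]
    split_ifs <;> omega
  · rw [coe_gen_of_pos hi.ne' hin, coe_gen_of_pos hi.ne' hin, hab]
    split_ifs <;> omega

lemma IsSigned.mul {σ τ : Equiv.Perm (SignedIdx n)} (hσ : IsSigned σ) (hτ : IsSigned τ) :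
    IsSigned (σ * τ) := fun a b hab => hσ (τ a) (τ b) (hτ a b hab)

/-- The condition on a word `w` that expresses `ℓ(σ s_i) > ℓ(σ)` in one-line notation. -/
def IsAscent (w : List ℤ) (i : ℕ) : Prop :=
  if i = 0 then 0 < w.getD 0 0 + w.getD 1 0 else w.getD (i - 1) 0 < w.getD i 0

lemma len_lt_len_mul_gen_iff (hn : 2 ≤ n) {σ : Equiv.Perm (SignedIdx n)} (hσ : IsSigned σ) {i : ℕ}
    (hin : i < n) : len σ < len (σ * gen n i) ↔ IsAscent (oneLine σ) i := by
  have h1 := two_pow_len hn hσ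
  have h2 := two_pow_len hn (hσ.mul (isSigned_gen hn hin))
  have hget : ∀ k (hk : k < n), (oneLine σ).getD k 0 = σ (posIdx ⟨k, hk⟩) := by
    intro k hk
    rw [List.getD_eq_getElem _ _ (by simpa [oneLine] using hk)]
    simp [oneLine]
  unfold IsAscent
  rcases Nat.eq_zero_or_pos i with rfl | hi
  · obtain ⟨l₁, l₂, hl, e1, e2⟩ := ofFn_eq_append (fun j => (σ (posIdx j) : ℤ))
      (fun j => ((σ * gen n 0) (posIdx j) : ℤ)) 0 (by omega) fun j hj hj' => by
        rw [Equiv.Perm.mul_apply]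
        congr 2
        refine Subtype.ext ?_
        rw [coe_gen_zero hn]
        simp only [posIdx]
        split_ifs <;> omega
    obtain rfl := List.length_eq_zero_iff.1 hl
    have g1 : gen n 0 (posIdx ⟨0, by omega⟩) = negIdx (posIdx ⟨1, by omega⟩) := by
      refine Subtype.ext ?_
      rw [coe_gen_zero hn]
      simp [posIdx, negIdx]
    have g2 : gen n 0 (posIdx ⟨0 + 1, by omega⟩) = negIdx (posIdx ⟨0, by omega⟩) := by
      refine Subtype.ext ?_
      rw [coe_gen_zero hn]
      simp [posIdx, negIdx]
    rw [if_pos rfl, hget 0 (by omega), hget 1 (by omega)]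
    simp only [Equiv.Perm.mul_apply, g1, g2, hσ.map_negIdx, List.nil_append] at e2
    rw [oneLine, e1] at h1
    simp only [oneLine, Equiv.Perm.mul_apply] at h2
    rw [e2] at h2
    simp only [List.nil_append, pairProd, List.map_cons, List.prod_cons, pairInv_neg_left] at h1 h2
    set x : ℤ := (σ (posIdx ⟨0, by omega⟩)).1
    set y : ℤ := (σ (posIdx ⟨0 + 1, hn⟩)).1
    have h3 : 2 ^ (len σ + pairInv y (-x)) = 2 ^ (len (σ * gen n 0) + pairInv x y) := by
      rw [pow_add, pow_add, h1, h2]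
      ring
    have h4 := Nat.pow_right_injective le_rfl h3
    have h5 : pairInv x y < pairInv y (-x) ↔ 0 < x + y := by
      simp only [pairInv]
      split_ifs <;> omega
    change _ ↔ 0 < x + y
    omega
  · obtain ⟨k, rfl⟩ := Nat.exists_eq_add_of_lt hi
    rw [Nat.zero_add] at *
    obtain ⟨l₁, l₂, hl, e1, e2⟩ := ofFn_eq_append (fun j => (σ (posIdx j) : ℤ))
      (fun j => ((σ * gen n (k + 1)) (posIdx j) : ℤ)) k (by omega) fun j hj hj' => by
        rw [Equiv.Perm.mul_apply]
        congr 2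
        refine Subtype.ext ?_
        rw [coe_gen_of_pos (by omega) hin]
        simp only [posIdx]
        split_ifs <;> omega
    have g1 : gen n (k + 1) (posIdx ⟨k, by omega⟩) = posIdx ⟨k + 1, by omega⟩ := by
      refine Subtype.ext ?_
      rw [coe_gen_of_pos (by omega) hin]
      simp [posIdx]
    have g2 : gen n (k + 1) (posIdx ⟨k + 1, by omega⟩) = posIdx ⟨k, by omega⟩ := by
      refine Subtype.ext ?_
      rw [coe_gen_of_pos (by omega) hin]
      simp [posIdx]
    rw [if_neg (by omega), Nat.add_sub_cancel, hget k (by omega), hget (k + 1) (by omega)]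
    simp only [Equiv.Perm.mul_apply, g1, g2] at e2
    rw [oneLine, e1] at h1
    simp only [oneLine, Equiv.Perm.mul_apply] at h2
    rw [e2] at h2
    set x : ℤ := (σ (posIdx ⟨k, by omega⟩)).1
    set y : ℤ := (σ (posIdx ⟨k + 1, hin⟩)).1
    have h3 : 2 ^ (len σ + pairInv y x) = 2 ^ (len (σ * gen n (k + 1)) + pairInv x y) := by
      rw [pow_add, pow_add, h1, h2]
      exact pairProd_swap _ l₁ l₂ x y
    have h4 := Nat.pow_right_injective le_rfl h3
    have h5 : pairInv x y < pairInv y x ↔ x < y := by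
      simp only [pairInv]
      split_ifs <;> omega
    omega

end

/-! ### Membership in the lists of words -/

section Enumeration
variable {α β : Type*}

lemma nodup_flatMap_of_eq {l : List α} {f : α → List β} (hl : l.Nodup)
    (hf : ∀ x ∈ l, (f x).Nodup)
    (h : ∀ x ∈ l, ∀ y ∈ l, ∀ z, z ∈ f x → z ∈ f y → x = y) : (l.flatMap f).Nodup := by
  refine List.nodup_flatMap.2 ⟨hf, ?_⟩
  exact hl.imp_of_mem fun hx hy hxy z hz hz' => hxy (h _ hx _ hy z hz hz')

/-- A decreasing part of a decreasing list starts with the largest entry if it contains it. -/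
lemma exists_eq_cons_of_mem {x : ℤ} {S : List ℤ} (hS : S.Pairwise (· > ·)) (hx : x ∈ S)
    (hV : ∀ y ∈ S, y ≤ x) : ∃ S', S = x :: S' := by
  cases S with
  | nil => simp at hx
  | cons y S =>
    rcases List.mem_cons.1 hx with rfl | h
    · exact ⟨S, rfl⟩
    · have h1 := (List.pairwise_cons.1 hS).1 x h
      have h2 := hV y List.mem_cons_self
      omega

lemma mem_splits_iff {V : List ℤ} (hV : V.Pairwise (· > ·)) {k : ℕ} {p : List ℤ × List ℤ} :
    p ∈ splits V k ↔ p.1.length = k ∧ p.1.Pairwise (· > ·) ∧ p.2.Pairwise (· > ·) ∧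
      (p.1 ++ p.2).Perm V := by
  constructor
  · intro h
    obtain ⟨h1, h2, h3, h4⟩ := splits_spec h
    exact ⟨h1, hV.sublist h2, hV.sublist h3, h4⟩
  rintro ⟨rfl, h2, h3, h4⟩
  obtain ⟨S, C⟩ := p
  dsimp only at *
  induction V generalizing S C with
  | nil =>
    obtain ⟨rfl, rfl⟩ := List.append_eq_nil_iff.1 h4.eq_nil
    simp [splits]
  | cons x V ih =>
    obtain ⟨hx, hV⟩ := List.pairwise_cons.1 hV
    have hle : ∀ y ∈ S ++ C, y ≤ x := by
      intro y hy
      rcases List.mem_cons.1 (h4.subset hy) with rfl | h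
      · exact le_rfl
      · exact (hx y h).le
    rcases List.mem_append.1 (h4.symm.subset List.mem_cons_self) with h | h
    · obtain ⟨S, rfl⟩ := exists_eq_cons_of_mem h2 h fun y hy =>
        hle y (List.mem_append_left _ hy)
      have := ih hV S C (List.pairwise_cons.1 h2).2 h3 (List.perm_cons x |>.1 h4)
      simp only [splits, List.length_cons, List.mem_append, List.mem_map]
      exact Or.inl ⟨_, this, rfl⟩
    · obtain ⟨C, rfl⟩ := exists_eq_cons_of_mem h3 h fun y hy =>
        hle y (List.mem_append_right _ hy)
      have hp : (S ++ C).Perm V := List.perm_cons x |>.1 (List.perm_middle.symm.trans h4)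
      have := ih hV S C h2 (List.pairwise_cons.1 h3).2 hp
      cases S with
      | nil =>
        have := hp.eq_of_pairwise (fun a b _ _ h h' => absurd h (by omega))
          (List.pairwise_cons.1 h3).2 hV
        simp [splits, this]
      | cons y S =>
        simp only [splits, List.length_cons, List.mem_append, List.mem_map]
        exact Or.inr ⟨_, this, rfl⟩

lemma nodup_splits {V : List α} (hV : V.Nodup) (k : ℕ) : (splits V k).Nodup := by
  induction V generalizing k with
  | nil => cases k <;> simp [splits]
  | cons x V ih =>
    obtain ⟨hx, hV⟩ := List.nodup_cons.1 hV
    cases k with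
    | zero => simp [splits]
    | succ k =>
      refine List.nodup_append'.2 ⟨(ih hV k).map fun p q h => ?_,
        (ih hV (k + 1)).map fun p q h => ?_, ?_⟩
      · simp only [Prod.mk.injEq, List.cons.injEq, true_and] at h
        exact Prod.ext h.1 h.2
      · simp only [Prod.mk.injEq, List.cons.injEq, true_and] at h
        exact Prod.ext h.1 h.2
      · intro p h1 h2
        obtain ⟨q, -, rfl⟩ := List.mem_map.1 h1
        obtain ⟨r, hr, he⟩ := List.mem_map.1 h2
        have h3 := (splits_spec hr).2.1.subset
        rw [(Prod.mk.inj he).1] at h3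
        exact hx (h3 List.mem_cons_self)

lemma IsAbsList.nodup {U : List ℤ} (h : IsAbsList U) : U.Nodup := h.1.imp fun h => h.ne'

lemma mem_signings_iff {U s : List ℤ} (hU : IsAbsList U) :
    s ∈ signings U ↔ s.Pairwise (· < ·) ∧ (s.map fun v => |v|).Perm U := by
  refine ⟨signings_spec hU, ?_⟩
  rintro ⟨h1, h2⟩
  induction U generalizing s with
  | nil => simpa [signings] using h2.eq_nil
  | cons m U ih =>
    have hm : ∀ x ∈ U, x < m := (List.pairwise_cons.1 hU.1).1
    have hle : ∀ v ∈ s, |v| ≤ m := by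
      intro v hv
      rcases List.mem_cons.1 (h2.subset (List.mem_map_of_mem hv)) with h | h
      · exact h.le
      · exact (hm _ h).le
    have hm0 : 0 < m := hU.2 m List.mem_cons_self
    obtain ⟨v, hv, hvm⟩ := List.mem_map.1 (h2.symm.subset List.mem_cons_self)
    simp only [signings, List.mem_append, List.mem_map]
    rcases eq_or_eq_neg_of_abs_eq hvm with rfl | rfl
    · left
      rcases List.eq_nil_or_concat s with rfl | ⟨s, w, rfl⟩
      · simp at hv
      rw [List.concat_eq_append] at *
      obtain ⟨h3, -, h4⟩ := List.pairwise_append.1 h1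
      have hw : w = v := by
        rcases List.mem_append.1 hv with h | h
        · have := h4 v h w (by simp)
          have := (abs_le.1 (hle w (by simp))).2
          omega
        · exact (List.mem_singleton.1 h).symm
      subst hw
      refine ⟨s, ih hU.of_cons h3 ?_, rfl⟩
      rw [List.map_append, List.map_singleton, abs_of_pos hm0] at h2
      exact (List.perm_cons w).1 ((List.perm_append_singleton _ _).symm.trans h2)
    · right
      cases s with
      | nil => simp at hv
      | cons w s =>
        obtain ⟨h3, h4⟩ := List.pairwise_cons.1 h1
        have hw : w = -m := by
          rcases List.mem_cons.1 hv with h | h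
          · exact h.symm
          · have := h3 _ h
            have := (abs_le.1 (hle w (by simp))).1
            omega
        subst hw
        refine ⟨s, ih hU.of_cons h4 ?_, rfl⟩
        rw [List.map_cons, abs_neg, abs_of_pos hm0] at h2
        exact (List.perm_cons m).1 h2

lemma nodup_signings {U : List ℤ} (hU : IsAbsList U) : (signings U).Nodup := by
  induction U with
  | nil => simp [signings]
  | cons m U ih =>
    have hm0 : 0 < m := hU.2 m List.mem_cons_self
    have hm : ∀ x ∈ U, x < m := (List.pairwise_cons.1 hU.1).1
    refine List.nodup_append'.2 ⟨(ih hU.of_cons).map (List.append_left_injective _),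
        (ih hU.of_cons).map (List.cons_injective), ?_⟩
    intro s h1 h2
    obtain ⟨t, ht, rfl⟩ := List.mem_map.1 h1
    obtain ⟨u, hu, he⟩ := List.mem_map.1 h2
    have h3 : m ∈ -m :: u := by rw [he]; simp
    rcases List.mem_cons.1 h3 with h | h
    · omega
    · have := (signings_spec hU.of_cons hu).2.subset (List.mem_map_of_mem h)
      have := hm _ this
      rw [abs_of_pos hm0] at this
      omega

/-- The word `w` consists of increasing blocks of the sizes `ds`. -/
def Blocks : List ℕ → List ℤ → Prop
  | [], w => w = []
  | d :: ds, w => d ≤ w.length ∧ (w.take d).Pairwise (· < ·) ∧ Blocks ds (w.drop d)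

lemma words_cons (V : List ℤ) (d : ℕ) (ds : List ℕ) :
    words V (d :: ds) = (splits V d).flatMap fun p => (signings p.1).flatMap fun s =>
      (words p.2 ds).map fun w => s ++ w := by
  cases V <;> rfl

/-- A list has at most one splitting for given contents of the two parts. -/
lemma splits_eq_of_perm {V : List ℤ} (hV : V.Pairwise (· > ·)) {k : ℕ} {p q : List ℤ × List ℤ}
    (hp : p ∈ splits V k) (hq : q ∈ splits V k) (h1 : p.1.Perm q.1) (h2 : p.2.Perm q.2) :
    p = q := by
  obtain ⟨-, hp1, hp2, -⟩ := (mem_splits_iff hV).1 hp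
  obtain ⟨-, hq1, hq2, -⟩ := (mem_splits_iff hV).1 hq
  exact Prod.ext (h1.eq_of_pairwise (fun a b _ _ h h' => absurd h (by omega)) hp1 hq1)
    (h2.eq_of_pairwise (fun a b _ _ h h' => absurd h (by omega)) hp2 hq2)

lemma exists_perm_pairwise_gt {l : List ℤ} (hl : l.Nodup) :
    ∃ U, l.Perm U ∧ U.Pairwise (· > ·) := by
  have hp := List.perm_insertionSort (· ≥ ·) l
  exact ⟨_, hp.symm, ((List.pairwise_insertionSort (· ≥ ·) l).and (hp.nodup_iff.2 hl)).imp
    fun h => lt_of_le_of_ne h.1 h.2.symm⟩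

/-- Every part of the absolute values of a word comes from a splitting. -/
lemma exists_mem_splits {V w : List ℤ} (hV : IsAbsList V) (hw : (w.map fun v => |v|).Perm V)
    {d : ℕ} (hd : d ≤ w.length) : ∃ p ∈ splits V d,
      ((w.take d).map fun v => |v|).Perm p.1 ∧ ((w.drop d).map fun v => |v|).Perm p.2 := by
  have hp : ((w.take d).map fun v => |v|) ++ ((w.drop d).map fun v => |v|) |>.Perm V := by
    rwa [← List.map_append, List.take_append_drop]
  have hnd := List.nodup_append'.1 (hp.nodup_iff.2 hV.nodup)
  obtain ⟨S, hS, hS'⟩ := exists_perm_pairwise_gt hnd.1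
  obtain ⟨C, hC, hC'⟩ := exists_perm_pairwise_gt hnd.2.1
  exact ⟨(S, C), (mem_splits_iff hV.1).2 ⟨by rw [← hS.length_eq]; simpa using hd, hS', hC',
    (hS.symm.append hC.symm).trans hp⟩, hS, hC⟩

lemma IsAbsList.of_mem_splits {V : List ℤ} (hV : IsAbsList V) {k : ℕ} {p : List ℤ × List ℤ}
    (hp : p ∈ splits V k) : IsAbsList p.1 ∧ IsAbsList p.2 :=
  ⟨hV.sublist (splits_spec hp).2.1, hV.sublist (splits_spec hp).2.2.1⟩

lemma mem_words_iff {V : List ℤ} (hV : IsAbsList V) {ds : List ℕ} {w : List ℤ} :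
    w ∈ words V ds ↔ (w.map fun v => |v|).Perm V ∧ Blocks ds w := by
  induction ds generalizing V w with
  | nil =>
    cases V with
    | nil => 
      simp only [words, Blocks, List.mem_singleton]
      exact ⟨fun h => ⟨by simp [h], h⟩, fun h => h.2⟩
    | cons x V =>
      simp only [words, Blocks, List.not_mem_nil, false_iff]
      rintro ⟨h, rfl⟩
      exact absurd h.symm.eq_nil (by simp)
  | cons d ds ih =>
    rw [words_cons]
    simp only [List.mem_flatMap, List.mem_map, Blocks]
    constructor
    · rintro ⟨p, hp, s, hs, w, hw, rfl⟩
      obtain ⟨h1, h2⟩ := hV.of_mem_splits hp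
      obtain ⟨h3, -, -, h4⟩ := splits_spec hp
      rw [mem_signings_iff h1] at hs
      rw [ih h2] at hw
      have h5 : s.length = d := by rw [← h3, ← hs.2.length_eq, List.length_map]
      refine ⟨?_, by simp [h5], by simpa [← h5] using hs.1, by simpa [← h5] using hw.2⟩
      rw [List.map_append]
      exact (hs.2.append hw.1).trans h4
    · rintro ⟨h1, h2, h3, h4⟩
      obtain ⟨p, hp, h5, h6⟩ := exists_mem_splits hV h1 h2
      obtain ⟨h7, h8⟩ := hV.of_mem_splits hp
      exact ⟨p, hp, w.take d, (mem_signings_iff h7).2 ⟨h3, h5⟩, w.drop d,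
        (ih h8).2 ⟨h6, h4⟩, List.take_append_drop d w⟩

lemma nodup_words {V : List ℤ} (hV : IsAbsList V) (ds : List ℕ) : (words V ds).Nodup := by
  induction ds generalizing V with
  | nil => cases V <;> simp [words]
  | cons d ds ih =>
    rw [words_cons]
    refine nodup_flatMap_of_eq (nodup_splits hV.nodup d) (fun p hp => ?_)
      fun p hp q hq w hw hw' => ?_
    · obtain ⟨h1, h2⟩ := hV.of_mem_splits hp
      refine nodup_flatMap_of_eq (nodup_signings h1)
        (fun s _ => (ih h2).map (List.append_right_injective s)) fun s hs t ht w hw hw' => ?_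
      obtain ⟨u, -, rfl⟩ := List.mem_map.1 hw
      obtain ⟨v, -, he⟩ := List.mem_map.1 hw'
      refine (List.append_inj_left he ?_).symm
      rw [← List.length_map (f := fun v : ℤ => |v|) (as := t), (signings_spec h1 ht).2.length_eq,
        ← (signings_spec h1 hs).2.length_eq, List.length_map]
    · simp only [List.mem_flatMap, List.mem_map] at hw hw'
      obtain ⟨s, hs, u, hu, rfl⟩ := hw
      obtain ⟨t, ht, v, hv, he⟩ := hw'
      obtain ⟨h1, h2⟩ := hV.of_mem_splits hp
      obtain ⟨h3, h4⟩ := hV.of_mem_splits hq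
      have hs' := (signings_spec h1 hs).2
      have ht' := (signings_spec h3 ht).2
      obtain ⟨rfl, rfl⟩ := List.append_inj he (by
        rw [← List.length_map (f := fun v : ℤ => |v|) (as := t), ht'.length_eq,
          (splits_spec hq).1, ← (splits_spec hp).1, ← hs'.length_eq, List.length_map])
      exact splits_eq_of_perm hV.1 hp hq (hs'.symm.trans ht')
        (((mem_words_iff h2).1 hu).1.symm.trans ((mem_words_iff h4).1 hv).1)

/-- The words that consist of an increasing block of `c` positive letters and of further increasing
blocks of the given sizes, and whose absolute values are the entries of `V`. -/
def flagWords (V : List ℤ) (c : ℕ) (ds : List ℕ) : List (List ℤ) :=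
  (splits V c).flatMap fun p => (words p.2 ds).map fun w => p.1.reverse ++ w

lemma sum_flagWords (V : List ℤ) (c : ℕ) (ds : List ℕ) :
    ((flagWords V c ds).map fun w => wt (place false w)).sum =
      flagSum false (par false c) c V ds := by
  rw [flagWords, sum_map_flatMap, flagSum, sumSplits]
  congr 1
  refine List.map_congr_left fun p hp => ?_
  simp only [sumWords, List.map_map, Function.comp_def, place_append, List.length_reverse,
    (splits_spec hp).1]

lemma mem_flagWords_iff {V : List ℤ} (hV : IsAbsList V) {c : ℕ} {ds : List ℕ} {w : List ℤ} :
    w ∈ flagWords V c ds ↔ (w.map fun v => |v|).Perm V ∧ c ≤ w.length ∧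
      (w.take c).Pairwise (· < ·) ∧ (∀ x ∈ w.take c, 0 < x) ∧ Blocks ds (w.drop c) := by
  simp only [flagWords, List.mem_flatMap, List.mem_map]
  constructor
  · rintro ⟨p, hp, w, hw, rfl⟩
    obtain ⟨h1, h2⟩ := hV.of_mem_splits hp
    obtain ⟨h3, -, -, h4⟩ := splits_spec hp
    rw [mem_words_iff h2] at hw
    have h5 : p.1.reverse.length = c := by rw [List.length_reverse, h3]
    have h6 : (p.1.map fun v => |v|) = p.1 :=
      (List.map_congr_left fun x hx => abs_of_pos (h1.2 x hx)).trans (List.map_id _)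
    refine ⟨?_, by simp [h3], ?_, ?_, ?_⟩
    · rw [List.map_append, List.map_reverse, h6]
      exact ((List.reverse_perm _).append hw.1).trans h4
    · rw [List.take_left' h5, List.pairwise_reverse]
      exact h1.1
    · rw [List.take_left' h5]
      exact fun x hx => h1.2 x (List.mem_reverse.1 hx)
    · rw [List.drop_left' h5]
      exact hw.2
  · rintro ⟨h1, h2, h3, h4, h5⟩
    obtain ⟨p, hp, h6, h7⟩ := exists_mem_splits hV h1 h2
    obtain ⟨h8, h9⟩ := hV.of_mem_splits hp
    refine ⟨p, hp, w.drop c, (mem_words_iff h9).2 ⟨h7, h5⟩, ?_⟩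
    have h10 : ((w.take c).map fun v => |v|) = w.take c :=
      (List.map_congr_left fun x hx => abs_of_pos (h4 x hx)).trans (List.map_id _)
    rw [h10] at h6
    have : w.take c = p.1.reverse := 
      (h6.trans (List.reverse_perm _).symm).eq_of_pairwise (fun a b _ _ h h' => absurd h (by omega))
        h3 (List.pairwise_reverse.2 h8.1)
    rw [← this, List.take_append_drop]

lemma nodup_flagWords {V : List ℤ} (hV : IsAbsList V) (c : ℕ) (ds : List ℕ) :
    (flagWords V c ds).Nodup := by
  refine nodup_flatMap_of_eq (nodup_splits hV.nodup c) (fun p hp => ?_) fun p hp q hq w hw hw' => ?_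
  · exact (nodup_words (hV.of_mem_splits hp).2 ds).map (List.append_right_injective _)
  · obtain ⟨u, hu, rfl⟩ := List.mem_map.1 hw
    obtain ⟨v, hv, he⟩ := List.mem_map.1 hw'
    obtain ⟨h1, rfl⟩ := List.append_inj he (by
      rw [List.length_reverse, List.length_reverse, (splits_spec hq).1, (splits_spec hp).1])
    exact splits_eq_of_perm hV.1 hp hq (by rw [List.reverse_injective h1])
      (((mem_words_iff (hV.of_mem_splits hp).2).1 hu).1.symm.trans
        ((mem_words_iff (hV.of_mem_splits hq).2).1 hv).1)

end Enumeration

/-! ### Signed permutations and words -/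

/-- The decreasing list `n, n - 1, …, 1`. -/
def absVals (n : ℕ) : List ℤ := ((List.range n).map fun k : ℕ => (k : ℤ) + 1).reverse

lemma length_absVals (n : ℕ) : (absVals n).length = n := by simp [absVals]

lemma mem_absVals {n : ℕ} {x : ℤ} : x ∈ absVals n ↔ 0 < x ∧ x ≤ n := by
  simp only [absVals, List.mem_reverse, List.mem_map, List.mem_range]
  constructor
  · rintro ⟨k, hk, rfl⟩; omega
  · rintro ⟨h1, h2⟩
    exact ⟨(x - 1).toNat, by omega, by omega⟩

lemma isAbsList_absVals (n : ℕ) : IsAbsList (absVals n) := by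
  refine ⟨?_, fun x hx => (mem_absVals.1 hx).1⟩
  rw [absVals, List.pairwise_reverse, List.pairwise_map]
  exact List.pairwise_lt_range.imp fun h => by omega

section
variable {n : ℕ}

lemma length_oneLine (σ : Equiv.Perm (SignedIdx n)) : (oneLine σ).length = n := by simp [oneLine]

lemma getElem_oneLine (σ : Equiv.Perm (SignedIdx n)) (k : ℕ) (h : k < (oneLine σ).length) :
    (oneLine σ)[k] = σ (posIdx ⟨k, by simpa [oneLine] using h⟩) := by simp [oneLine]

/-- An index is determined by its absolute value and its sign. -/
lemma eq_posIdx_or_eq_negIdx (a : SignedIdx n) :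
    ∃ j : Fin n, a = posIdx j ∨ a = negIdx (posIdx j) := by
  have h0 := a.ne_zero
  have h1 := abs_le.1 a.abs_le
  rcases lt_or_gt_of_ne h0 with h | h
  · refine ⟨⟨(-a.1 - 1).toNat, by omega⟩, Or.inr (Subtype.ext ?_)⟩
    simp only [posIdx, negIdx]; omega
  · refine ⟨⟨(a.1 - 1).toNat, by omega⟩, Or.inl (Subtype.ext ?_)⟩
    simp only [posIdx]; omega

lemma oneLine_injOn : Set.InjOn (oneLine (n := n)) {σ | IsSigned σ} := by
  intro σ hσ τ hτ h
  have h1 : ∀ j : Fin n, (σ (posIdx j) : ℤ) = τ (posIdx j) := congrFun (List.ofFn_injective h)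
  refine Equiv.ext fun a => Subtype.ext ?_
  obtain ⟨j, rfl | rfl⟩ := eq_posIdx_or_eq_negIdx a
  · exact h1 j
  · rw [IsSigned.map_negIdx hσ, IsSigned.map_negIdx hτ, h1]

lemma IsSigned.perm_absVals {σ : Equiv.Perm (SignedIdx n)} (hσ : IsSigned σ) :
    ((oneLine σ).map fun v => |v|).Perm (absVals n) := by
  rw [oneLine, List.map_ofFn]
  refine List.Subperm.perm_of_length_le (List.subperm_of_subset ?_ ?_) ?_
  · rw [List.nodup_ofFn]
    intro i j h
    by_contra hij
    exact hσ.abs_ne hij h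
  · intro x hx
    obtain ⟨j, rfl⟩ := List.mem_ofFn.1 hx
    exact mem_absVals.2 ⟨abs_pos.2 (SignedIdx.ne_zero _), SignedIdx.abs_le _⟩
  · simp [length_absVals]

lemma exists_isSigned_oneLine {w : List ℤ} (hw : (w.map fun v => |v|).Perm (absVals n)) :
    ∃ σ : Equiv.Perm (SignedIdx n), IsSigned σ ∧ oneLine σ = w := by
  have hl : w.length = n := by simpa [length_absVals] using hw.length_eq
  have hmem : ∀ k (hk : k < w.length), w[k] ≠ 0 ∧ |w[k]| ≤ n := by
    intro k hk
    have := mem_absVals.1 (hw.subset (List.mem_map_of_mem (List.getElem_mem hk)))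
    exact ⟨abs_pos.1 this.1, this.2⟩
  have hnd : ∀ i j (hi : i < w.length) (hj : j < w.length), |w[i]| = |w[j]| → i = j := by
    intro i j hi hj h
    have := hw.nodup_iff.2 (isAbsList_absVals n).nodup
    exact (this.getElem_inj_iff (hi := by simpa using hi) (hj := by simpa using hj)).1
      (by simpa using h)
  have hidx : ∀ a : SignedIdx n, (|(a : ℤ)| - 1).toNat < w.length := by
    intro a
    have h1 := abs_pos.2 a.ne_zero
    have h2 := a.abs_le
    omega
  let f : SignedIdx n → SignedIdx n := fun a =>
    ⟨if 0 < (a : ℤ) then w[(|(a : ℤ)| - 1).toNat]'(hidx a)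
      else -w[(|(a : ℤ)| - 1).toNat]'(hidx a), by
      obtain ⟨h1, h2⟩ := hmem _ (hidx a)
      rw [abs_le] at h2
      simp only [Finset.mem_erase, Finset.mem_Icc]
      split_ifs <;> omega⟩
  have hfval : ∀ a : SignedIdx n, (f a : ℤ) = if 0 < (a : ℤ) then
    w[(|(a : ℤ)| - 1).toNat]'(hidx a) else -w[(|(a : ℤ)| - 1).toNat]'(hidx a) := fun a => rfl
  have hf : Function.Injective f := by
    intro a b hab
    have hab' : (f a : ℤ) = f b := congrArg _ hab
    rw [hfval, hfval] at hab'
    have h1 : (|(a : ℤ)| - 1).toNat = (|(b : ℤ)| - 1).toNat := by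
      refine hnd _ _ (hidx a) (hidx b) ?_
      split_ifs at hab' with h1 h2 h2
      · rw [hab']
      · rw [hab', abs_neg]
      · rw [← hab', abs_neg]
      · rw [neg_inj.1 hab']
    simp only [h1] at hab'
    have h2 := (hmem _ (hidx b)).1
    have h3 := abs_pos.2 a.ne_zero
    have h4 := abs_pos.2 b.ne_zero
    have h5 := a.ne_zero
    have h6 := b.ne_zero
    refine Subtype.ext ?_
    rcases abs_eq_abs.1 (show |(a : ℤ)| = |(b : ℤ)| by omega) with h | h
    · exact h
    · split_ifs at hab' <;> omega
  refine ⟨Equiv.ofBijective f (Finite.injective_iff_bijective.1 hf), ?_, ?_⟩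
  · intro a b hab
    rw [Equiv.ofBijective_apply, Equiv.ofBijective_apply, hfval, hfval]
    have h5 := a.ne_zero
    simp only [hab, abs_neg]
    split_ifs <;> omega
  · refine List.ext_getElem (by rw [length_oneLine, hl]) fun k h1 h2 => ?_
    rw [getElem_oneLine, Equiv.ofBijective_apply, hfval, if_pos (by simp only [posIdx]; omega)]
    congr 1
    simp only [posIdx]
    rw [abs_of_nonneg (by omega)]
    omega

open scoped Classical in
/-- The sum of `(-1)^ℓ x^L` over all signed permutations that satisfy `P`. -/
noncomputable def signedSum (n : ℕ) (P : Equiv.Perm (SignedIdx n) → Prop) : ℤ[X] :=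
  ∑ σ with IsSigned σ ∧ P σ, (-1) ^ len σ * X ^ oddLen σ

lemma signedSum_congr {P Q : Equiv.Perm (SignedIdx n) → Prop}
    (h : ∀ σ, IsSigned σ → (P σ ↔ Q σ)) : signedSum n P = signedSum n Q := by
  classical
  unfold signedSum
  refine Finset.sum_congr (Finset.filter_congr fun σ _ => ?_) fun _ _ => rfl
  exact and_congr_right (h σ)

lemma signedSum_and_add (P Q : Equiv.Perm (SignedIdx n) → Prop) :
    signedSum n (fun σ => P σ ∧ Q σ) + signedSum n (fun σ => P σ ∧ ¬ Q σ) = signedSum n P := by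
  classical
  unfold signedSum
  rw [← Finset.sum_filter_add_sum_filter_not (Finset.univ.filter fun σ => IsSigned σ ∧ P σ) Q]
  simp only [Finset.filter_filter, and_assoc]

/-- Sums over signed permutations may be computed by enumerating the words in one-line notation. -/
lemma signedSum_eq_sum (hn : 2 ≤ n) (l : List (List ℤ)) (hl : l.Nodup)
    (P : Equiv.Perm (SignedIdx n) → Prop)
    (h1 : ∀ w ∈ l, (w.map fun v => |v|).Perm (absVals n))
    (h2 : ∀ σ, IsSigned σ → (P σ ↔ oneLine σ ∈ l)) :
    signedSum n P = (l.map fun w => wt (place false w)).sum := by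
  classical
  rw [← List.sum_toFinset _ hl, signedSum]
  refine Finset.sum_bij (fun σ _ => oneLine σ) ?_ ?_ ?_ ?_
  · intro σ hσ
    rw [Finset.mem_filter] at hσ
    exact List.mem_toFinset.2 ((h2 σ hσ.2.1).1 hσ.2.2)
  · intro σ hσ τ hτ h
    rw [Finset.mem_filter] at hσ hτ
    exact oneLine_injOn hσ.2.1 hτ.2.1 h
  · intro w hw
    rw [List.mem_toFinset] at hw
    obtain ⟨σ, hσ, rfl⟩ := exists_isSigned_oneLine (h1 w hw)
    exact ⟨σ, Finset.mem_filter.2 ⟨Finset.mem_univ _, hσ, (h2 σ hσ).2 hw⟩, rfl⟩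
  · intro σ hσ
    rw [Finset.mem_filter] at hσ
    exact neg_one_pow_len_mul hn hσ.2.1

/-- The signed permutation that exchanges `1` and `-1`. -/
noncomputable def flip (n : ℕ) : Equiv.Perm (SignedIdx n) := transp n 1 (-1)

lemma coe_flip (hn : 2 ≤ n) (p : SignedIdx n) :
    (flip n p : ℤ) = if (p : ℤ) = 1 ∨ (p : ℤ) = -1 then -(p : ℤ) else (p : ℤ) := by
  have h1 : |(1 : ℤ)| ≤ n := by simp; omega
  rw [flip, coe_transp _ _ (by norm_num) h1 (by norm_num) (by rwa [abs_neg])]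
  split_ifs <;> omega

lemma isSigned_flip (hn : 2 ≤ n) : IsSigned (flip n) := by
  intro a b hab
  rw [coe_flip hn, coe_flip hn, hab]
  split_ifs <;> omega

lemma flip_mul_flip (hn : 2 ≤ n) : flip n * flip n = 1 := by
  refine Equiv.ext fun p => Subtype.ext ?_
  rw [Equiv.Perm.mul_apply, coe_flip hn, coe_flip hn, Equiv.Perm.one_apply]
  split_ifs <;> omega

/-- Exchanging the values `±1` does not change the inversions. -/
lemma pairInv_flip (hn : 2 ≤ n) {a b : SignedIdx n} (h : |(a : ℤ)| ≠ |(b : ℤ)|) :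
    pairInv (flip n a) (flip n b) = pairInv a b := by
  have h1 := a.ne_zero
  have h2 := b.ne_zero
  rw [coe_flip hn, coe_flip hn]
  have : (a : ℤ) ≠ b ∧ (a : ℤ) ≠ -b := ⟨fun h' => h (by rw [h']), fun h' => h (by rw [h', abs_neg])⟩
  obtain ⟨h3, h4⟩ := this
  generalize (a : ℤ) = x at *
  generalize (b : ℤ) = y at *
  unfold pairInv
  split_ifs <;> omega

lemma len_flip_mul (hn : 2 ≤ n) {σ : Equiv.Perm (SignedIdx n)} (hσ : IsSigned σ) :
    len (flip n * σ) = len σ := by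
  rw [len_eq_sum hn hσ, len_eq_sum hn ((isSigned_flip hn).mul hσ)]
  refine Finset.sum_congr rfl fun i _ => Finset.sum_congr rfl fun j _ => ?_
  split_ifs with h
  · exact pairInv_flip hn (hσ.abs_ne h.ne)
  · rfl

lemma oddLen_flip_mul (hn : 2 ≤ n) {σ : Equiv.Perm (SignedIdx n)} (hσ : IsSigned σ) :
    oddLen (flip n * σ) = oddLen σ := by
  rw [oddLen_eq_sum hn hσ, oddLen_eq_sum hn ((isSigned_flip hn).mul hσ)]
  refine Finset.sum_congr rfl fun i _ => Finset.sum_congr rfl fun j _ => ?_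
  split_ifs with h
  · exact pairInv_flip hn (hσ.abs_ne h.1.ne)
  · rfl

lemma neg_one_pow_negCount (σ : Equiv.Perm (SignedIdx n)) :
    (-1 : ℤ) ^ negCount σ = ∏ j : Fin n, if (σ (posIdx j) : ℤ) < 0 then (-1 : ℤ) else 1 := by
  rw [negCount, Finset.prod_ite, Finset.prod_const, Finset.prod_const_one, mul_one]

lemma even_negCount_flip_mul (hn : 2 ≤ n) {σ : Equiv.Perm (SignedIdx n)} (hσ : IsSigned σ) :
    Even (negCount (flip n * σ)) ↔ ¬ Even (negCount σ) := by
  have key : (-1 : ℤ) ^ negCount (flip n * σ) = -(-1) ^ negCount σ := by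
    obtain ⟨j, hj⟩ := eq_posIdx_or_eq_negIdx (σ.symm (posIdx ⟨0, by omega⟩))
    have hj' : (σ (posIdx j) : ℤ) = 1 ∨ (σ (posIdx j) : ℤ) = -1 := by
      rcases hj with hj | hj
      · left
        rw [← hj, Equiv.apply_symm_apply]
        simp [posIdx]
      · right
        have := hσ.map_negIdx (posIdx j)
        rw [← hj, Equiv.apply_symm_apply] at this
        simp only [posIdx] at this ⊢
        omega
    rw [neg_one_pow_negCount, neg_one_pow_negCount, ← Finset.mul_prod_erase _ _ (Finset.mem_univ j),
      ← Finset.mul_prod_erase Finset.univ (fun j => if (σ (posIdx j) : ℤ) < 0 then (-1 : ℤ) else 1)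
      (Finset.mem_univ j), ← neg_mul]
    congr 1
    · rw [Equiv.Perm.mul_apply, coe_flip hn]
      rcases hj' with h | h <;> simp [h]
    · refine Finset.prod_congr rfl fun i hi => ?_
      have := hσ.abs_ne (Finset.ne_of_mem_erase hi)
      have h : (flip n (σ (posIdx i)) : ℤ) = σ (posIdx i) := by
        rw [coe_flip hn, if_neg]
        rintro (h | h) <;> rcases hj' with h' | h' <;> simp [h, h'] at this
      rw [Equiv.Perm.mul_apply, h]
  rw [← neg_one_pow_eq_one_iff_even (R := ℤ) (by norm_num), key]
  rcases neg_one_pow_eq_or ℤ (negCount σ) with h | h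
  · simp [h, ← neg_one_pow_eq_one_iff_even (R := ℤ) (by norm_num)]
  · simp [h, ← neg_one_pow_eq_one_iff_even (R := ℤ) (by norm_num)]

/-- The condition that `σ` has no descent in `I`, in one-line notation. -/
def Ascents (I : Finset ℕ) (σ : Equiv.Perm (SignedIdx n)) : Prop :=
  ∀ i ∈ I, IsAscent (oneLine σ) i

lemma ascents_iff (hn : 2 ≤ n) {I : Finset ℕ} (hI : I ⊆ Finset.range n)
    {σ : Equiv.Perm (SignedIdx n)} (hσ : IsSigned σ) :
    Ascents I σ ↔ ∀ i ∈ I, len σ < len (σ * gen n i) :=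
  forall₂_congr fun _ hi => (len_lt_len_mul_gen_iff hn hσ (Finset.mem_range.1 (hI hi))).symm

lemma genFun_eq_signedSum (hn : 2 ≤ n) {I : Finset ℕ} (hI : I ⊆ Finset.range n) :
    genFun n I = signedSum n (fun σ => Ascents I σ ∧ Even (negCount σ)) := by
  classical
  unfold genFun signedSum
  refine Finset.sum_congr (Finset.ext fun σ => ?_) fun _ _ => rfl
  simp only [Finset.mem_filter, Finset.mem_univ, true_and]
  unfold InQuotient IsEvenSigned
  constructor
  · rintro ⟨⟨h1, h2⟩, h3⟩
    exact ⟨h1, (ascents_iff hn hI h1).2 h3, h2⟩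
  · rintro ⟨h1, h3, h2⟩
    exact ⟨⟨h1, h2⟩, (ascents_iff hn hI h1).1 h3⟩

/-- Exchanging the values `±1` identifies the even signed permutations with the others. -/
lemma two_mul_genFun (hn : 2 ≤ n) {I : Finset ℕ} (hI : I ⊆ Finset.range n) :
    2 * genFun n I = signedSum n (Ascents I) := by
  classical
  rw [← signedSum_and_add (Ascents I) fun σ => Even (negCount σ), two_mul,
    genFun_eq_signedSum hn hI]
  congr 1
  have hmem : ∀ σ : Equiv.Perm (SignedIdx n), IsSigned σ →
      (Ascents I (flip n * σ) ↔ Ascents I σ) := by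
    intro σ hσ
    rw [ascents_iff hn hI hσ, ascents_iff hn hI ((isSigned_flip hn).mul hσ)]
    refine forall₂_congr fun i hi => ?_
    rw [mul_assoc, len_flip_mul hn hσ,
      len_flip_mul hn (hσ.mul (isSigned_gen hn (Finset.mem_range.1 (hI hi))))]
  refine Finset.sum_bij' (fun σ _ => flip n * σ) (fun σ _ => flip n * σ) ?_ ?_ ?_ ?_ ?_
  · intro σ hσ
    simp only [Finset.mem_filter, Finset.mem_univ, true_and] at hσ ⊢
    refine ⟨(isSigned_flip hn).mul hσ.1, (hmem σ hσ.1).2 hσ.2.1, ?_⟩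
    rw [even_negCount_flip_mul hn hσ.1, not_not]
    exact hσ.2.2
  · intro σ hσ
    simp only [Finset.mem_filter, Finset.mem_univ, true_and] at hσ ⊢
    exact ⟨(isSigned_flip hn).mul hσ.1, (hmem σ hσ.1).2 hσ.2.1,
      (even_negCount_flip_mul hn hσ.1).2 hσ.2.2⟩
  · intro σ _
    rw [← mul_assoc, flip_mul_flip hn, one_mul]
  · intro σ _
    rw [← mul_assoc, flip_mul_flip hn, one_mul]
  · intro σ hσ
    simp only [Finset.mem_filter, Finset.mem_univ, true_and] at hσ
    rw [len_flip_mul hn hσ.1, oddLen_flip_mul hn hσ.1]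

lemma exists_oneLine_mul_flip (hn : 2 ≤ n) {σ : Equiv.Perm (SignedIdx n)} (hσ : IsSigned σ) :
    ∃ x l, x ≠ 0 ∧ oneLine σ = x :: l ∧ oneLine (σ * flip n) = -x :: l := by
  obtain ⟨k, rfl⟩ : ∃ k, n = k + 1 := ⟨n - 1, by omega⟩
  refine ⟨σ (posIdx 0), _, SignedIdx.ne_zero _, List.ofFn_succ, ?_⟩
  rw [oneLine, List.ofFn_succ]
  congr 1
  · rw [Equiv.Perm.mul_apply, ← hσ.map_negIdx]
    congr 2
    refine Subtype.ext ?_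
    rw [coe_flip hn]
    simp [posIdx, negIdx]
  · congr 1
    funext j
    rw [Equiv.Perm.mul_apply]
    congr 2
    refine Subtype.ext ?_
    rw [coe_flip hn, if_neg]
    simp only [posIdx, Fin.val_succ]
    push_cast
    omega

/-- Changing the sign of the first entry preserves `(-1)^ℓ x^L`. -/
lemma signedSum_mul_flip (hn : 2 ≤ n) (P : Equiv.Perm (SignedIdx n) → Prop) :
    signedSum n (fun σ => P (σ * flip n)) = signedSum n P := by
  classical
  refine Finset.sum_bij' (fun σ _ => σ * flip n) (fun σ _ => σ * flip n) ?_ ?_ ?_ ?_ ?_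
  · intro σ hσ
    simp only [Finset.mem_filter, Finset.mem_univ, true_and] at hσ ⊢
    exact ⟨hσ.1.mul (isSigned_flip hn), hσ.2⟩
  · intro σ hσ
    simp only [Finset.mem_filter, Finset.mem_univ, true_and] at hσ ⊢
    refine ⟨hσ.1.mul (isSigned_flip hn), ?_⟩
    rw [mul_assoc, flip_mul_flip hn, mul_one]
    exact hσ.2
  · intro σ _
    rw [mul_assoc, flip_mul_flip hn, mul_one]
  · intro σ _
    rw [mul_assoc, flip_mul_flip hn, mul_one]
  · intro σ hσ
    simp only [Finset.mem_filter, Finset.mem_univ, true_and] at hσ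
    rw [neg_one_pow_len_mul hn hσ.1, neg_one_pow_len_mul hn (hσ.1.mul (isSigned_flip hn))]
    obtain ⟨x, l, -, h1, h2⟩ := exists_oneLine_mul_flip hn hσ.1
    rw [h1, h2]
    simp only [place, wt, pairInv_neg_left]

/-- Changing the sign of the first entry exchanges the conditions for `0` and `1`. -/
lemma isAscent_neg_cons_iff (x : ℤ) (l : List ℤ) (i : ℕ) :
    IsAscent (-x :: l) i ↔ IsAscent (x :: l) (Equiv.swap 0 1 i) := by
  unfold IsAscent
  rcases i with _ | _ | i
  · simp
  · simp
    omega
  · rw [Equiv.swap_apply_of_ne_of_ne (by omega) (by omega)]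
    simp

lemma ascents_mul_flip_iff (hn : 2 ≤ n) (I : Finset ℕ) {σ : Equiv.Perm (SignedIdx n)}
    (hσ : IsSigned σ) :
    Ascents I (σ * flip n) ↔ ∀ i ∈ I, IsAscent (oneLine σ) (Equiv.swap 0 1 i) := by
  obtain ⟨x, l, -, h1, h2⟩ := exists_oneLine_mul_flip hn hσ
  unfold Ascents
  simp only [h1, h2, isAscent_neg_cons_iff]

/-- If `0 ∈ I` and `1 ∉ I`, then `0` may be replaced by `1`. -/
lemma signedSum_ascents_swap (hn : 2 ≤ n) {I : Finset ℕ} (h0 : 0 ∈ I) (h1 : 1 ∉ I) :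
    signedSum n (Ascents I) = signedSum n (Ascents (insert 1 (I.erase 0))) := by
  rw [← signedSum_mul_flip hn (Ascents I)]
  refine signedSum_congr fun σ hσ => ?_
  rw [ascents_mul_flip_iff hn I hσ]
  unfold Ascents
  constructor
  · intro h i hi
    rcases Finset.mem_insert.1 hi with rfl | hi
    · simpa using h 0 h0
    · obtain ⟨h2, h3⟩ := Finset.mem_erase.1 hi
      have := h i h3
      rwa [Equiv.swap_apply_of_ne_of_ne h2 (show i ≠ 1 by rintro rfl; exact h1 h3)] at this
  · intro h i hi
    rcases eq_or_ne i 0 with rfl | h2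
    · simpa using h 1 (Finset.mem_insert_self _ _)
    · rw [Equiv.swap_apply_of_ne_of_ne h2 (show i ≠ 1 by rintro rfl; exact h1 hi)]
      exact h i (Finset.mem_insert_of_mem (Finset.mem_erase.2 ⟨h2, hi⟩))

/-- If `0` and `1` belong to `I`, then the sign of the first entry may be prescribed. -/
lemma genFun_eq_signedSum_of_mem (hn : 2 ≤ n) {I : Finset ℕ} (hI : I ⊆ Finset.range n)
    (h0 : 0 ∈ I) (h1 : 1 ∈ I) :
    genFun n I = signedSum n (fun σ => Ascents I σ ∧ 0 < (oneLine σ).getD 0 0) := by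
  have h2 : (2 : ℤ[X]) ≠ 0 := two_ne_zero
  refine mul_left_cancel₀ h2 ?_
  rw [two_mul_genFun hn hI, ← signedSum_and_add (Ascents I) fun σ => 0 < (oneLine σ).getD 0 0,
    two_mul]
  congr 1
  rw [← signedSum_mul_flip hn]
  refine signedSum_congr fun σ hσ => and_congr ?_ ?_
  · rw [ascents_mul_flip_iff hn I hσ]
    unfold Ascents
    constructor
    · intro h i hi
      rcases i with _ | _ | i
      · simpa using h 1 h1
      · simpa using h 0 h0
      · have := h _ hi
        rwa [Equiv.swap_apply_of_ne_of_ne (by omega) (by omega)] at this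
    · intro h i hi
      rcases i with _ | _ | i
      · simpa using h 1 h1
      · simpa using h 0 h0
      · rw [Equiv.swap_apply_of_ne_of_ne (by omega) (by omega)]
        exact h _ hi
  · obtain ⟨x, l, h3, h4, h5⟩ := exists_oneLine_mul_flip hn hσ
    rw [h4, h5]
    simp
    omega

/-- The reduction to words in the case `0 ∉ I`. -/
lemma signedSum_ascents_eq_flagSum (hn : 2 ≤ n) {I : Finset ℕ} {ds : List ℕ}
    (h : ∀ w : List ℤ, w.length = n → ((∀ i ∈ I, IsAscent w i) ↔ Blocks ds w)) :
    signedSum n (Ascents I) = flagSum false false 0 (absVals n) ds := by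
  have hV := isAbsList_absVals n
  rw [signedSum_eq_sum hn (flagWords (absVals n) 0 ds) (nodup_flagWords hV 0 ds), sum_flagWords]
  · rfl
  · exact fun w hw => ((mem_flagWords_iff hV).1 hw).1
  · intro σ hσ
    rw [mem_flagWords_iff hV, Ascents, h _ (length_oneLine σ)]
    simp [hσ.perm_absVals]

/-- The reduction to words in the case `0, 1 ∈ I`. -/
lemma genFun_eq_flagSum (hn : 2 ≤ n) {I : Finset ℕ} (hI : I ⊆ Finset.range n)
    (h0 : 0 ∈ I) (h1 : 1 ∈ I) {c : ℕ} {ds : List ℕ} (hc : c ≤ n)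
    (h : ∀ w : List ℤ, w.length = n → (((∀ i ∈ I, IsAscent w i) ∧ 0 < w.getD 0 0) ↔
      (w.take c).Pairwise (· < ·) ∧ (∀ x ∈ w.take c, 0 < x) ∧ Blocks ds (w.drop c))) :
    genFun n I = flagSum false (par false c) c (absVals n) ds := by
  have hV := isAbsList_absVals n
  rw [genFun_eq_signedSum_of_mem hn hI h0 h1, 
    signedSum_eq_sum hn (flagWords (absVals n) c ds) (nodup_flagWords hV c ds), sum_flagWords]
  · exact fun w hw => ((mem_flagWords_iff hV).1 hw).1
  · intro σ hσ
    rw [mem_flagWords_iff hV, Ascents, h _ (length_oneLine σ), length_oneLine]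
    simp [hσ.perm_absVals, hc]

end

/-! ### The components of `I` and the block sizes -/

lemma comp_union_of_mem_left {K R : Finset ℕ} {b i : ℕ}
    (hK : ∀ i ∈ K, ∀ j ∈ K, Finset.uIcc i j ⊆ K) (hb : ∀ k ∈ K, k < b) (hR : ∀ r ∈ R, b < r)
    (hi : i ∈ K) : comp (K ∪ R) i = K := by
  ext j
  simp only [comp, Finset.mem_filter, Finset.mem_union]
  constructor
  · rintro ⟨h | h, h1⟩
    · exact h
    · have h2 := hb i hi
      have h3 := hR j h
      have h4 : b ∈ K ∪ R := h1 (Finset.mem_uIcc.2 (by omega))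
      rcases Finset.mem_union.1 h4 with h4 | h4
      · exact absurd (hb b h4) (lt_irrefl b)
      · exact absurd (hR b h4) (lt_irrefl b)
  · exact fun h => ⟨Or.inl h, (hK i hi j h).trans Finset.subset_union_left⟩

lemma comp_union_of_mem_right {K R : Finset ℕ} {b i : ℕ}
    (hb : ∀ k ∈ K, k < b) (hR : ∀ r ∈ R, b < r) (hi : i ∈ R) : comp (K ∪ R) i = comp R i := by
  have h0 := hR i hi
  have key : ∀ j, b < j → (Finset.uIcc i j ⊆ K ∪ R ↔ Finset.uIcc i j ⊆ R) := by
    intro j hj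
    refine ⟨fun h x hx => ?_, fun h => h.trans Finset.subset_union_right⟩
    rcases Finset.mem_union.1 (h hx) with h1 | h1
    · have := hb x h1
      rw [Finset.mem_uIcc] at hx
      omega
    · exact h1
  ext j
  simp only [comp, Finset.mem_filter, Finset.mem_union]
  constructor
  · rintro ⟨h | h, h1⟩
    · have h2 := hb j h
      have h4 : b ∈ K ∪ R := h1 (Finset.mem_uIcc.2 (by omega))
      rcases Finset.mem_union.1 h4 with h4 | h4
      · exact absurd (hb b h4) (lt_irrefl b)
      · exact absurd (hR b h4) (lt_irrefl b)
    · exact ⟨h, (key j (hR j h)).1 h1⟩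
  · rintro ⟨h, h1⟩
    exact ⟨Or.inr h, (key j (hR j h)).2 h1⟩

/-- An interval that is separated from the rest of a set is one of its components. -/
lemma components_union {K R : Finset ℕ} {b : ℕ} (hK0 : K.Nonempty)
    (hK : ∀ i ∈ K, ∀ j ∈ K, Finset.uIcc i j ⊆ K) (hb : ∀ k ∈ K, k < b) (hR : ∀ r ∈ R, b < r) :
    components (K ∪ R) = insert K (components R) ∧ K ∉ components R := by
  constructor
  · unfold components
    rw [Finset.image_union, Finset.image_congr (g := comp R)
      fun i hi => comp_union_of_mem_right hb hR hi, Finset.image_congr (g := fun _ => K)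
      fun i hi => comp_union_of_mem_left hK hb hR hi, Finset.image_const hK0, Finset.insert_eq]
  · intro h
    obtain ⟨i, hi, h⟩ := Finset.mem_image.1 h
    obtain ⟨k, hk⟩ := hK0
    have h1 := hb k hk
    rw [← h] at hk
    have h2 := hR k (Finset.mem_filter.1 hk).1
    omega

/-- The multiset of the sizes of the components of a set. -/
def compCards (I : Finset ℕ) : Multiset ℕ := (components I).val.map Finset.card

lemma compCards_union {K R : Finset ℕ} {b : ℕ} (hK0 : K.Nonempty)
    (hK : ∀ i ∈ K, ∀ j ∈ K, Finset.uIcc i j ⊆ K) (hb : ∀ k ∈ K, k < b) (hR : ∀ r ∈ R, b < r) :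
    compCards (K ∪ R) = K.card ::ₘ compCards R := by
  obtain ⟨h1, h2⟩ := components_union hK0 hK hb hR
  rw [compCards, h1, Finset.insert_val_of_notMem h2, Multiset.map_cons, compCards]

lemma pairwise_take_iff {w : List ℤ} {d : ℕ} (hd : d ≤ w.length) :
    (w.take d).Pairwise (· < ·) ↔ ∀ k, k + 1 < d → w.getD k 0 < w.getD (k + 1) 0 := by
  rw [← List.isChain_iff_pairwise, List.isChain_iff_getElem]
  simp only [List.length_take, min_eq_left hd, List.getElem_take]
  refine forall₂_congr fun k hk => ?_
  rw [List.getD_eq_getElem _ _ (by omega), List.getD_eq_getElem _ _ (by omega)]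

lemma oddCount_cons_eq_zero {d : ℕ} {ds : List ℕ} :
    oddCount (d :: ds) = 0 ↔ Even d ∧ oddCount ds = 0 := by
  simp [oddCount, Nat.even_iff]

/-- The conditions imposed by the elements `i` of `I` with `a < i < a + N` say that a word with
letters in the positions `a + 1, …, a + N` consists of increasing blocks. The sizes of the blocks
with at least two letters exceed those of the components of `I` in this range by one. -/
lemma exists_blocks (I : Finset ℕ) (N a : ℕ) : ∃ ds : List ℕ, ds.sum = N ∧
    (∀ w : List ℤ, w.length = N →
      ((∀ i ∈ I, a < i → i < a + N → w.getD (i - a - 1) 0 < w.getD (i - a) 0) ↔ Blocks ds w)) ∧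
    (oddCount ds = 0 ↔ Even N ∧ ∀ i, a < i → i < a + N → Odd (i - a) → i ∈ I) ∧
    compCards (I.filter fun i => a < i ∧ i < a + N) =
      Multiset.filter (· ≠ 0) (ds.map fun d => d - 1 : List ℕ) := by
  induction N using Nat.strong_induction_on generalizing a with
  | _ N ih =>
  rcases Nat.eq_zero_or_pos N with rfl | hN
  · refine ⟨[], rfl, fun w hw => ?_, ?_, ?_⟩
    · rw [List.length_eq_zero_iff] at hw
      exact iff_of_true (fun i _ h1 h2 => absurd h2 (by omega)) hw
    · exact iff_of_true rfl ⟨Even.zero, fun i h1 h2 => absurd h2 (by omega)⟩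
    · rw [Finset.filter_false_of_mem fun i _ => by omega]
      rfl
  have hex : ∃ d, 0 < d ∧ (d = N ∨ a + d ∉ I) := ⟨N, hN, Or.inl rfl⟩
  classical
  -- The first block ends at the first position that is not tied to the next one by `I`.
  obtain ⟨d, ⟨hd0, hd⟩, hmin⟩ : ∃ d, (0 < d ∧ (d = N ∨ a + d ∉ I)) ∧
      ∀ k < d, ¬ (0 < k ∧ (k = N ∨ a + k ∉ I)) :=
    ⟨Nat.find hex, Nat.find_spec hex, fun k hk => Nat.find_min hex hk⟩
  have hdN : d ≤ N := by
    by_contra h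
    exact hmin N (not_le.1 h) ⟨hN, Or.inl rfl⟩
  have hmem : ∀ i, a < i → i < a + d → i ∈ I := by
    intro i h1 h2
    by_contra h
    exact hmin (i - a) (by omega) ⟨by omega, Or.inr (by rwa [show a + (i - a) = i by omega])⟩
  obtain ⟨ds, h1, h2, h3, h4⟩ := ih (N - d) (by omega) (a + d)
  rw [show a + d + (N - d) = a + N by omega] at h2 h3 h4
  have hcut : a + d ∉ I ∨ a + d = a + N := by
    rcases hd with h | h
    · exact Or.inr (by rw [h])
    · exact Or.inl h
  refine ⟨d :: ds, by rw [List.sum_cons, h1]; omega, fun w hw => ?_, ?_, ?_⟩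
  · rw [Blocks, pairwise_take_iff (by omega), ← h2 _ (by rw [List.length_drop, hw])]
    have hg : ∀ k, (w.drop d).getD k 0 = w.getD (d + k) 0 := by
      intro k
      simp [List.getD_eq_getElem?_getD, List.getElem?_drop]
    simp only [hg]
    constructor
    · intro h
      refine ⟨by omega, fun k hk => ?_, fun i hi h5 h6 => ?_⟩
      · have := h (a + k + 1) (hmem _ (by omega) (by omega)) (by omega) (by omega)
        rwa [show a + k + 1 - a - 1 = k by omega, show a + k + 1 - a = k + 1 by omega] at this
      · have := h i hi (by omega) h6
        rwa [show d + (i - (a + d) - 1) = i - a - 1 by omega,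
          show d + (i - (a + d)) = i - a by omega]
    · rintro ⟨-, h5, h6⟩ i hi h7 h8
      rcases lt_trichotomy i (a + d) with h | h | h
      · have := h5 (i - a - 1) (by omega)
        rwa [show i - a - 1 + 1 = i - a by omega] at this
      · exfalso
        subst h
        rcases hcut with h | h
        · exact h hi
        · omega
      · have := h6 i hi h h8
        rwa [show d + (i - (a + d) - 1) = i - a - 1 by omega,
          show d + (i - (a + d)) = i - a by omega] at this
  · rw [oddCount_cons_eq_zero, h3]
    constructor
    · rintro ⟨h5, h6, h7⟩
      refine ⟨by rw [show N = d + (N - d) by omega]; exact h5.add h6, fun i h8 h9 h10 => ?_⟩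
      rcases lt_trichotomy i (a + d) with h | h | h
      · exact hmem i h8 h
      · exfalso
        rw [h, Nat.add_sub_cancel_left] at h10
        exact (Nat.not_odd_iff_even.2 h5) h10
      · refine h7 i h h9 ?_
        rw [Nat.odd_iff] at h10 ⊢
        rw [Nat.even_iff] at h5
        omega
    · rintro ⟨h5, h6⟩
      have h7 : Even d := by
        by_contra h
        rw [Nat.not_even_iff_odd] at h
        rcases hcut with h' | h'
        · refine h' (h6 (a + d) (by omega) ?_ (by rwa [Nat.add_sub_cancel_left]))
          have : d ≠ N := by
            rintro rfl
            exact (Nat.not_odd_iff_even.2 h5) h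
          omega
        · have : d = N := by omega
          rw [this] at h
          exact (Nat.not_odd_iff_even.2 h5) h
      rw [Nat.even_iff] at h5 h7
      refine ⟨Nat.even_iff.2 h7, Nat.even_iff.2 (by omega), fun i h8 h9 h10 => ?_⟩
      refine h6 i (by omega) h9 ?_
      rw [Nat.odd_iff] at h10 ⊢
      omega
  · have hsplit : I.filter (fun i => a < i ∧ i < a + N) =
        Finset.Ioo a (a + d) ∪ I.filter fun i => a + d < i ∧ i < a + N := by
      ext i
      simp only [Finset.mem_filter, Finset.mem_union, Finset.mem_Ioo]
      constructor
      · rintro ⟨hi, h5, h6⟩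
        rcases lt_trichotomy i (a + d) with h | h | h
        · exact Or.inl ⟨h5, h⟩
        · exfalso
          subst h
          rcases hcut with h | h
          · exact h hi
          · omega
        · exact Or.inr ⟨hi, h, h6⟩
      · rintro (⟨h5, h6⟩ | ⟨hi, h5, h6⟩)
        · exact ⟨hmem i h5 h6, h5, by omega⟩
        · exact ⟨hi, by omega, h6⟩
    rw [hsplit, List.map_cons, ← Multiset.cons_coe]
    rcases Nat.lt_or_ge 1 d with h | h
    · rw [compCards_union (b := a + d) ⟨a + 1, by
        rw [Finset.mem_Ioo]; omega⟩ ?_ ?_ ?_, h4,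
        Multiset.filter_cons_of_pos _ (by omega), Nat.card_Ioo, Nat.add_sub_cancel_left]
      · intro i hi j hj x hx
        simp only [Finset.mem_Ioo, Finset.mem_uIcc] at *
        omega
      · exact fun k hk => (Finset.mem_Ioo.1 hk).2
      · exact fun r hr => (Finset.mem_filter.1 hr).2.1
    · obtain rfl : d = 1 := by omega
      rw [Multiset.filter_cons_of_neg _ (by omega), ← h4]
      congr 1
      ext i
      simp only [Finset.mem_union, Finset.mem_Ioo, or_iff_right_iff_imp]
      omega

lemma compCards_prod {M : Type*} [CommMonoid M] (g : ℕ → M) (I : Finset ℕ) :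
    ((compCards I).map g).prod = ∏ J ∈ components I, g J.card := by
  rw [compCards, Multiset.map_map]
  rfl

lemma prod_map_filter_ne_zero {M : Type*} [CommMonoid M] (g : ℕ → M) (hg : g 0 = 1)
    (s : Multiset ℕ) : ((s.filter (· ≠ 0)).map g).prod = (s.map g).prod := by
  induction s using Multiset.induction_on with
  | empty => rfl
  | cons a s ih =>
    by_cases h : a = 0
    · rw [Multiset.filter_cons_of_neg (p := fun x : ℕ => x ≠ 0) _ (by simpa using h), ih, h,
        Multiset.map_cons, Multiset.prod_cons, hg, one_mul]
    · rw [Multiset.filter_cons_of_pos (p := fun x : ℕ => x ≠ 0) _ h, Multiset.map_cons,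
        Multiset.prod_cons, ih, Multiset.map_cons, Multiset.prod_cons]

/-! ### The values of the generating functions -/

/-- The word condition for `0, 1 ∈ I`, where `c` is the size of the component of `0`. -/
lemma ascents_and_pos_iff {n c : ℕ} {I : Finset ℕ} {ds : List ℕ}
    (hI : I ⊆ Finset.range n) (hcI : Finset.range c ⊆ I) (hc : c ∉ I) (hc2 : 2 ≤ c) (hcn : c < n)
    (hds : ∀ w : List ℤ, w.length = n - c →
      ((∀ i ∈ I, c < i → i < c + (n - c) → w.getD (i - c - 1) 0 < w.getD (i - c) 0) ↔
        Blocks ds w)) (w : List ℤ) (hw : w.length = n) :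
    ((∀ i ∈ I, IsAscent w i) ∧ 0 < w.getD 0 0) ↔
      (w.take c).Pairwise (· < ·) ∧ (∀ x ∈ w.take c, 0 < x) ∧ Blocks ds (w.drop c) := by
  have hg : ∀ k, (w.drop c).getD k 0 = w.getD (c + k) 0 := by
    intro k
    simp [List.getD_eq_getElem?_getD, List.getElem?_drop]
  have hpos : ∀ k, k < c → w.getD k 0 ∈ w.take c := by
    intro k hk
    rw [List.getD_eq_getElem _ _ (by omega)]
    exact List.mem_take_iff_getElem.2 ⟨k, by omega, rfl⟩
  rw [← hds _ (by rw [List.length_drop, hw])]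
  simp only [hg]
  constructor
  · rintro ⟨h1, h2⟩
    have h3 : (w.take c).Pairwise (· < ·) := by
      refine (pairwise_take_iff (by omega)).2 fun k hk => ?_
      simpa [IsAscent] using h1 (k + 1) (hcI (Finset.mem_range.2 hk))
    refine ⟨h3, ?_, fun i hi h4 h5 => ?_⟩
    · obtain ⟨c, rfl⟩ : ∃ k, c = k + 1 := ⟨c - 1, by omega⟩
      cases w with
      | nil => simp at h2
      | cons x l =>
        rw [List.take_succ_cons] at h3 ⊢
        intro y hy
        have h2 : 0 < x := by simpa using h2
        rcases List.mem_cons.1 hy with rfl | hy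
        · exact h2
        · exact h2.trans ((List.pairwise_cons.1 h3).1 y hy)
    · have := h1 i hi
      rw [IsAscent, if_neg (by omega)] at this
      rwa [show c + (i - c - 1) = i - 1 by omega, show c + (i - c) = i by omega]
  · rintro ⟨h1, h2, h3⟩
    refine ⟨fun i hi => ?_, h2 _ (hpos 0 (by omega))⟩
    have hin := Finset.mem_range.1 (hI hi)
    rcases Nat.eq_zero_or_pos i with rfl | h0
    · have := h2 _ (hpos 0 (by omega))
      have := h2 _ (hpos 1 (by omega))
      rw [IsAscent, if_pos rfl]
      omega
    rw [IsAscent, if_neg (by omega)]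
    rcases lt_trichotomy i c with h | rfl | h
    · have := (pairwise_take_iff (by omega)).1 h1 (i - 1) (by omega)
      rwa [show i - 1 + 1 = i by omega] at this
    · exact absurd hi hc
    · have := h3 i hi h (by omega)
      rwa [show c + (i - c - 1) = i - 1 by omega, show c + (i - c) = i by omega] at this

lemma IsCyclotomicProduct.of_two_mul {p q : ℤ[X]} (hq : IsCyclotomicProduct q)
    (h : 2 * p = 2 * q) : IsCyclotomicProduct p := by
  rwa [mul_left_cancel₀ (two_ne_zero : (2 : ℤ[X]) ≠ 0) h]

/-- If `0 ∉ I`, the sum over the signed permutations is twice a product of cyclotomic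
polynomials. -/
lemma isCyclotomicProduct_of_two_mul_eq {n : ℕ} (hn : 2 ≤ n) {I : Finset ℕ}
    (hI : I ⊆ Finset.range n) (h0 : 0 ∉ I) {p : ℤ[X]} (hp : 2 * p = signedSum n (Ascents I)) :
    IsCyclotomicProduct p := by
  obtain ⟨ds, h1, h2, -, -⟩ := exists_blocks I n 0
  rw [signedSum_ascents_eq_flagSum hn (ds := ds) fun w hw => ?_] at hp
  · have hV := isAbsList_absVals n
    refine (isCyclotomicProduct_blockProd ds).of_mul ?_
    have hsum := sum_eq_halfSum_oddCount ds
    rcases hk : oddCount ds with _ | k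
    · obtain ⟨m, hm⟩ : ∃ m, halfSum ds = m + 1 := ⟨halfSum ds - 1, by omega⟩
      have h3 := flagSum_even_of_even 0 m (absVals n) hV ds (by rw [length_absVals]; omega) hk hm
      refine (((isCyclotomicProduct_sqProd 0 m).mul ((IsCyclotomicProduct.one_sub_X_pow
        (show 0 < 0 + m + 1 by omega)).pow 2)).mul (IsCyclotomicProduct.one_add_X_pow
        (show 0 < 0 + m + 1 by omega))).of_two_mul ?_
      rw [Nat.mul_zero, ← hp] at h3
      linear_combination h3
    · have h3 := flagSum_even_of_odd 0 k (absVals n) hV ds (by rw [length_absVals]; omega) hk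
      refine ((isCyclotomicProduct_sqProd 0 (halfSum ds)).mul
        (isCyclotomicProduct_singlesProd k (0 + halfSum ds))).of_two_mul ?_
      rw [Nat.mul_zero, ← hp] at h3
      linear_combination h3
  · rw [← h2 w hw]
    refine forall₂_congr fun i hi => ?_
    have hi0 : i ≠ 0 := fun h => h0 (h ▸ hi)
    have hin := Finset.mem_range.1 (hI hi)
    rw [IsAscent, if_neg hi0]
    exact ⟨fun h _ _ => h, fun h => h (by omega) (by omega)⟩

/-- The condition on `n` and `I` under which the generating function is not a product of
cyclotomic polynomials. -/
def IsExceptional (n : ℕ) (I : Finset ℕ) : Prop :=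
  Even n ∧ {0} ∪ (Finset.Icc 1 (n - 1)).filter (fun i => Odd i) ⊆ I

/-- Either the generating function is a product of cyclotomic polynomials, or `0` lies in a
component of even size `2 g`, all other blocks have even sizes `ds` as well, and the generating
function is given by an explicit formula. -/
lemma isCyclotomicProduct_or_exists {n : ℕ} (hn : 2 ≤ n) {I : Finset ℕ}
    (hI : I ⊂ Finset.range n) :
    (¬ IsExceptional n I ∧ IsCyclotomicProduct (genFun n I)) ∨
    (IsExceptional n I ∧ ∃ g m ds, 0 < g ∧ n = 2 * (g + m + 1) ∧ halfSum ds = m + 1 ∧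
      comp I 0 = Finset.range (2 * g) ∧
      compCards I = (2 * g) ::ₘ Multiset.filter (· ≠ 0) (ds.map fun d => d - 1 : List ℕ) ∧
      blockProd ds * genFun n I = sqProd g m * (1 - X ^ (g + m + 1)) ^ 2 *
        (1 + X ^ (2 * g) + 2 * X ^ (g + m + 1))) := by
  have hexc0 : IsExceptional n I → 0 ∈ I := fun h => h.2 (by simp)
  have hexc : IsExceptional n I → ∀ i, i < n → Odd i → i ∈ I := by
    rintro ⟨-, h⟩ i hi hodd
    have := hodd.pos
    exact h (Finset.mem_union_right _ (Finset.mem_filter.2 ⟨Finset.mem_Icc.2 (by omega), hodd⟩))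
  by_cases h0 : 0 ∈ I
  swap
  · exact Or.inl ⟨fun h => h0 (hexc0 h),
      isCyclotomicProduct_of_two_mul_eq hn hI.1 h0 (two_mul_genFun hn hI.1)⟩
  by_cases h1 : 1 ∈ I
  swap
  · refine Or.inl ⟨fun h => h1 (hexc h 1 (by omega) odd_one), ?_⟩
    refine isCyclotomicProduct_of_two_mul_eq hn (I := insert 1 (I.erase 0)) ?_ (by simp) ?_
    · exact Finset.insert_subset (Finset.mem_range.2 (by omega))
        ((Finset.erase_subset _ _).trans hI.1)
    · rw [← signedSum_ascents_swap hn h0 h1, two_mul_genFun hn hI.1]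
  have hex : ∃ c, c ∉ I := ⟨n, fun h => lt_irrefl n (Finset.mem_range.1 (hI.1 h))⟩
  obtain ⟨c, hc, hmin⟩ : ∃ c, c ∉ I ∧ ∀ k < c, k ∈ I :=
    ⟨Nat.find hex, Nat.find_spec hex, fun k hk => not_not.1 (Nat.find_min hex hk)⟩
  have hcn : c < n := by
    by_contra h
    exact hI.2 fun k hk => hmin k (by have := Finset.mem_range.1 hk; omega)
  have hc2 : 2 ≤ c := by
    by_contra h
    rcases (show c = 0 ∨ c = 1 by omega) with rfl | rfl
    exacts [hc h0, hc h1]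
  have hcI : Finset.range c ⊆ I := fun k hk => hmin k (Finset.mem_range.1 hk)
  obtain ⟨ds, hsum, hblocks, hodd, hcards⟩ := exists_blocks I (n - c) c
  have hgen := genFun_eq_flagSum hn hI.1 h0 h1 hcn.le
    (ascents_and_pos_iff hI.1 hcI hc hc2 hcn hblocks)
  have hV := isAbsList_absVals n
  have hlen := length_absVals n
  have hsum' := sum_eq_halfSum_oddCount ds
  rcases Nat.even_or_odd' c with ⟨g, rfl | rfl⟩
  swap
  · rw [par_two_mul_add_one] at hgen
    refine Or.inl ⟨fun h => hc (hexc h _ hcn (odd_two_mul_add_one g)), ?_⟩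
    refine (isCyclotomicProduct_blockProd ds).of_mul ?_
    rw [hgen, Bool.not_false, flagSum_odd g _ hV ds (by omega)]
    exact (isCyclotomicProduct_sqProd _ _).mul (isCyclotomicProduct_singlesProd _ _)
  rw [par_two_mul] at hgen
  rcases hk : oddCount ds with _ | k
  swap
  · refine Or.inl ⟨fun h => ?_, ?_⟩
    · have : oddCount ds = 0 := by
        refine hodd.2 ⟨?_, fun i h2 h3 h4 => hexc h i (by omega) ?_⟩
        · have := h.1
          rw [Nat.even_iff] at this ⊢
          omega
        · rw [Nat.odd_iff] at h4 ⊢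
          omega
      omega
    · refine (isCyclotomicProduct_blockProd ds).of_mul ?_
      rw [hgen, flagSum_even_of_odd g k _ hV ds (by omega) hk]
      exact ((IsCyclotomicProduct.one_add_X_pow (by omega)).mul
        (isCyclotomicProduct_sqProd _ _)).mul (isCyclotomicProduct_singlesProd _ _)
  obtain ⟨m, hm⟩ : ∃ m, halfSum ds = m + 1 := ⟨halfSum ds - 1, by omega⟩
  have hsplit : I = Finset.range (2 * g) ∪
      I.filter fun i => 2 * g < i ∧ i < 2 * g + (n - 2 * g) := by
    ext i
    simp only [Finset.mem_union, Finset.mem_range, Finset.mem_filter]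
    constructor
    · intro hi
      have hin := Finset.mem_range.1 (hI.1 hi)
      rcases lt_trichotomy i (2 * g) with h | rfl | h
      · exact Or.inl h
      · exact absurd hi hc
      · exact Or.inr ⟨hi, h, by omega⟩
    · rintro (h | h)
      · exact hmin i h
      · exact h.1
  have hK : ∀ i ∈ Finset.range (2 * g), ∀ j ∈ Finset.range (2 * g),
      Finset.uIcc i j ⊆ Finset.range (2 * g) := by
    intro i hi j hj x hx
    simp only [Finset.mem_range, Finset.mem_uIcc] at *
    omega
  have hb : ∀ k ∈ Finset.range (2 * g), k < 2 * g := fun k => Finset.mem_range.1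
  have hR : ∀ r ∈ I.filter fun i => 2 * g < i ∧ i < 2 * g + (n - 2 * g), 2 * g < r :=
    fun r hr => (Finset.mem_filter.1 hr).2.1
  have h0c : 0 ∈ Finset.range (2 * g) := Finset.mem_range.2 (by omega)
  refine Or.inr ⟨⟨?_, ?_⟩, g, m, ds, by omega, by omega, hm, ?_, ?_, ?_⟩
  · rw [Nat.even_iff]; omega
  · intro i hi
    rcases Finset.mem_union.1 hi with hi | hi
    · rw [Finset.mem_singleton.1 hi]
      exact h0
    · obtain ⟨h2, h3⟩ := Finset.mem_filter.1 hi
      rw [Finset.mem_Icc] at h2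
      rw [Nat.odd_iff] at h3
      rcases Nat.lt_or_ge i (2 * g) with h | h
      · exact hmin i h
      · exact (hodd.1 hk).2 i (by omega) (by omega) (Nat.odd_iff.2 (by omega))
  · conv_lhs => rw [hsplit]
    exact comp_union_of_mem_left hK hb hR h0c
  · conv_lhs => rw [hsplit]
    rw [compCards_union ⟨0, h0c⟩ hK hb hR, hcards, Finset.card_range]
  · rw [hgen]
    exact flagSum_even_of_even g m _ hV ds (by omega) hk hm

/-! ### The explicit formula -/

lemma qProd_mul_qProd_dvd (a b : ℕ) : qProd a * qProd b ∣ qProd (a + b) := by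
  induction a generalizing b with
  | zero => simp
  | succ a iha =>
    induction b with
    | zero => simp
    | succ b ihb =>
      obtain ⟨P, hP⟩ := iha (b + 1)
      obtain ⟨Q, hQ⟩ := ihb
      refine ⟨P + X ^ (2 * (a + 1)) * Q, ?_⟩
      rw [show a + 1 + b = a + (b + 1) by omega] at hQ
      rw [show a + 1 + (b + 1) = a + (b + 1) + 1 by omega, qProd_succ (a + (b + 1))]
      have e1 := qProd_succ a
      have e2 := qProd_succ b
      have e3 : (X : ℤ[X]) ^ (2 * (a + (b + 1) + 1)) = X ^ (2 * (a + 1)) * X ^ (2 * (b + 1)) := by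
        ring
      -- The `q`-Pascal rule: split `1 - y^{a+b+2}` as `(1 - y^{a+1}) + y^{a+1} (1 - y^{b+1})`.
      rw [e3]
      linear_combination (1 - X ^ (2 * (a + 1))) * hP +
        X ^ (2 * (a + 1)) * (1 - X ^ (2 * (b + 1))) * hQ -
        qProd (b + 1) * P * e1 - X ^ (2 * (a + 1)) * qProd (a + 1) * Q * e2

/-- The `q`-multinomial coefficients are polynomials. -/
lemma qProd_mul_blockProd_dvd (g : ℕ) (ds : List ℕ) :
    qProd g * blockProd ds ∣ qProd (g + halfSum ds) := by
  induction ds generalizing g with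
  | nil => simp [blockProd, halfSum]
  | cons d ds ih =>
    have h := (mul_dvd_mul_right (qProd_mul_qProd_dvd g (d / 2)) (blockProd ds)).trans
      (ih (g + d / 2))
    simpa [blockProd, halfSum, mul_assoc, add_assoc] using h

lemma qFactorial_eq (k : ℕ) : qFactorial (RatFunc.X ^ 2) k =
    algebraMap ℤ[X] (RatFunc ℤ) (qProd k) / (1 - RatFunc.X ^ 2) ^ k := by
  induction k with
  | zero => simp [qFactorial]
  | succ k ih =>
    rw [qFactorial] at ih ⊢
    rw [Finset.prod_Icc_succ_top (by omega), ih, qNum, qProd_succ, div_mul_div_comm, ← pow_succ,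
      map_mul, map_sub, map_one, map_pow, RatFunc.algebraMap_X, pow_mul]

lemma one_sub_X_sq_ne_zero : (1 - RatFunc.X ^ 2 : RatFunc ℤ) ≠ 0 := by
  have h : (1 - X ^ 2 : ℤ[X]) ≠ 0 := by
    intro h
    have := congrArg (Polynomial.eval 0) h
    simp at this
  have := (map_ne_zero_iff _ (RatFunc.algebraMap_injective ℤ)).2 h
  simpa [RatFunc.algebraMap_X] using this

lemma prod_components_eq {M : Type*} [CommMonoid M] (f : ℕ → M) (hf : f 0 = 1) {I : Finset ℕ}
    {g : ℕ} {ds : List ℕ}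
    (h : compCards I = (2 * g) ::ₘ Multiset.filter (· ≠ 0) (ds.map fun d => d - 1 : List ℕ)) :
    ∏ J ∈ components I, f ((J.card + 1) / 2) = f g * (ds.map fun d => f (d / 2)).prod := by
  rw [← compCards_prod (fun k => f ((k + 1) / 2)), h, Multiset.map_cons, Multiset.prod_cons,
    prod_map_filter_ne_zero _ (by simpa using hf), Multiset.map_coe, Multiset.prod_coe,
    List.map_map, show (2 * g + 1) / 2 = g by omega]
  congr 2
  refine List.map_congr_left fun d _ => ?_
  rw [Function.comp_apply]
  congr 1
  omega

lemma m_eq {I : Finset ℕ} {g : ℕ} {ds : List ℕ}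
    (h : compCards I = (2 * g) ::ₘ Multiset.filter (· ≠ 0) (ds.map fun d => d - 1 : List ℕ)) :
    m I = g + halfSum ds := by
  have h1 := prod_components_eq (fun k => Multiplicative.ofAdd k) rfl h
  have h2 : ∀ l : List ℕ, (l.map fun d => Multiplicative.ofAdd (d / 2)).prod =
      Multiplicative.ofAdd (halfSum l) := by
    intro l
    induction l with
    | nil => rfl
    | cons d l ih =>
      rw [List.map_cons, List.prod_cons, ih, ← ofAdd_add]
      rfl
  rw [h2, ← ofAdd_add, ← ofAdd_sum] at h1
  exact Multiplicative.ofAdd.injective h1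

lemma algebraMap_eq_C {I : Finset ℕ} {g : ℕ} {ds : List ℕ}
    (h : compCards I = (2 * g) ::ₘ Multiset.filter (· ≠ 0) (ds.map fun d => d - 1 : List ℕ))
    {P : ℤ[X]} (hP : qProd (g + halfSum ds) = qProd g * blockProd ds * P) :
    algebraMap ℤ[X] (RatFunc ℤ) P = C I := by
  have h2 : ∀ l : List ℕ, (l.map fun d => qFactorial (RatFunc.X ^ 2) (d / 2)).prod =
      algebraMap ℤ[X] (RatFunc ℤ) (blockProd l) / (1 - RatFunc.X ^ 2) ^ halfSum l := by
    intro l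
    induction l with
    | nil => simp [blockProd, halfSum]
    | cons d l ih =>
      rw [List.map_cons, List.prod_cons, ih, qFactorial_eq, div_mul_div_comm, ← map_mul, ← pow_add]
      simp [blockProd, halfSum]
  have h3 := one_sub_X_sq_ne_zero
  have h4 : algebraMap ℤ[X] (RatFunc ℤ) (qProd g * blockProd ds) ≠ 0 := by
    rw [map_ne_zero_iff _ (RatFunc.algebraMap_injective ℤ)]
    intro h5
    rw [h5, zero_mul] at hP
    exact qProd_ne_zero _ hP
  rw [C, m_eq h, prod_components_eq _ (by simp [qFactorial]) h, h2, qFactorial_eq, qFactorial_eq,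
    div_mul_div_comm, ← map_mul, ← pow_add, div_div_div_cancel_right₀ (pow_ne_zero _ h3),
    eq_div_iff h4, ← map_mul, hP, mul_comm]

/-- The factors of the formula pair up to the factors `1 - x^{2j}` with `g < j ≤ g + m + 1`. -/
lemma prod_one_add_mul (g m : ℕ) :
    (∏ i ∈ Finset.Icc (2 * g + 2) (2 * (g + m + 1)), (1 + (-1) ^ (i - 1) * X ^ (i / 2) : ℤ[X])) *
      (1 + X ^ (g + m + 1)) = ∏ j ∈ Finset.range (m + 1), (1 - X ^ (2 * (g + j + 1))) := by
  induction m with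
  | zero =>
    rw [show 2 * (g + 0 + 1) = 2 * g + 2 by ring, Finset.Icc_self, Finset.prod_singleton,
      Finset.prod_range_one, show (2 * g + 2) / 2 = g + 1 by omega,
      show 2 * g + 2 - 1 = 2 * g + 1 by omega, (odd_two_mul_add_one g).neg_one_pow]
    ring
  | succ m ih =>
    rw [Finset.prod_range_succ, ← ih, show 2 * (g + (m + 1) + 1) = 2 * (g + m + 1) + 1 + 1 by ring,
      Finset.prod_Icc_succ_top (by omega), Finset.prod_Icc_succ_top (by omega),
      show (2 * (g + m + 1) + 1 + 1) / 2 = g + m + 2 by omega,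
      show (2 * (g + m + 1) + 1) / 2 = g + m + 1 by omega, Nat.add_sub_cancel, Nat.add_sub_cancel,
      (odd_two_mul_add_one _).neg_one_pow, (even_two_mul _).neg_one_pow]
    ring

lemma one_add_X_pow_succ_ne_zero (k : ℕ) : (1 + X ^ (k + 1) : ℤ[X]) ≠ 0 := by
  intro h
  have := congrArg (Polynomial.eval 0) h
  simp at this

lemma qProd_mul_prod (g m : ℕ) :
    qProd g * ∏ j ∈ Finset.range m, (1 - X ^ (2 * (g + j + 1))) = qProd (g + m) := by
  rw [qProd, qProd, Finset.prod_range_add]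

/-- The formula in `ℤ[x]`, with the `q`-multinomial coefficient `P` and without denominators. -/
lemma genFun_mul_eq {f P : ℤ[X]} {g m : ℕ} {ds : List ℕ} (hm : halfSum ds = m + 1)
    (hP : qProd (g + halfSum ds) = qProd g * blockProd ds * P)
    (h : blockProd ds * f = sqProd g m * (1 - X ^ (g + m + 1)) ^ 2 *
      (1 + X ^ (2 * g) + 2 * X ^ (g + m + 1))) :
    f * (1 + X ^ (g + m + 1)) = P * (1 + X ^ (2 * g) + 2 * X ^ (g + m + 1)) *
      ∏ i ∈ Finset.Icc (2 * g + 2) (2 * (g + m + 1)), (1 + (-1) ^ (i - 1) * X ^ (i / 2)) := by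
  have hB : blockProd ds ≠ 0 := by
    intro h0
    rw [h0, mul_zero, zero_mul] at hP
    exact qProd_ne_zero _ hP
  have hS : (1 + X ^ (g + m + 1) : ℤ[X]) ≠ 0 := one_add_X_pow_succ_ne_zero _
  have h1 := prod_one_add_mul g m
  have h2 : blockProd ds * P = ∏ j ∈ Finset.range (m + 1), (1 - X ^ (2 * (g + j + 1))) := by
    refine mul_left_cancel₀ (qProd_ne_zero g) ?_
    rw [qProd_mul_prod, ← mul_assoc, ← hP, hm]
  have h3 : sqProd g m = (∏ j ∈ Finset.range m, (1 - X ^ (2 * (g + j + 1)))) ^ 2 := by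
    rw [sqProd, Finset.prod_pow]
  rw [Finset.prod_range_succ] at h1 h2
  rw [h3] at h
  set E : ℤ[X] := ∏ j ∈ Finset.range m, (1 - X ^ (2 * (g + j + 1)))
  set Q : ℤ[X] := ∏ i ∈ Finset.Icc (2 * g + 2) (2 * (g + m + 1)),
    (1 + (-1) ^ (i - 1) * X ^ (i / 2))
  have h4 : (X : ℤ[X]) ^ (2 * (g + m + 1)) = (X ^ (g + m + 1)) ^ 2 := by ring
  rw [h4] at h1 h2
  set s : ℤ[X] := X ^ (g + m + 1)
  set T : ℤ[X] := 1 + X ^ (2 * g) + 2 * s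
  refine mul_left_cancel₀ (mul_ne_zero hB hS) ?_
  linear_combination (1 + s) ^ 2 * h - (1 + s) * T * Q * h2 - T * E * (1 - s ^ 2) * h1

end TypeD

theorem theorem6p2 (n : ℕ) (hn : 2 ≤ n) (I : Finset ℕ) (hI : I ⊂ Finset.range n) :
    (¬ TypeD.IsCyclotomicProduct (TypeD.genFun n I) ↔
      Even n ∧ {0} ∪ (Finset.Icc 1 (n - 1)).filter (fun i => Odd i) ⊆ I) ∧
    (¬ TypeD.IsCyclotomicProduct (TypeD.genFun n I) →
      -- the explicit formula
      (algebraMap ℤ[X] (RatFunc ℤ) (TypeD.genFun n I) =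
        TypeD.C I *
          ((1 + RatFunc.X ^ (TypeD.comp I 0).card + 2 * RatFunc.X ^ (n / 2)) /
            (1 + RatFunc.X ^ (n / 2))) *
          ∏ i ∈ Finset.Icc ((TypeD.comp I 0).card + 2) n,
            (1 + (-1) ^ (i - 1) * RatFunc.X ^ (i / 2))) ∧
      -- all factors but the trinomial are products of cyclotomic polynomials, up to sign
      (∃ c : ℤ[X], TypeD.IsCyclotomicProduct c ∧ algebraMap ℤ[X] (RatFunc ℤ) c = TypeD.C I) ∧
      TypeD.IsCyclotomicProduct (1 + X ^ (n / 2)) ∧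
      (∀ i ∈ Finset.Icc ((TypeD.comp I 0).card + 2) n,
        TypeD.IsCyclotomicProduct (1 + (-1) ^ (i - 1) * X ^ (i / 2))) ∧
      -- the trinomial `x^a + 2 x^b + 1`, with positive `a` and `b`, is not
      0 < (TypeD.comp I 0).card ∧ 0 < n / 2 ∧
      ¬ TypeD.IsCyclotomicProduct
        (X ^ (TypeD.comp I 0).card + 2 * X ^ (n / 2) + 1)) := by
  rcases TypeD.isCyclotomicProduct_or_exists hn hI with
    ⟨h1, h2⟩ | ⟨h1, g, m, ds, hg, hnm, hm, hcomp, hcards, hgen⟩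
  · exact ⟨iff_of_false (fun h => h h2) h1, fun h => absurd h2 h⟩
  obtain ⟨P, hP⟩ := TypeD.qProd_mul_blockProd_dvd g ds
  have hn2 : n / 2 = g + m + 1 := by omega
  have htri := TypeD.not_isCyclotomicProduct_trinomial (a := 2 * g) (b := g + m + 1) (by omega)
    (by omega) (by omega)
  have hnot : ¬ TypeD.IsCyclotomicProduct (TypeD.genFun n I) := by
    intro h
    refine htri ?_
    have h2 := (TypeD.isCyclotomicProduct_blockProd ds).mul h
    rw [hgen] at h2
    have h3 := ((TypeD.isCyclotomicProduct_sqProd g m).mul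
      ((TypeD.IsCyclotomicProduct.one_sub_X_pow (show 0 < g + m + 1 by omega)).pow 2)).of_mul h2
    rwa [show (X ^ (2 * g) + 2 * X ^ (g + m + 1) + 1 : ℤ[X]) =
      1 + X ^ (2 * g) + 2 * X ^ (g + m + 1) by ring]
  rw [hn2, hcomp, Finset.card_range]
  have hPC := TypeD.algebraMap_eq_C hcards hP
  refine ⟨iff_of_true hnot h1, fun _ => ⟨?_, ⟨P, ?_, hPC⟩, .one_add_X_pow (by omega), ?_, by omega,
    by omega, htri⟩⟩
  · have hS : (1 + RatFunc.X ^ (g + m + 1) : RatFunc ℤ) ≠ 0 := by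
      have h : (1 + X ^ (g + m + 1) : ℤ[X]) ≠ 0 := TypeD.one_add_X_pow_succ_ne_zero _
      have := (map_ne_zero_iff _ (RatFunc.algebraMap_injective ℤ)).2 h
      simpa [RatFunc.algebraMap_X] using this
    have h2 := congrArg (algebraMap ℤ[X] (RatFunc ℤ)) (TypeD.genFun_mul_eq hm hP hgen)
    simp only [map_mul, map_add, map_one, map_pow, map_prod, map_neg, map_ofNat,
      RatFunc.algebraMap_X, hPC] at h2
    rw [mul_div_assoc', div_mul_eq_mul_div, eq_div_iff hS, h2, ← hnm]
  · refine ((TypeD.isCyclotomicProduct_qProd g).mul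
      (TypeD.isCyclotomicProduct_blockProd ds)).of_mul ?_
    rw [← hP]
    exact TypeD.isCyclotomicProduct_qProd _
  · intro i hi
    rw [Finset.mem_Icc] at hi
    rcases Nat.even_or_odd (i - 1) with h | h
    · rw [h.neg_one_pow, one_mul]
      exact .one_add_X_pow (by omega)
    · rw [h.neg_one_pow, neg_one_mul, ← sub_eq_add_neg]
      exact .one_sub_X_pow (by omega)
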